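/- Let $n\ge 2$ and let $\mathbb{H}^n=\{x\in\mathbb{R}^{n+1}: x_0^2-x_1^2-\cdots-x_n^2=1,\ x_0>0\}$ be hyperbolic space, with geodesic distance $d(x,y)=\cosh^{-1}(x_0y_0-x_1y_1-\cdots-x_ny_n)$, canonical volume measure $\mathrm{d}x$, Laplace--Beltrami operator $\Delta$ and vertex $v=(1,0,\dots,0)$. Let $G(x,y)=\Phi(d(x,y))$ be the Green's function of $-\Delta$, where $$\Phi(\theta)=\frac{1}{n\alpha(n)}\int_\theta^\infty\frac{\mathrm{d}\zeta}{\sinh^{n-1}\zeta}\in(0,\infty],$$ with $\alpha(n)$ the volume of the unit ball of $\mathbb{R}^n$ (so $\Phi(0)=\infty$). Let $A:[0,\infty)\to\mathbb{R}$ be continuous on $[0,\infty)$ and $C^2$ on $(0,\infty)$, with $\Delta_xA(d(x,y))>0$ for all $x\ne y$ in $\mathbb{H}^n$, and put $K(x,y)=G(x,y)+A(d(x,y))$. For a probability measure $\mu$ on $\mathbb{H}^n$ let $E[\mu]=\frac12\iint K(x,y)\,\mathrm{d}\mu(x)\,\mathrm{d}\mu(y)$. Call a probability measure $\mu$ with finite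 second moment $\int d(x,v)^2\,\mathrm{d}\mu(x)<\infty$ a local minimizer of $E$ if there is $\epsilon>0$ such that $E[\sigma]\ge E[\mu]$ for every probability measure $\sigma$ with finite second moment whose $2$-Wasserstein distance (with respect to $d$) to $\mu$ is less than $\epsilon$. Let $\mu=\rho(x)\,\mathrm{d}x$ be a local minimizer of $E$ that is absolutely continuous with respect to the volume measure, with a density $\rho\ge0$ that is bounded and radially symmetric, i.e. $\rho(x)$ depends only on $d(v,x)$ (both up to null sets). Then there is $R>0$ such that the support of $\rho$ is the closed geodesic ball centred at the vertex: $$\operatorname{supp}(\rho)=\{x\in\mathbb{H}^n: d(v,x)\le R\}.$$ -/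

import Mathlib

open MeasureTheory Set
open scoped ENNReal

/-- `ℝⁿ⁺¹`, written as `ℝ × ℝⁿ`: the zeroth coordinate and the remaining ones. -/
abbrev MinkowskiSpace (n : ℕ) : Type := ℝ × EuclideanSpace ℝ (Fin n)

/-- The Lorentzian product `⟨x, y⟩ = x₀ y₀ - x₁ y₁ - ⋯ - xₙ yₙ`. -/
noncomputable def lorentz {n : ℕ} (x y : MinkowskiSpace n) : ℝ :=
  x.1 * y.1 - inner ℝ x.2 y.2

/-- Hyperbolic space `ℍⁿ` as the upper sheet `⟨x, x⟩ = 1`, `x₀ > 0` of the hyperboloid, with the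
topology and the Borel sets induced from `ℝⁿ⁺¹`. (The Euclidean metric of the ambient space is
not used; the geodesic distance is `hypDist` below.) -/
abbrev HypSpace (n : ℕ) : Type := {x : MinkowskiSpace n // lorentz x x = 1 ∧ 0 < x.1}

/-- The geodesic distance `d(x, y) = cosh⁻¹ ⟨x, y⟩`. -/
noncomputable def hypDist {n : ℕ} (x y : HypSpace n) : ℝ :=
  Real.arcosh (lorentz x.1 y.1)

/-- The vertex `v = (1, 0, …, 0)`. -/
noncomputable def vertex (n : ℕ) : HypSpace n :=
  ⟨(1, 0), by simp [lorentz]⟩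

/-- Polar coordinates `(ξ, θ) ↦ (cosh θ, sinh θ ξ)`. -/
noncomputable def polar {n : ℕ} (p : Metric.sphere (0 : EuclideanSpace ℝ (Fin n)) 1 × ℝ) :
    HypSpace n :=
  ⟨(Real.cosh p.2, Real.sinh p.2 • (p.1 : EuclideanSpace ℝ (Fin n))), by
    have h : ‖(p.1 : EuclideanSpace ℝ (Fin n))‖ = 1 := norm_eq_of_mem_sphere p.1
    refine ⟨?_, Real.cosh_pos _⟩
    simp only [lorentz, real_inner_self_eq_norm_sq, norm_smul, h, mul_one, Real.norm_eq_abs,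
      sq_abs]
    nlinarith [Real.cosh_sq p.2]⟩

/-- The canonical volume measure, `dx = sinhⁿ⁻¹ θ dσ(ξ) dθ` in polar coordinates, where `σ` is the
surface measure of the unit sphere of `ℝⁿ`. -/
noncomputable def hypVolume (n : ℕ) : Measure (HypSpace n) :=
  Measure.map polar
    (((volume : Measure (EuclideanSpace ℝ (Fin n))).toSphere).prod
      (((volume : Measure ℝ).restrict (Ioi 0)).withDensity
        fun θ => ENNReal.ofReal (Real.sinh θ ^ (n - 1))))

/-- The vector `eᵢ(x) = (xᵢ, eᵢ + xᵢ / (1 + x₀) (x₁, …, xₙ))`. The vectors `e₁(x), …, eₙ(x)` form an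
orthonormal basis of the tangent space of `ℍⁿ` at `x`. -/
noncomputable def frame {n : ℕ} (x : HypSpace n) (i : Fin n) : MinkowskiSpace n :=
  (x.1.2 i, EuclideanSpace.single i 1 + (x.1.2 i / (1 + x.1.1)) • x.1.2)

theorem HypSpace.norm_sq {n : ℕ} (x : HypSpace n) : ‖x.1.2‖ ^ 2 = x.1.1 ^ 2 - 1 := by
  have h := x.2.1
  simp only [lorentz, real_inner_self_eq_norm_sq] at h
  linarith

theorem lorentz_frame_right {n : ℕ} (x : HypSpace n) (i : Fin n) :
    lorentz x.1 (frame x i) = 0 := by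
  have h0 : (1 + x.1.1) ≠ 0 := by have := x.2.2; positivity
  simp only [lorentz, frame, inner_add_right, inner_smul_right, real_inner_self_eq_norm_sq,
    x.norm_sq, EuclideanSpace.inner_single_right]
  simp
  field_simp
  ring

theorem lorentz_frame_frame {n : ℕ} (x : HypSpace n) (i j : Fin n) :
    lorentz (frame x i) (frame x j) = if i = j then -1 else 0 := by
  have h0 : (1 + x.1.1) ≠ 0 := by have := x.2.2; positivity
  simp only [lorentz, frame, inner_add_right, inner_add_left, inner_smul_right, inner_smul_left,
    real_inner_self_eq_norm_sq, x.norm_sq, EuclideanSpace.inner_single_right,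
    EuclideanSpace.inner_single_left]
  by_cases hij : i = j
  · subst hij
    simp
    field_simp
    ring
  · simp [hij, Ne.symm hij]
    field_simp
    ring

/-- The unit speed geodesic `t ↦ cosh t x + sinh t eᵢ(x)` through `x` with velocity `eᵢ(x)`. -/
noncomputable def geodesic {n : ℕ} (x : HypSpace n) (i : Fin n) (t : ℝ) : HypSpace n :=
  ⟨Real.cosh t • x.1 + Real.sinh t • frame x i, by
    constructor
    · have h1 := lorentz_frame_right x i
      have h2 := lorentz_frame_frame x i i
      have h3 := x.2.1
      have h4 := Real.cosh_sq t
      simp only [if_true] at h2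
      have key : lorentz (Real.cosh t • x.1 + Real.sinh t • frame x i)
          (Real.cosh t • x.1 + Real.sinh t • frame x i) =
          Real.cosh t ^ 2 * lorentz x.1 x.1 + 2 * Real.cosh t * Real.sinh t * lorentz x.1 (frame x i)
            + Real.sinh t ^ 2 * lorentz (frame x i) (frame x i) := by
        simp only [lorentz, Prod.fst_add, Prod.snd_add, Prod.smul_fst, Prod.smul_snd, smul_eq_mul,
          inner_add_left, inner_add_right, inner_smul_left, inner_smul_right,
          real_inner_comm x.1.2 (frame x i).2, conj_trivial]
        ring
      rw [key, h1, h2, h3]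
      linarith
    · have h1 : |x.1.2 i| ≤ ‖x.1.2‖ := by simpa using PiLp.norm_apply_le x.1.2 i
      have h2 : |x.1.2 i| < x.1.1 := by
        refine lt_of_le_of_lt h1 (lt_of_pow_lt_pow_left₀ 2 x.2.2.le ?_)
        rw [x.norm_sq]; linarith
      have h3 : |Real.sinh t| < Real.cosh t := by
        refine abs_lt_of_sq_lt_sq ?_ (Real.cosh_pos t).le
        rw [Real.cosh_sq]; linarith
      have h4 : |Real.sinh t * x.1.2 i| < Real.cosh t * x.1.1 := by
        rw [abs_mul]
        exact mul_lt_mul'' h3 h2 (abs_nonneg _) (abs_nonneg _)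
      have h5 := (abs_lt.1 h4).1
      simp only [Prod.fst_add, Prod.smul_fst, smul_eq_mul, frame]
      linarith⟩

/-- The Laplace–Beltrami operator of `ℍⁿ` (for functions that are `C²` near `x`): the trace of the
Riemannian Hessian, that is, the sum of the second derivatives of `f` along the geodesics that start
at `x` in the directions of an orthonormal basis of the tangent space. -/
noncomputable def laplaceBeltrami {n : ℕ} (f : HypSpace n → ℝ) (x : HypSpace n) : ℝ :=
  ∑ i : Fin n, deriv (deriv fun t : ℝ => f (geodesic x i t)) 0

/-- The profile of the Green's function,
`Φ(θ) = (n α(n))⁻¹ ∫_θ^∞ sinh^{-(n-1)} ζ dζ`, with `α(n)` the volume of the unit ball of `ℝⁿ`. It is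
`[0, ∞]`-valued, with `Φ(0) = ∞` if `n ≥ 2`. -/
noncomputable def greenProfile (n : ℕ) (θ : ℝ) : ℝ≥0∞ :=
  (∫⁻ ζ in Ioi θ, ENNReal.ofReal (1 / Real.sinh ζ ^ (n - 1))) /
    (n * volume (Metric.ball (0 : EuclideanSpace ℝ (Fin n)) 1))

/-- The interaction potential `K(x, y) = G(x, y) + A(d(x, y))`, where `G(x, y) = Φ(d(x, y))`. It is
`+∞` on the diagonal if `n ≥ 2`. -/
noncomputable def newtonPotential {n : ℕ} (A : ℝ → ℝ) (x y : HypSpace n) : EReal :=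
  (greenProfile n (hypDist x y) : EReal) + (A (hypDist x y) : EReal)

/-- The interaction energy `E[μ] = ½ ∬ K dμ dμ`, the integral of the positive part minus the
integral of the negative part. -/
noncomputable def interactionEnergy {n : ℕ} (K : HypSpace n → HypSpace n → EReal)
    (μ : Measure (HypSpace n)) : EReal :=
  ((1 / 2 : ℝ) : EReal) *
    (((∫⁻ p, (K p.1 p.2).toENNReal ∂(μ.prod μ) : ℝ≥0∞) : EReal) -
      ((∫⁻ p, (-(K p.1 p.2)).toENNReal ∂(μ.prod μ) : ℝ≥0∞) : EReal))

/-- Membership in `𝒫₂(ℍⁿ)`: probability measures with finite second moment. -/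
def IsP2 {n : ℕ} (μ : Measure (HypSpace n)) : Prop :=
  IsProbabilityMeasure μ ∧ ∫⁻ x, ENNReal.ofReal (hypDist x (vertex n) ^ 2) ∂μ < ∞

/-- The `2`-Wasserstein distance for the geodesic distance. -/
noncomputable def wasserstein {n : ℕ} (μ σ : Measure (HypSpace n)) : ℝ≥0∞ :=
  (⨅ π ∈ {π : Measure (HypSpace n × HypSpace n) | π.map Prod.fst = μ ∧ π.map Prod.snd = σ},
    ∫⁻ p, ENNReal.ofReal (hypDist p.1 p.2 ^ 2) ∂π) ^ (1 / 2 : ℝ)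

/-- `μ ∈ 𝒫₂(ℍⁿ)` is a local minimizer of the interaction energy with respect to the
`2`-Wasserstein distance. -/
def IsLocalEnergyMinimizer {n : ℕ} (K : HypSpace n → HypSpace n → EReal)
    (μ : Measure (HypSpace n)) : Prop :=
  IsP2 μ ∧ ∃ ε : ℝ, 0 < ε ∧ ∀ σ : Measure (HypSpace n), IsP2 σ →
    wasserstein μ σ < ENNReal.ofReal ε → interactionEnergy K μ ≤ interactionEnergy K σ

/-- The measure `ρ(x) dx` with density `ρ`. -/
noncomputable def densityMeasure {n : ℕ} (ρ : HypSpace n → ℝ) : Measure (HypSpace n) :=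
  (hypVolume n).withDensity fun x => ENNReal.ofReal (ρ x)

/-- `ρ` is (almost everywhere) a function of the distance to the vertex. -/
def IsRadial {n : ℕ} (ρ : HypSpace n → ℝ) : Prop :=
  ∃ f : ℝ → ℝ, ∀ᵐ x ∂(hypVolume n), ρ x = f (hypDist (vertex n) x)

open Filter Topology

/-! Write κ = `greenConst n`, T = `greenTail n` and b(cosh θ) = A(θ) - A(0). In the variable C =
cosh d(x, y) the Laplacian becomes (C² - 1) b'' + n C b'. It is positive for b and zero for the
Green's profile away from C = 1. Everything rests on these two facts and a maximum principle for
averages over geodesic spheres (`SubharmonicProfile.exists_lt`).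

A radial measure is encoded by the law τ of the distance to the vertex. Averaging K - A(0) over two
spheres of radii r ≠ s gives κ T(max r s) plus the average of b, by Newton's theorem
(`sphereAvg_greenCosh`). Call this kernel k(r, s) and put Λ(r) = ∫ k(r, s) dτ(s). Transferring a
small fraction of the mass to any bounded region costs little Wasserstein distance, so a local
minimizer satisfies the Euler–Lagrange conditions globally: Λ ≥ L on (0, ∞), with equality on supp τ
(`exists_radialPotential_eq_on_support`).

No gaps (`mem_support_of_lt`): in a gap of supp τ the Green part of Λ is affine in T and the b part
is strictly convex in T. Hence Λ < L inside a gap whose ends both lie in the support. In a gap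
reaching down to the vertex Λ is strictly increasing, so again Λ < L. Thus supp τ is downward closed
in (0, ∞).

Boundedness (`not_forall_radialPotential_eq`): otherwise Λ = L on all of (0, ∞). Letting r → ∞ gives
b ≤ L, so h(r) = L - b(cosh r) is nonnegative and strictly concave in T, and h/T is strictly
increasing in r. If h/T exceeds κ somewhere, with value c, then averaging b ≤ L - cT shows that c
times the mass far inside radius r is at most κ, and r → ∞ gives c ≤ κ, a contradiction. If h/T ≤ κ
everywhere, then h/T < κ everywhere, so κ T + b > L off the diagonal and Λ(1) > L. -/

/-! ### Distance, polar coordinates and geodesics on the hyperboloid. -/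

theorem lorentz_comm {n : ℕ} (x y : MinkowskiSpace n) : lorentz x y = lorentz y x := by
  simp only [lorentz, real_inner_comm, mul_comm]

theorem continuous_lorentz {n : ℕ} :
    Continuous fun p : MinkowskiSpace n × MinkowskiSpace n => lorentz p.1 p.2 := by
  unfold lorentz
  fun_prop

theorem HypSpace.one_le_fst {n : ℕ} (x : HypSpace n) : 1 ≤ x.1.1 := by
  have h := x.norm_sq
  have h' := x.2.2
  nlinarith [sq_nonneg ‖x.1.2‖]

theorem one_le_lorentz {n : ℕ} (x y : HypSpace n) : 1 ≤ lorentz x.1 y.1 := by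
  have hx := x.norm_sq
  have hy := y.norm_sq
  have hx1 := x.one_le_fst
  have hy1 := y.one_le_fst
  have h : inner ℝ x.1.2 y.1.2 ≤ ‖x.1.2‖ * ‖y.1.2‖ := real_inner_le_norm _ _
  have h2 : ‖x.1.2‖ * ‖y.1.2‖ ≤ x.1.1 * y.1.1 - 1 := by
    refine abs_le_of_sq_le_sq' ?_ (by nlinarith) |>.2
    rw [mul_pow, hx, hy]
    nlinarith [sq_nonneg (x.1.1 - y.1.1)]
  unfold lorentz
  linarith

theorem cosh_hypDist {n : ℕ} (x y : HypSpace n) : Real.cosh (hypDist x y) = lorentz x.1 y.1 :=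
  Real.cosh_arcosh (one_le_lorentz x y)

theorem hypDist_nonneg {n : ℕ} (x y : HypSpace n) : 0 ≤ hypDist x y :=
  Real.arcosh_nonneg (one_le_lorentz x y)

theorem hypDist_comm {n : ℕ} (x y : HypSpace n) : hypDist x y = hypDist y x := by
  unfold hypDist; rw [lorentz_comm]

theorem continuous_hypDist {n : ℕ} :
    Continuous fun p : HypSpace n × HypSpace n => hypDist p.1 p.2 := by
  unfold hypDist
  refine Real.continuousOn_arcosh.comp_continuous ?_ fun p => one_le_lorentz p.1 p.2
  exact continuous_lorentz.comp
    ((continuous_subtype_val.comp continuous_fst).prodMk (continuous_subtype_val.comp continuous_snd))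

theorem lorentz_vertex {n : ℕ} (x : MinkowskiSpace n) : lorentz x (vertex n).1 = x.1 := by
  simp [lorentz, vertex]

theorem cosh_hypDist_vertex {n : ℕ} (x : HypSpace n) :
    Real.cosh (hypDist (vertex n) x) = x.1.1 := by
  rw [cosh_hypDist, lorentz_comm, lorentz_vertex]

theorem sinh_hypDist_vertex {n : ℕ} (x : HypSpace n) :
    Real.sinh (hypDist (vertex n) x) = ‖x.1.2‖ := by
  rw [← abs_of_nonneg (Real.sinh_nonneg_iff.2 (hypDist_nonneg (vertex n) x)),
    ← abs_of_nonneg (norm_nonneg x.1.2), ← sq_eq_sq_iff_abs_eq_abs, x.norm_sq, Real.sinh_sq,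
    cosh_hypDist_vertex]

theorem hypDist_le_add {n : ℕ} (x y : HypSpace n) :
    hypDist x y ≤ hypDist (vertex n) x + hypDist (vertex n) y := by
  rw [← abs_of_nonneg (hypDist_nonneg x y),
    ← abs_of_nonneg (add_nonneg (hypDist_nonneg (vertex n) x) (hypDist_nonneg (vertex n) y)),
    ← Real.cosh_le_cosh, cosh_hypDist, Real.cosh_add, cosh_hypDist_vertex, cosh_hypDist_vertex,
    sinh_hypDist_vertex, sinh_hypDist_vertex]
  have := (abs_le.1 (abs_real_inner_le_norm x.1.2 y.1.2)).1
  unfold lorentz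
  linarith

theorem lorentz_polar_polar {n : ℕ} (ξ η : Metric.sphere (0 : EuclideanSpace ℝ (Fin n)) 1)
    (r s : ℝ) : lorentz (polar (ξ, r)).1 (polar (η, s)).1 =
      Real.cosh r * Real.cosh s - Real.sinh r * Real.sinh s * inner ℝ ξ.1 η.1 := by
  simp only [lorentz, polar, inner_smul_left, inner_smul_right, conj_trivial]
  ring

theorem hypDist_vertex_polar {n : ℕ} (ξ : Metric.sphere (0 : EuclideanSpace ℝ (Fin n)) 1)
    {r : ℝ} (hr : 0 ≤ r) : hypDist (vertex n) (polar (ξ, r)) = r := by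
  unfold hypDist
  rw [lorentz_comm, lorentz_vertex]
  exact Real.arcosh_cosh hr

theorem continuous_polar {n : ℕ} : Continuous (polar (n := n)) := by
  unfold polar
  refine Continuous.subtype_mk ?_ _
  have h1 : Continuous fun p : Metric.sphere (0 : EuclideanSpace ℝ (Fin n)) 1 × ℝ =>
    (p.1 : EuclideanSpace ℝ (Fin n)) := continuous_subtype_val.comp continuous_fst
  exact (Real.continuous_cosh.comp continuous_snd).prodMk
    ((Real.continuous_sinh.comp continuous_snd).smul h1)

theorem exists_polar_eq {n : ℕ} [Nonempty (Metric.sphere (0 : EuclideanSpace ℝ (Fin n)) 1)]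
    (x : HypSpace n) : ∃ ξ, polar (ξ, hypDist (vertex n) x) = x := by
  by_cases h : x.1.2 = 0
  · refine ⟨Classical.arbitrary _, ?_⟩
    refine Subtype.ext (Prod.ext ?_ ?_)
    · simp only [polar, cosh_hypDist_vertex]
    · simp only [polar, sinh_hypDist_vertex, h, norm_zero, zero_smul]
  · have h' : ‖x.1.2‖ ≠ 0 := norm_ne_zero_iff.2 h
    refine ⟨⟨‖x.1.2‖⁻¹ • x.1.2, by simp [norm_smul, h']⟩, ?_⟩
    refine Subtype.ext (Prod.ext ?_ ?_)
    · simp only [polar, cosh_hypDist_vertex]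
    · simp only [polar, sinh_hypDist_vertex, smul_smul, mul_inv_cancel₀ h', one_smul]

theorem lorentz_geodesic {n : ℕ} (x : HypSpace n) (i : Fin n) (t : ℝ) (y : MinkowskiSpace n) :
    lorentz (geodesic x i t).1 y = Real.cosh t * lorentz x.1 y + Real.sinh t * lorentz (frame x i) y := by
  simp only [lorentz, geodesic, Prod.fst_add, Prod.snd_add, Prod.smul_fst, Prod.smul_snd,
    smul_eq_mul, inner_add_left, inner_smul_left, conj_trivial]
  ring

theorem continuous_geodesic {n : ℕ} (x : HypSpace n) (i : Fin n) : Continuous (geodesic x i) := by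
  unfold geodesic
  refine Continuous.subtype_mk ?_ _
  exact (Real.continuous_cosh.smul continuous_const).add
    (Real.continuous_sinh.smul continuous_const)

theorem geodesic_zero {n : ℕ} (x : HypSpace n) (i : Fin n) : geodesic x i 0 = x := by
  ext1
  simp [geodesic]

/-- Parseval's identity: x and its frame form a Lorentz-orthonormal basis, and ⟨y, y⟩ = 1. It turns
the sum of second derivatives along the frame into an expression in ⟨x, y⟩ alone. -/
theorem sum_lorentz_frame_sq {n : ℕ} (x y : HypSpace n) :
    ∑ i, lorentz (frame x i) y.1 ^ 2 = lorentz x.1 y.1 ^ 2 - 1 := by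
  have h0 : 1 + x.1.1 ≠ 0 := by have := x.2.2; positivity
  have hf : ∀ i, lorentz (frame x i) y.1 =
      x.1.2 i * (y.1.1 - inner ℝ x.1.2 y.1.2 / (1 + x.1.1)) - y.1.2 i := by
    intro i
    simp only [lorentz, frame, inner_add_left, inner_smul_left, EuclideanSpace.inner_single_left,
      map_one, one_mul, conj_trivial]
    field_simp
    ring
  have hx : ∑ i, x.1.2 i ^ 2 = x.1.1 ^ 2 - 1 := by
    rw [← x.norm_sq, EuclideanSpace.norm_sq_eq]; simp
  have hy : ∑ i, y.1.2 i ^ 2 = y.1.1 ^ 2 - 1 := by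
    rw [← y.norm_sq, EuclideanSpace.norm_sq_eq]; simp
  have hxy : ∑ i, x.1.2 i * y.1.2 i = inner ℝ x.1.2 y.1.2 := by
    simp [PiLp.inner_apply, mul_comm]
  set p : ℝ := inner ℝ x.1.2 y.1.2
  set β : ℝ := y.1.1 - p / (1 + x.1.1) with hβ
  calc ∑ i, lorentz (frame x i) y.1 ^ 2
      = ∑ i, (β ^ 2 * x.1.2 i ^ 2 - 2 * β * (x.1.2 i * y.1.2 i) + y.1.2 i ^ 2) :=
        Finset.sum_congr rfl fun i _ => by rw [hf]; ring
    _ = β ^ 2 * (x.1.1 ^ 2 - 1) - 2 * β * p + (y.1.1 ^ 2 - 1) := by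
        rw [Finset.sum_add_distrib, Finset.sum_sub_distrib, ← Finset.mul_sum, ← Finset.mul_sum,
          hx, hy, hxy]
    _ = lorentz x.1 y.1 ^ 2 - 1 := by
        change _ = (x.1.1 * y.1.1 - p) ^ 2 - 1
        rw [hβ]
        field_simp
        ring

/-! ### The Laplacian of functions of the Lorentzian product. -/

/-- The restriction of `z ↦ b ⟨z, y⟩` to a geodesic has the form `t ↦ b (C cosh t + P sinh t)`. -/
theorem hasDerivAt_comp_cosh_sinh {b : ℝ → ℝ} {b₁ C P t : ℝ}
    (hb : HasDerivAt b b₁ (Real.cosh t * C + Real.sinh t * P)) :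
    HasDerivAt (fun t => b (Real.cosh t * C + Real.sinh t * P))
      (b₁ * (Real.sinh t * C + Real.cosh t * P)) t :=
  hb.comp t (((Real.hasDerivAt_cosh t).mul_const C).add ((Real.hasDerivAt_sinh t).mul_const P))

theorem hasDerivAt_comp_cosh_sinh_mul {b' : ℝ → ℝ} {b₂ C P t : ℝ}
    (hb : HasDerivAt b' b₂ (Real.cosh t * C + Real.sinh t * P)) :
    HasDerivAt (fun t => b' (Real.cosh t * C + Real.sinh t * P) *
        (Real.sinh t * C + Real.cosh t * P))
      (b₂ * (Real.sinh t * C + Real.cosh t * P) ^ 2 +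
        b' (Real.cosh t * C + Real.sinh t * P) * (Real.cosh t * C + Real.sinh t * P)) t := by
  have h := (hasDerivAt_comp_cosh_sinh hb).mul
    (((Real.hasDerivAt_sinh t).mul_const C).add ((Real.hasDerivAt_cosh t).mul_const P))
  refine h.congr_deriv ?_
  simp only [Pi.add_apply]
  ring

/-- The Laplace–Beltrami operator on functions of `⟨x, y⟩`. -/
theorem laplaceBeltrami_lorentz {n : ℕ} {b b' b'' : ℝ → ℝ} {x y : HypSpace n}
    (h : ∀ᶠ C in 𝓝 (lorentz x.1 y.1), HasDerivAt b (b' C) C ∧ HasDerivAt b' (b'' C) C) :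
    laplaceBeltrami (fun z => b (lorentz z.1 y.1)) x =
      (lorentz x.1 y.1 ^ 2 - 1) * b'' (lorentz x.1 y.1) +
        n * lorentz x.1 y.1 * b' (lorentz x.1 y.1) := by
  unfold laplaceBeltrami
  set C := lorentz x.1 y.1
  have key : ∀ i : Fin n, deriv (deriv fun t : ℝ => b (lorentz (geodesic x i t).1 y.1)) 0 =
      b'' C * lorentz (frame x i) y.1 ^ 2 + b' C * C := by
    intro i
    simp only [lorentz_geodesic]
    set P := lorentz (frame x i) y.1
    have hc : Tendsto (fun t => Real.cosh t * C + Real.sinh t * P) (𝓝 0) (𝓝 C) := by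
      have : Continuous fun t => Real.cosh t * C + Real.sinh t * P := by fun_prop
      simpa using this.tendsto 0
    have h1 : (deriv fun t : ℝ => b (Real.cosh t * C + Real.sinh t * P)) =ᶠ[𝓝 0]
        fun t => b' (Real.cosh t * C + Real.sinh t * P) * (Real.sinh t * C + Real.cosh t * P) := by
      filter_upwards [hc.eventually h] with t ht
      exact (hasDerivAt_comp_cosh_sinh ht.1).deriv
    rw [h1.deriv_eq, (hasDerivAt_comp_cosh_sinh_mul (hc.eventually h).self_of_nhds.2).deriv]
    simp
  rw [Finset.sum_congr rfl fun i _ => key i, Finset.sum_add_distrib, ← Finset.mul_sum,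
    sum_lorentz_frame_sq]
  simp
  ring

/-! ### A maximum principle for averages. -/

/-- Positivity is recorded as a second difference, which can be integrated over a parameter without
differentiating under the integral sign. -/
theorem two_mul_lt_add_of_second_deriv_pos {g g' g'' : ℝ → ℝ} {δ : ℝ}
    (h : ∀ t, |t| < δ → HasDerivAt g (g' t) t ∧ HasDerivAt g' (g'' t) t ∧ 0 < g'' t)
    {t : ℝ} (ht : 0 < t) (htδ : t < δ) : 2 * g 0 < g t + g (-t) := by
  have hmono : StrictMonoOn g' (Ioo (-δ) δ) := by
    refine strictMonoOn_of_deriv_pos (convex_Ioo _ _)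
      (fun s hs => (h s (abs_lt.2 hs)).2.1.continuousAt.continuousWithinAt) fun s hs => ?_
    rw [interior_Ioo] at hs
    rw [(h s (abs_lt.2 hs)).2.1.deriv]
    exact (h s (abs_lt.2 hs)).2.2
  have hd : ∀ s ∈ Icc 0 t, HasDerivAt (fun s => g s + g (-s)) (g' s - g' (-s)) s := by
    intro s hs
    have h1 := (h s (abs_lt.2 ⟨by linarith [hs.1], by linarith [hs.2]⟩)).1
    have h2 := (h (-s) (abs_lt.2 ⟨by linarith [hs.2], by linarith [hs.1]⟩)).1
    exact (h1.add (h2.scomp s (hasDerivAt_neg s))).congr_deriv (by simp [sub_eq_add_neg])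
  have hs : StrictMonoOn (fun s => g s + g (-s)) (Icc 0 t) := by
    refine strictMonoOn_of_deriv_pos (convex_Icc _ _)
      (fun s hs => (hd s hs).continuousAt.continuousWithinAt) fun s hs => ?_
    rw [interior_Icc] at hs
    rw [(hd s (Ioo_subset_Icc_self hs)).deriv, sub_pos]
    exact hmono ⟨by linarith [hs.2], by linarith [hs.1]⟩ ⟨by linarith [hs.1], by linarith [hs.2]⟩
      (by linarith [hs.1])
  have := hs (left_mem_Icc.2 ht.le) (right_mem_Icc.2 ht.le) ht
  simp only [neg_zero] at this
  linarith

/-- `z ↦ b ⟨z, y⟩` is of class `C²` with positive Laplacian on `ℍⁿ ∖ {y}`. -/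
def SubharmonicProfile (n : ℕ) (b : ℝ → ℝ) : Prop :=
  ∃ b' b'' : ℝ → ℝ, (∀ C, 1 < C → HasDerivAt b (b' C) C ∧ HasDerivAt b' (b'' C) C) ∧
    ContinuousOn b'' (Ioi 1) ∧ ∀ C, 1 < C → 0 < (C ^ 2 - 1) * b'' C + n * C * b' C

theorem SubharmonicProfile.continuousOn {n : ℕ} {b : ℝ → ℝ} (hb : SubharmonicProfile n b) :
    ContinuousOn b (Ioi 1) := by
  obtain ⟨b', b'', h, -⟩ := hb
  exact fun C hC => (h C hC).1.continuousAt.continuousWithinAt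

theorem Continuous.integrable_of_compactSpace {X : Type*} [TopologicalSpace X] [CompactSpace X]
    [MeasurableSpace X] [OpensMeasurableSpace X] {ω : Measure X} [IsFiniteMeasure ω] {f : X → ℝ}
    (hf : Continuous f) : Integrable f ω :=
  hf.integrable_of_hasCompactSupport (HasCompactSupport.of_compactSpace f)

theorem integral_lt_integral_of_forall_lt {X : Type*} [MeasurableSpace X] {ω : Measure X} [NeZero ω]
    {f g : X → ℝ} (hf : Integrable f ω) (hg : Integrable g ω) (h : ∀ x, f x < g x) :
    ∫ x, f x ∂ω < ∫ x, g x ∂ω := by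
  rw [← sub_pos, ← integral_sub hg hf,
    integral_pos_iff_support_of_nonneg (fun x => (sub_pos.2 (h x)).le) (hg.sub hf),
    eq_univ_of_forall (s := Function.support fun x => g x - f x) fun x => (sub_pos.2 (h x)).ne']
  exact Measure.measure_univ_pos.2 (NeZero.ne ω)

/-- A maximum principle: an average of functions with positive Laplacian minus a function with
nonpositive Laplacian has no local maximum. -/
theorem SubharmonicProfile.exists_lt {n : ℕ} {X : Type*} [TopologicalSpace X] [CompactSpace X]
    [MeasurableSpace X] [OpensMeasurableSpace X] {ω : Measure X} [IsProbabilityMeasure ω]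
    {b : ℝ → ℝ} (hb : SubharmonicProfile n b) {y : X → HypSpace n} (hy : Continuous y)
    {x : HypSpace n} {c c' c'' : ℝ → ℝ}
    (hc : ∀ᶠ C in 𝓝 x.1.1, HasDerivAt c (c' C) C ∧ HasDerivAt c' (c'' C) C)
    (hcc : ContinuousAt c'' x.1.1)
    (hL : (x.1.1 ^ 2 - 1) * c'' x.1.1 + n * x.1.1 * c' x.1.1 ≤ 0)
    (hxy : ∀ ξ, 1 < lorentz x.1 (y ξ).1) {U : Set (HypSpace n)} (hU : U ∈ 𝓝 x) :
    ∃ z ∈ U, (∫ ξ, b (lorentz x.1 (y ξ).1) ∂ω) - c x.1.1 <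
      (∫ ξ, b (lorentz z.1 (y ξ).1) ∂ω) - c z.1.1 := by
  have hbc := hb.continuousOn
  obtain ⟨b', b'', hbd, hb'', hLb⟩ := hb
  let q : Fin n → X → ℝ → ℝ := fun i ξ t =>
    Real.cosh t * lorentz x.1 (y ξ).1 + Real.sinh t * lorentz (frame x i) (y ξ).1
  let q' : Fin n → X → ℝ → ℝ := fun i ξ t =>
    Real.sinh t * lorentz x.1 (y ξ).1 + Real.cosh t * lorentz (frame x i) (y ξ).1
  let p : Fin n → ℝ → ℝ := fun i t => Real.cosh t * x.1.1 + Real.sinh t * (frame x i).1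
  let p' : Fin n → ℝ → ℝ := fun i t => Real.sinh t * x.1.1 + Real.cosh t * (frame x i).1
  have hyl : ∀ w : MinkowskiSpace n, Continuous fun ξ => lorentz w (y ξ).1 := fun w =>
    continuous_lorentz.comp (continuous_const.prodMk (continuous_subtype_val.comp hy))
  have hq : ∀ i, Continuous fun z : ℝ × X => q i z.2 z.1 := fun i =>
    ((Real.continuous_cosh.comp continuous_fst).mul ((hyl _).comp continuous_snd)).add
      ((Real.continuous_sinh.comp continuous_fst).mul ((hyl _).comp continuous_snd))
  have hq' : ∀ i, Continuous fun z : ℝ × X => q' i z.2 z.1 := fun i =>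
    ((Real.continuous_sinh.comp continuous_fst).mul ((hyl _).comp continuous_snd)).add
      ((Real.continuous_cosh.comp continuous_fst).mul ((hyl _).comp continuous_snd))
  have hp : ∀ i, Continuous (p i) := fun i => by fun_prop
  have hp' : ∀ i, Continuous (p' i) := fun i => by fun_prop
  have hq0 : ∀ i ξ, q i ξ 0 = lorentz x.1 (y ξ).1 := fun i ξ => by simp [q]
  have hp0 : ∀ i, p i 0 = x.1.1 := fun i => by simp [p]
  have hp0' : ∀ i, p' i 0 = (frame x i).1 := fun i => by simp [p']
  have hq0' : ∀ i ξ, q' i ξ 0 = lorentz (frame x i) (y ξ).1 := fun i ξ => by simp [q']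
  have hgq : ∀ i t ξ, lorentz (geodesic x i t).1 (y ξ).1 = q i ξ t := fun i t ξ =>
    lorentz_geodesic x i t _
  have hgp : ∀ i t, (geodesic x i t).1.1 = p i t := fun i t => by simp [geodesic, p]
  let g : X → ℝ → ℝ := fun ξ t => ∑ i, (b (q i ξ t) - c (p i t))
  let g' : X → ℝ → ℝ := fun ξ t => ∑ i, (b' (q i ξ t) * q' i ξ t - c' (p i t) * p' i t)
  let g'' : X → ℝ → ℝ := fun ξ t => ∑ i, ((b'' (q i ξ t) * q' i ξ t ^ 2 + b' (q i ξ t) * q i ξ t) -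
    (c'' (p i t) * p' i t ^ 2 + c' (p i t) * p i t))
  have hg0 : ∀ ξ, 0 < g'' ξ 0 := by
    intro ξ
    have h1 := hLb _ (hxy ξ)
    -- Summing over the frame gives the Laplacian of b at x minus that of c. The term with c is
    -- handled by the same identity, because z₀ is the Lorentzian product of z with the vertex.
    have h2 := sum_lorentz_frame_sq x (y ξ)
    have h3 := sum_lorentz_frame_sq x (vertex n)
    simp only [lorentz_vertex] at h3
    have : g'' ξ 0 = ((lorentz x.1 (y ξ).1 ^ 2 - 1) * b'' (lorentz x.1 (y ξ).1) +
        n * lorentz x.1 (y ξ).1 * b' (lorentz x.1 (y ξ).1)) -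
        ((x.1.1 ^ 2 - 1) * c'' x.1.1 + n * x.1.1 * c' x.1.1) := by
      simp only [g'', hq0, hq0', hp0, hp0', Finset.sum_sub_distrib, Finset.sum_add_distrib,
        ← Finset.mul_sum, h2, h3, Finset.sum_const, Finset.card_univ, Fintype.card_fin,
        nsmul_eq_mul]
      ring
    rw [this]
    linarith
  have hev : ∀ᶠ t in 𝓝 (0 : ℝ), ∀ ξ ∈ (univ : Set X),
      (0 < g'' ξ t ∧ ∀ i, 1 < q i ξ t) ∧ ∀ i, geodesic x i t ∈ U ∧
        HasDerivAt c (c' (p i t)) (p i t) ∧ HasDerivAt c' (c'' (p i t)) (p i t) := by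
    have hA : ∀ᶠ t in 𝓝 (0 : ℝ), ∀ i, geodesic x i t ∈ U ∧
        HasDerivAt c (c' (p i t)) (p i t) ∧ HasDerivAt c' (c'' (p i t)) (p i t) := by
      refine eventually_all.2 fun i => ?_
      have h1 : Tendsto (p i) (𝓝 0) (𝓝 x.1.1) := hp0 i ▸ (hp i).tendsto 0
      have h2 : Tendsto (geodesic x i) (𝓝 0) (𝓝 x) := by
        simpa only [geodesic_zero] using (continuous_geodesic x i).tendsto 0
      exact (h2.eventually hU).and (h1.eventually hc)
    -- Compactness of X makes the time interval uniform in ξ.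
    have hB : ∀ᶠ t in 𝓝 (0 : ℝ), ∀ ξ ∈ (univ : Set X), 0 < g'' ξ t ∧ ∀ i, 1 < q i ξ t := by
      refine isCompact_univ.eventually_forall_of_forall_eventually fun ξ _ => ?_
      refine Filter.Eventually.and ?_ ?_
      · have : ContinuousAt (fun z : ℝ × X => g'' z.2 z.1) (0, ξ) := by
          refine tendsto_finsetSum _ fun i _ => ?_
          have h1 : ContinuousAt b'' (q i ξ 0) := by
            rw [hq0]; exact hb''.continuousAt (Ioi_mem_nhds (hxy ξ))
          have h2 : ContinuousAt b' (q i ξ 0) := by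
            rw [hq0]; exact (hbd _ (hxy ξ)).2.continuousAt
          have h3 : ContinuousAt c'' (p i 0) := by rw [hp0]; exact hcc
          have h4 : ContinuousAt c' (p i 0) := by
            rw [hp0]; exact hc.self_of_nhds.2.continuousAt
          have hq1 := (hq i).continuousAt (x := (0, ξ))
          have hq2 := (hq' i).continuousAt (x := (0, ξ))
          have hp1 : ContinuousAt (fun z : ℝ × X => p i z.1) (0, ξ) :=
            ((hp i).comp continuous_fst).continuousAt
          have hp2 : ContinuousAt (fun z : ℝ × X => p' i z.1) (0, ξ) :=
            ((hp' i).comp continuous_fst).continuousAt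
          have k1 : ContinuousAt (fun z : ℝ × X => b'' (q i z.2 z.1)) (0, ξ) :=
            ContinuousAt.comp (f := fun z : ℝ × X => q i z.2 z.1) h1 hq1
          have k2 : ContinuousAt (fun z : ℝ × X => b' (q i z.2 z.1)) (0, ξ) :=
            ContinuousAt.comp (f := fun z : ℝ × X => q i z.2 z.1) h2 hq1
          have k3 : ContinuousAt (fun z : ℝ × X => c'' (p i z.1)) (0, ξ) :=
            ContinuousAt.comp (f := fun z : ℝ × X => p i z.1) h3 hp1
          have k4 : ContinuousAt (fun z : ℝ × X => c' (p i z.1)) (0, ξ) :=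
            ContinuousAt.comp (f := fun z : ℝ × X => p i z.1) h4 hp1
          exact ((k1.mul (hq2.pow 2)).add (k2.mul hq1)).sub ((k3.mul (hp2.pow 2)).add (k4.mul hp1))
        exact this.eventually (Ioi_mem_nhds (hg0 ξ))
      · refine eventually_all.2 fun i => ?_
        have h1 : 1 < q i ξ 0 := by rw [hq0]; exact hxy ξ
        exact (hq i).continuousAt.eventually (Ioi_mem_nhds h1)
    filter_upwards [hA, hB] with t h1 h2 ξ hξ using ⟨h2 ξ hξ, h1⟩
  obtain ⟨δ, hδ, hball⟩ := Metric.eventually_nhds_iff.1 hev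
  have hball' : ∀ t, |t| < δ → ∀ ξ, (0 < g'' ξ t ∧ ∀ i, 1 < q i ξ t) ∧ ∀ i, geodesic x i t ∈ U ∧
        HasDerivAt c (c' (p i t)) (p i t) ∧ HasDerivAt c' (c'' (p i t)) (p i t) :=
    fun t ht ξ => hball (by simpa using ht) ξ (mem_univ _)
  have hgg : ∀ ξ, 2 * g ξ 0 < g ξ (δ / 2) + g ξ (-(δ / 2)) := by
    intro ξ
    refine two_mul_lt_add_of_second_deriv_pos (g' := g' ξ) (g'' := g'' ξ) (δ := δ) (fun t ht => ?_)
      (by linarith) (by linarith)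
    obtain ⟨⟨h1, h2⟩, h3⟩ := hball' t ht ξ
    refine ⟨?_, ?_, h1⟩
    · exact HasDerivAt.fun_sum fun i _ => (hasDerivAt_comp_cosh_sinh (hbd _ (h2 i)).1).sub
        (hasDerivAt_comp_cosh_sinh (h3 i).2.1)
    · exact HasDerivAt.fun_sum fun i _ => (hasDerivAt_comp_cosh_sinh_mul (hbd _ (h2 i)).2).sub
        (hasDerivAt_comp_cosh_sinh_mul (h3 i).2.2)
  have hint : ∀ t, |t| < δ → ∀ i, Integrable (fun ξ => b (q i ξ t)) ω := by
    intro t ht i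
    refine Continuous.integrable_of_compactSpace (hbc.comp_continuous ?_ fun ξ =>
      (hball' t ht ξ).1.2 i)
    exact (hq i).comp (continuous_const.prodMk continuous_id)
  have hint' : ∀ t, |t| < δ → Integrable (fun ξ => g ξ t) ω := fun t ht =>
    integrable_finsetSum _ fun i _ => (hint t ht i).sub (integrable_const _)
  have hG : ∀ t, |t| < δ → ∫ ξ, g ξ t ∂ω = ∑ i, ((∫ ξ, b (q i ξ t) ∂ω) - c (p i t)) := by
    intro t ht
    simp only [g]
    rw [integral_finsetSum (f := fun i ξ => b (q i ξ t) - c (p i t)) _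
      fun i _ => (hint t ht i).sub (integrable_const _)]
    refine Finset.sum_congr rfl fun i _ => ?_
    rw [integral_sub (hint t ht i) (integrable_const _)]
    simp
  have ha0 : |(0 : ℝ)| < δ := by simpa using hδ
  have ha1 : |δ / 2| < δ := by rw [abs_of_pos (by linarith)]; linarith
  have ha2 : |-(δ / 2)| < δ := by rwa [abs_neg]
  have hlt : 2 * ∫ ξ, g ξ 0 ∂ω < ∫ ξ, g ξ (δ / 2) ∂ω + ∫ ξ, g ξ (-(δ / 2)) ∂ω := by
    rw [← integral_const_mul, ← integral_add (hint' _ ha1) (hint' _ ha2)]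
    exact integral_lt_integral_of_forall_lt ((hint' _ ha0).const_mul 2)
      ((hint' _ ha1).add (hint' _ ha2)) hgg
  -- At a local maximum every frame direction has nonpositive second difference, against the strict
  -- inequality for their sum.
  by_contra! hcon
  have hle : ∀ t, |t| < δ → ∫ ξ, g ξ t ∂ω ≤ ∫ ξ, g ξ 0 ∂ω := by
    intro t ht
    rw [hG t ht, hG 0 ha0]
    refine Finset.sum_le_sum fun i _ => ?_
    have hX : Nonempty X := by
      by_contra h
      rw [not_nonempty_iff] at h
      exact (IsProbabilityMeasure.ne_zero ω) (Measure.eq_zero_of_isEmpty ω)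
    have := hcon _ ((hball' t ht hX.some).2 i).1
    simpa only [hgq, hgp, hq0, hp0] using this
  linarith [hle _ ha1, hle _ ha2]

/-! ### The Green's function. -/

/-- The real-valued profile `θ ↦ ∫_θ^∞ sinh^{-(n-1)} ζ dζ`. -/
noncomputable def greenTail (n : ℕ) (θ : ℝ) : ℝ := ∫ ζ in Ioi θ, 1 / Real.sinh ζ ^ (n - 1)

theorem continuousOn_inv_sinh_pow (n : ℕ) :
    ContinuousOn (fun ζ : ℝ => 1 / Real.sinh ζ ^ (n - 1)) (Ioi 0) :=
  continuousOn_const.div (Real.continuous_sinh.pow _).continuousOn fun _ hζ =>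
    (pow_pos (Real.sinh_pos_iff.2 hζ) _).ne'

theorem integrableOn_inv_sinh_pow {n : ℕ} (hn : 2 ≤ n) {c : ℝ} (hc : 0 < c) :
    IntegrableOn (fun ζ : ℝ => 1 / Real.sinh ζ ^ (n - 1)) (Ioi c) := by
  -- For ζ > c one has sinh ζ ≥ k exp ζ with this k. One factor 1 / sinh ζ then supplies the
  -- exponential decay, and the other n - 2 are bounded by their value at c.
  have hk : 0 < (1 - Real.exp (-(2 * c))) / 2 := by
    have : Real.exp (-(2 * c)) < 1 := Real.exp_zero ▸ Real.exp_lt_exp.2 (by linarith)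
    linarith
  have hsc : 0 < Real.sinh c := Real.sinh_pos_iff.2 hc
  refine ((integrableOn_exp_neg_Ioi c).const_mul
    ((1 / Real.sinh c) ^ (n - 2) * ((1 - Real.exp (-(2 * c))) / 2)⁻¹)).mono'
    (((continuousOn_inv_sinh_pow n).mono
      (Ioi_subset_Ioi hc.le)).aestronglyMeasurable measurableSet_Ioi) ?_
  refine (ae_restrict_iff' measurableSet_Ioi).2 (Eventually.of_forall fun ζ hζ => ?_)
  have hζ' : c < ζ := hζ
  have hs : 0 < Real.sinh ζ := Real.sinh_pos_iff.2 (hc.trans hζ')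
  rw [Real.norm_of_nonneg (by positivity)]
  have h1 : (1 - Real.exp (-(2 * c))) / 2 * Real.exp ζ ≤ Real.sinh ζ := by
    rw [Real.sinh_eq]
    have : Real.exp (-ζ) ≤ Real.exp (-(2 * c)) * Real.exp ζ := by
      rw [← Real.exp_add]; exact Real.exp_le_exp.2 (by linarith)
    linarith
  have h2 : 1 / Real.sinh ζ ≤ ((1 - Real.exp (-(2 * c))) / 2)⁻¹ * Real.exp (-ζ) := by
    rw [Real.exp_neg ζ, ← mul_inv, one_div]
    exact inv_anti₀ (mul_pos hk (Real.exp_pos _)) h1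
  have h3 : 1 / Real.sinh ζ ≤ 1 / Real.sinh c :=
    one_div_le_one_div_of_le hsc (Real.sinh_le_sinh.2 hζ'.le)
  have h4 : 1 / Real.sinh ζ ^ (n - 1) = (1 / Real.sinh ζ) ^ (n - 2) * (1 / Real.sinh ζ) := by
    rw [← pow_succ, one_div_pow]
    congr 2
    omega
  rw [h4, mul_assoc]
  gcongr

theorem greenTail_sub {n : ℕ} (hn : 2 ≤ n) {a b : ℝ} (ha : 0 < a) (hab : a ≤ b) :
    greenTail n b = greenTail n a - ∫ ζ in a..b, 1 / Real.sinh ζ ^ (n - 1) := by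
  rw [intervalIntegral.integral_of_le hab, eq_sub_iff_add_eq, add_comm]
  unfold greenTail
  rw [← setIntegral_union (Ioc_disjoint_Ioi le_rfl) measurableSet_Ioi
    ((integrableOn_inv_sinh_pow hn ha).mono_set Ioc_subset_Ioi_self)
    (integrableOn_inv_sinh_pow hn (ha.trans_le hab)), Ioc_union_Ioi_eq_Ioi hab]

theorem hasDerivAt_greenTail {n : ℕ} (hn : 2 ≤ n) {θ : ℝ} (hθ : 0 < θ) :
    HasDerivAt (greenTail n) (-(1 / Real.sinh θ ^ (n - 1))) θ := by
  have h1 : HasDerivAt (fun u => ∫ ζ in (θ / 2)..u, 1 / Real.sinh ζ ^ (n - 1))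
      (1 / Real.sinh θ ^ (n - 1)) θ := by
    have hc : ContinuousOn (fun ζ : ℝ => 1 / Real.sinh ζ ^ (n - 1)) (Ioi 0) :=
      continuousOn_inv_sinh_pow n
    refine intervalIntegral.integral_hasDerivAt_right ?_ ?_ (hc.continuousAt (Ioi_mem_nhds hθ))
    · refine ContinuousOn.intervalIntegrable (hc.mono ?_)
      rw [uIcc_of_le (by linarith)]
      intro z hz
      exact lt_of_lt_of_le (by linarith) hz.1
    · exact hc.stronglyMeasurableAtFilter isOpen_Ioi _ hθ
  refine (h1.const_sub (greenTail n (θ / 2))).congr_of_eventuallyEq ?_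
  filter_upwards [Ioi_mem_nhds (show θ / 2 < θ by linarith)] with u hu
  exact greenTail_sub hn (by linarith) (le_of_lt hu)

theorem greenTail_strictAntiOn {n : ℕ} (hn : 2 ≤ n) : StrictAntiOn (greenTail n) (Ioi 0) := by
  refine strictAntiOn_of_deriv_neg (convex_Ioi _)
    (fun θ hθ => (hasDerivAt_greenTail hn hθ).continuousAt.continuousWithinAt) fun θ hθ => ?_
  rw [interior_Ioi] at hθ
  rw [(hasDerivAt_greenTail hn hθ).deriv, neg_lt_zero]
  exact one_div_pos.2 (pow_pos (Real.sinh_pos_iff.2 hθ) _)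

theorem greenTail_nonneg (n : ℕ) {θ : ℝ} (hθ : 0 ≤ θ) : 0 ≤ greenTail n θ :=
  setIntegral_nonneg measurableSet_Ioi fun _ hζ =>
    one_div_nonneg.2 (pow_nonneg (Real.sinh_nonneg_iff.2 (hθ.trans (le_of_lt hζ))) _)

theorem greenTail_pos {n : ℕ} (hn : 2 ≤ n) {θ : ℝ} (hθ : 0 < θ) : 0 < greenTail n θ :=
  (greenTail_nonneg n (by linarith : (0 : ℝ) ≤ θ + 1)).trans_lt
    (greenTail_strictAntiOn hn hθ (mem_Ioi.2 (by linarith)) (by linarith))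

theorem tendsto_greenTail_atTop {n : ℕ} (hn : 2 ≤ n) : Tendsto (greenTail n) atTop (𝓝 0) := by
  have h := intervalIntegral_tendsto_integral_Ioi (1 : ℝ)
    (integrableOn_inv_sinh_pow hn one_pos) tendsto_id
  have h2 : Tendsto (fun θ : ℝ => greenTail n 1 - ∫ ζ in (1 : ℝ)..θ, 1 / Real.sinh ζ ^ (n - 1))
      atTop (𝓝 (greenTail n 1 - greenTail n 1)) := h.const_sub _
  rw [sub_self] at h2
  refine h2.congr' ?_
  filter_upwards [eventually_ge_atTop 1] with θ hθ using (greenTail_sub hn one_pos hθ).symm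

theorem lintegral_inv_sinh_pow {n : ℕ} (hn : 2 ≤ n) {θ : ℝ} (hθ : 0 < θ) :
    ∫⁻ ζ in Ioi θ, ENNReal.ofReal (1 / Real.sinh ζ ^ (n - 1)) = ENNReal.ofReal (greenTail n θ) := by
  refine (ofReal_integral_eq_lintegral_ofReal (integrableOn_inv_sinh_pow hn hθ) ?_).symm
  refine (ae_restrict_iff' measurableSet_Ioi).2 (Eventually.of_forall fun ζ hζ => ?_)
  exact one_div_nonneg.2 (pow_nonneg (Real.sinh_nonneg_iff.2 (hθ.le.trans (le_of_lt hζ))) _)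

/-- `greenTail` as a function of `C = cosh θ`. -/
noncomputable def greenCosh (n : ℕ) (C : ℝ) : ℝ := greenTail n (Real.arcosh C)

/-- The derivative of `greenCosh`. -/
noncomputable def greenCoshDeriv (n : ℕ) (C : ℝ) : ℝ := -(√(C ^ 2 - 1) ^ n)⁻¹

/-- The second derivative of `greenCosh`. -/
noncomputable def greenCoshDeriv2 (n : ℕ) (C : ℝ) : ℝ :=
  n * C * (√(C ^ 2 - 1) ^ n)⁻¹ * (C ^ 2 - 1)⁻¹

theorem sqrt_sq_sub_one_pos {C : ℝ} (hC : 1 < C) : 0 < √(C ^ 2 - 1) :=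
  Real.sqrt_pos.2 (by nlinarith)

theorem hasDerivAt_sqrt_sq_sub_one {C : ℝ} (hC : 1 < C) :
    HasDerivAt (fun C => √(C ^ 2 - 1)) (C / √(C ^ 2 - 1)) C := by
  have h : HasDerivAt (fun C : ℝ => C ^ 2 - 1) (2 * C) C := by
    simpa using (hasDerivAt_pow 2 C).sub_const 1
  refine (h.sqrt (by nlinarith)).congr_deriv ?_
  have := sqrt_sq_sub_one_pos hC
  field_simp

theorem hasDerivAt_greenCosh {n : ℕ} (hn : 2 ≤ n) {C : ℝ} (hC : 1 < C) :
    HasDerivAt (greenCosh n) (greenCoshDeriv n C) C := by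
  refine ((hasDerivAt_greenTail hn (Real.arcosh_pos hC)).comp C
    (Real.hasDerivAt_arcosh hC)).congr_deriv ?_
  have := sqrt_sq_sub_one_pos hC
  rw [Real.sinh_arcosh hC.le, greenCoshDeriv, one_div, neg_mul, ← mul_inv, ← pow_succ,
    Nat.sub_add_cancel (by omega)]

theorem hasDerivAt_greenCoshDeriv {n : ℕ} (hn : 2 ≤ n) {C : ℝ} (hC : 1 < C) :
    HasDerivAt (greenCoshDeriv n) (greenCoshDeriv2 n C) C := by
  have hp := sqrt_sq_sub_one_pos hC
  have h2 : √(C ^ 2 - 1) ^ 2 = C ^ 2 - 1 := Real.sq_sqrt (by nlinarith)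
  refine (((hasDerivAt_sqrt_sq_sub_one hC).pow n).inv (pow_pos hp n).ne').neg.congr_deriv ?_
  obtain ⟨m, rfl⟩ : ∃ m, n = m + 1 := ⟨n - 1, by omega⟩
  simp only [greenCoshDeriv2, Pi.pow_apply, Nat.add_sub_cancel]
  generalize √(C ^ 2 - 1) = S at *
  rw [← h2]
  field_simp
  ring

/-- Harmonicity away from the pole: multiples of either sign can be added to a subharmonic profile,
and T can serve as the affine coordinate for radial convexity. -/
theorem greenCosh_laplace {n : ℕ} {C : ℝ} (hC : 1 < C) :
    (C ^ 2 - 1) * greenCoshDeriv2 n C + n * C * greenCoshDeriv n C = 0 := by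
  have : C ^ 2 - 1 ≠ 0 := by nlinarith
  rw [greenCoshDeriv2, greenCoshDeriv]
  field_simp
  ring

theorem continuousOn_greenCoshDeriv2 (n : ℕ) : ContinuousOn (greenCoshDeriv2 n) (Ioi 1) := by
  intro C hC
  have hp := sqrt_sq_sub_one_pos hC
  have h1 : (√(C ^ 2 - 1) ^ n) ≠ 0 := (pow_pos hp n).ne'
  have h2 : C ^ 2 - 1 ≠ 0 := by have : 1 < C := hC; nlinarith
  unfold greenCoshDeriv2
  refine ContinuousAt.continuousWithinAt ?_
  fun_prop (disch := assumption)

theorem continuousOn_greenCosh {n : ℕ} (hn : 2 ≤ n) : ContinuousOn (greenCosh n) (Ioi 1) :=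
  fun _ hC => (hasDerivAt_greenCosh hn hC).continuousAt.continuousWithinAt

theorem greenCosh_cosh (n : ℕ) {r : ℝ} (hr : 0 ≤ r) :
    greenCosh n (Real.cosh r) = greenTail n r := by
  rw [greenCosh, Real.arcosh_cosh hr]

theorem SubharmonicProfile.add_greenCosh {n : ℕ} (hn : 2 ≤ n) {b : ℝ → ℝ}
    (hb : SubharmonicProfile n b) {ε : ℝ} (hε : 0 < ε) (k : ℝ) :
    SubharmonicProfile n fun C => k * greenCosh n C + ε * b C := by
  obtain ⟨b', b'', h1, h2, h3⟩ := hb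
  refine ⟨fun C => k * greenCoshDeriv n C + ε * b' C,
    fun C => k * greenCoshDeriv2 n C + ε * b'' C, fun C hC => ⟨?_, ?_⟩, ?_, fun C hC => ?_⟩
  · exact ((hasDerivAt_greenCosh hn hC).const_mul k).add ((h1 C hC).1.const_mul ε)
  · exact ((hasDerivAt_greenCoshDeriv hn hC).const_mul k).add ((h1 C hC).2.const_mul ε)
  · exact (continuousOn_const.mul (continuousOn_greenCoshDeriv2 n)).add (continuousOn_const.mul h2)
  · have e1 := greenCosh_laplace (n := n) hC
    have e2 := mul_pos hε (h3 C hC)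
    have e3 : k * ((C ^ 2 - 1) * greenCoshDeriv2 n C + n * C * greenCoshDeriv n C) = 0 := by
      rw [e1, mul_zero]
    linarith

/-! ### The interaction profile and its monotonicity. -/

/-- `A - A(0)` as a continuous function of `C = cosh θ`. -/
noncomputable def pairProfile (A : ℝ → ℝ) (C : ℝ) : ℝ := A (Real.arcosh (max C 1)) - A 0

theorem pairProfile_lorentz {n : ℕ} (A : ℝ → ℝ) (x y : HypSpace n) :
    pairProfile A (lorentz x.1 y.1) = A (hypDist x y) - A 0 := by
  rw [pairProfile, max_eq_left (one_le_lorentz x y), hypDist]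

theorem continuous_pairProfile {A : ℝ → ℝ} (hA₀ : ContinuousOn A (Ici 0)) :
    Continuous (pairProfile A) := by
  refine Continuous.sub ?_ continuous_const
  refine hA₀.comp_continuous ?_ fun C => Real.arcosh_nonneg (le_max_right C 1)
  exact Real.continuousOn_arcosh.comp_continuous (continuous_id.max continuous_const)
    fun C => le_max_right C 1

instance nonempty_unitSphere {n : ℕ} [NeZero n] :
    Nonempty (Metric.sphere (0 : EuclideanSpace ℝ (Fin n)) 1) :=
  ⟨⟨EuclideanSpace.single 0 1, by simp⟩⟩

/-- Taking y to be the vertex suffices, since every C > 1 is attained by ⟨x, v⟩ for some x. -/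
theorem subharmonicProfile_pairProfile {n : ℕ} (hn : 2 ≤ n) {A : ℝ → ℝ}
    (hA₂ : ContDiffOn ℝ 2 A (Ioi 0))
    (hA : ∀ x y : HypSpace n, x ≠ y → 0 < laplaceBeltrami (fun z => A (hypDist z y)) x) :
    SubharmonicProfile n (pairProfile A) := by
  have : NeZero n := ⟨by omega⟩
  have h2 : ContDiffOn ℝ 2 (pairProfile A) (Ioi 1) := by
    have h : ContDiffOn ℝ 2 (fun C => A (Real.arcosh C) - A 0) (Ioi 1) :=
      (hA₂.comp Real.contDiffOn_arcosh fun C hC => Real.arcosh_pos hC).sub contDiffOn_const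
    refine h.congr fun C hC => ?_
    rw [pairProfile, max_eq_left (le_of_lt hC)]
  have h1 : ContDiffOn ℝ 1 (deriv (pairProfile A)) (Ioi 1) :=
    h2.deriv_of_isOpen isOpen_Ioi (by norm_num)
  have h0 : ContDiffOn ℝ 0 (deriv (deriv (pairProfile A))) (Ioi 1) :=
    h1.deriv_of_isOpen isOpen_Ioi (by norm_num)
  have hd : ∀ C, 1 < C → HasDerivAt (pairProfile A) (deriv (pairProfile A) C) C ∧
      HasDerivAt (deriv (pairProfile A)) (deriv (deriv (pairProfile A)) C) C := fun C hC =>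
    ⟨((h2.differentiableOn (by norm_num)).differentiableAt (Ioi_mem_nhds hC)).hasDerivAt,
      ((h1.differentiableOn (by norm_num)).differentiableAt (Ioi_mem_nhds hC)).hasDerivAt⟩
  refine ⟨_, _, hd, h0.continuousOn, fun C hC => ?_⟩
  let x : HypSpace n := polar (Classical.arbitrary _, Real.arcosh C)
  have hx : lorentz x.1 (vertex n).1 = C := by
    rw [lorentz_vertex]; exact Real.cosh_arcosh hC.le
  have hxv : x ≠ vertex n := by
    intro h
    rw [h, (vertex n).2.1] at hx
    exact hC.ne hx
  have h := hA x (vertex n) hxv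
  have he : (fun z => A (hypDist z (vertex n))) =
      fun z => (fun C => pairProfile A C + A 0) (lorentz z.1 (vertex n).1) := by
    funext z
    simp [pairProfile_lorentz]
  rw [he, laplaceBeltrami_lorentz (b := fun C => pairProfile A C + A 0) (b' := deriv (pairProfile A))
    (b'' := deriv (deriv (pairProfile A))), hx] at h
  · exact h
  · rw [hx]
    filter_upwards [Ioi_mem_nhds hC] with D hD using ⟨(hd D hD).1.add_const _, (hd D hD).2⟩

theorem tendsto_greenCosh_one {n : ℕ} (hn : 2 ≤ n) : Tendsto (greenCosh n) (𝓝[>] 1) atTop := by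
  -- With S² = C² - 1 and C ≤ 5/4 one has S ≤ 1 and C + 1 ≤ 3, so Sⁿ ≤ S² ≤ 3 (C - 1). The
  -- derivative -1/Sⁿ therefore gives at least logarithmic blow-up at 1.
  have hanti : AntitoneOn (fun C => greenCosh n C + 1 / 3 * Real.log (C - 1)) (Ioc 1 (5 / 4)) := by
    have hd : ∀ C, 1 < C → HasDerivAt (fun C => greenCosh n C + 1 / 3 * Real.log (C - 1))
        (greenCoshDeriv n C + 1 / 3 * (1 / (C - 1))) C := fun C hC =>
      (hasDerivAt_greenCosh hn hC).add
        ((((hasDerivAt_id C).sub_const 1).log (sub_pos.2 hC).ne').const_mul _)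
    refine antitoneOn_of_deriv_nonpos (convex_Ioc _ _)
      (fun C hC => (hd C hC.1).continuousAt.continuousWithinAt)
      (fun C hC => ?_) fun C hC => ?_
    · rw [interior_Ioc] at hC
      exact (hd C hC.1).differentiableAt.differentiableWithinAt
    · rw [interior_Ioc] at hC
      rw [(hd C hC.1).deriv, greenCoshDeriv]
      have hp := sqrt_sq_sub_one_pos hC.1
      have h1 : √(C ^ 2 - 1) ≤ 1 := Real.sqrt_le_one.2 (by nlinarith [hC.1, hC.2])
      have h2 : √(C ^ 2 - 1) ^ n ≤ 3 * (C - 1) := by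
        refine (pow_le_pow_of_le_one hp.le h1 hn).trans ?_
        rw [Real.sq_sqrt (by nlinarith [hC.1])]
        nlinarith [hC.1, hC.2]
      have h3 := inv_anti₀ (pow_pos hp n) h2
      rw [mul_inv] at h3
      rw [one_div, one_div]
      linarith
  have hlog : Tendsto (fun C : ℝ => greenCosh n (5 / 4) + 1 / 3 * Real.log (5 / 4 - 1) +
      (-(1 / 3)) * Real.log (C - 1)) (𝓝[>] 1) atTop := by
    refine tendsto_atTop_add_const_left _ _ (Tendsto.const_mul_atBot_of_neg (by norm_num) ?_)
    refine Real.tendsto_log_nhdsGT_zero.comp ?_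
    refine tendsto_nhdsWithin_iff.2 ⟨?_, ?_⟩
    · have : Tendsto (fun C : ℝ => C - 1) (𝓝 1) (𝓝 (1 - 1)) := (continuous_sub_right 1).tendsto 1
      rw [sub_self] at this
      exact this.mono_left nhdsWithin_le_nhds
    · filter_upwards [self_mem_nhdsWithin] with C hC using mem_Ioi.2 (sub_pos.2 (mem_Ioi.1 hC))
  refine tendsto_atTop_mono' _ ?_ hlog
  filter_upwards [Ioc_mem_nhdsGT (show (1 : ℝ) < 5 / 4 by norm_num)] with C hC
  have := hanti hC (right_mem_Ioc.2 (by norm_num)) hC.2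
  simp only at this
  linarith

/-- With S² = C² - 1, the derivative of Sⁿ b' is Sⁿ⁻² times the Laplacian, so Sⁿ b' increases
strictly. If b' were nonpositive somewhere, Sⁿ b' would stay below a negative constant k near C = 1.
Comparison with -k times the Green's profile would then force b → ∞ at 1, against continuity. -/
theorem SubharmonicProfile.strictMonoOn {n : ℕ} (hn : 2 ≤ n) {b : ℝ → ℝ}
    (hb : SubharmonicProfile n b) (hbc : Continuous b) : StrictMonoOn b (Ici 1) := by
  obtain ⟨b', b'', h1, -, h3⟩ := hb
  have hd : ∀ C, 1 < C → HasDerivAt (fun C => √(C ^ 2 - 1) ^ n * b' C)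
      (n * √(C ^ 2 - 1) ^ (n - 1) * (C / √(C ^ 2 - 1)) * b' C + √(C ^ 2 - 1) ^ n * b'' C) C :=
    fun C hC => ((hasDerivAt_sqrt_sq_sub_one hC).pow n).mul (h1 C hC).2
  have hmono : StrictMonoOn (fun C => √(C ^ 2 - 1) ^ n * b' C) (Ioi 1) := by
    refine strictMonoOn_of_deriv_pos (convex_Ioi _)
      (fun C hC => (hd C hC).continuousAt.continuousWithinAt) fun C hC => ?_
    rw [interior_Ioi] at hC
    rw [(hd C hC).deriv]
    have hp := sqrt_sq_sub_one_pos hC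
    have h2 : √(C ^ 2 - 1) ^ 2 = C ^ 2 - 1 := Real.sq_sqrt (by have : 1 < C := hC; nlinarith)
    have := mul_pos (pow_pos hp (n - 2)) (h3 C hC)
    obtain ⟨m, rfl⟩ : ∃ m, n = m + 2 := ⟨n - 2, by omega⟩
    simp only [Nat.add_sub_cancel, show m + 2 - 1 = m + 1 by omega] at this ⊢
    generalize √(C ^ 2 - 1) = S at *
    rw [← h2] at this
    refine this.trans_eq ?_
    field_simp
    ring
  refine strictMonoOn_of_deriv_pos (convex_Ici _) hbc.continuousOn fun C₁ hC₁ => ?_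
  rw [interior_Ici] at hC₁
  have hC₁' : 1 < C₁ := hC₁
  rw [(h1 C₁ hC₁).1.deriv]
  by_contra! hneg
  set C₀ := (1 + C₁) / 2 with hC₀
  have hC₀1 : 1 < C₀ := by linarith
  set k := √(C₀ ^ 2 - 1) ^ n * b' C₀ with hk
  have hk0 : k < 0 := by
    have := hmono hC₀1 hC₁ (show C₀ < C₁ by linarith)
    have h' : √(C₁ ^ 2 - 1) ^ n * b' C₁ ≤ 0 :=
      mul_nonpos_of_nonneg_of_nonpos (pow_nonneg (Real.sqrt_nonneg _) _) hneg
    simp only at this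
    linarith
  have hanti : AntitoneOn (fun C => b C + k * greenCosh n C) (Ioc 1 C₀) := by
    have hd' : ∀ C, 1 < C → HasDerivAt (fun C => b C + k * greenCosh n C)
        (b' C + k * greenCoshDeriv n C) C := fun C hC =>
      (h1 C hC).1.add ((hasDerivAt_greenCosh hn hC).const_mul k)
    refine antitoneOn_of_deriv_nonpos (convex_Ioc _ _)
      (fun C hC => (hd' C hC.1).continuousAt.continuousWithinAt)
      (fun C hC => ?_) fun C hC => ?_
    · rw [interior_Ioc] at hC
      exact (hd' C hC.1).differentiableAt.differentiableWithinAt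
    · rw [interior_Ioc] at hC
      rw [(hd' C hC.1).deriv, greenCoshDeriv]
      have hp := pow_pos (sqrt_sq_sub_one_pos hC.1) n
      have h4 := hmono hC.1 hC₀1 hC.2
      simp only at h4
      rw [← hk] at h4
      have h5 : b' C = (√(C ^ 2 - 1) ^ n * b' C) * (√(C ^ 2 - 1) ^ n)⁻¹ := by
        field_simp
      rw [h5]
      have := mul_lt_mul_of_pos_right h4 (inv_pos.2 hp)
      linarith
  have hlim : Tendsto b (𝓝[>] 1) atTop := by
    refine tendsto_atTop_mono' _ (f₁ := fun C => b C₀ + k * greenCosh n C₀ + (-k) * greenCosh n C) ?_ ?_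
    · filter_upwards [Ioc_mem_nhdsGT hC₀1] with C hC
      have := hanti hC (right_mem_Ioc.2 hC₀1) hC.2
      simp only at this
      linarith
    · exact tendsto_atTop_add_const_left _ _
        ((tendsto_greenCosh_one hn).const_mul_atTop (neg_pos.2 hk0))
  exact not_tendsto_nhds_of_tendsto_atTop hlim _ ((hbc.tendsto 1).mono_left nhdsWithin_le_nhds)

/-! ### Averages over geodesic spheres and Newton's theorem. -/

/-- The unit sphere of `ℝⁿ`. -/
abbrev UnitSphere (n : ℕ) : Type := Metric.sphere (0 : EuclideanSpace ℝ (Fin n)) 1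

/-- The normalized surface measure of the unit sphere. -/
noncomputable def sphereMeasure (n : ℕ) : Measure (UnitSphere n) :=
  ((volume : Measure (EuclideanSpace ℝ (Fin n))).toSphere univ)⁻¹ •
    (volume : Measure (EuclideanSpace ℝ (Fin n))).toSphere

theorem toSphere_univ_ne_zero (n : ℕ) [NeZero n] :
    (volume : Measure (EuclideanSpace ℝ (Fin n))).toSphere univ ≠ 0 :=
  Measure.measure_univ_ne_zero.2 (Measure.toSphere_ne_zero _)

instance isProbabilityMeasure_sphereMeasure (n : ℕ) [NeZero n] :
    IsProbabilityMeasure (sphereMeasure n) := by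
  refine ⟨?_⟩
  rw [sphereMeasure, Measure.smul_apply, smul_eq_mul]
  exact ENNReal.inv_mul_cancel (toSphere_univ_ne_zero n) (measure_ne_top _ _)

/-- The action of a linear isometry on the unit sphere. -/
noncomputable def LinearIsometryEquiv.unitSphere {n : ℕ}
    (L : EuclideanSpace ℝ (Fin n) ≃ₗᵢ[ℝ] EuclideanSpace ℝ (Fin n)) :
    UnitSphere n ≃ₜ UnitSphere n where
  toFun ξ := ⟨L ξ.1, by simp⟩
  invFun ξ := ⟨L.symm ξ.1, by simp⟩
  left_inv ξ := by simp
  right_inv ξ := by simp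
  continuous_toFun := (L.continuous.comp continuous_subtype_val).subtype_mk _
  continuous_invFun := (L.symm.continuous.comp continuous_subtype_val).subtype_mk _

-- The surface measure of s is a multiple of the volume of the cone over s, and a linear isometry
-- maps cones to cones and preserves volume.
open scoped Pointwise in
theorem measurePreserving_unitSphere {n : ℕ}
    (L : EuclideanSpace ℝ (Fin n) ≃ₗᵢ[ℝ] EuclideanSpace ℝ (Fin n)) :
    MeasurePreserving L.unitSphere.toMeasurableEquiv (sphereMeasure n) (sphereMeasure n) := by
  refine ⟨L.unitSphere.toMeasurableEquiv.measurable, ?_⟩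
  rw [sphereMeasure, Measure.map_smul]
  congr 1
  ext s hs
  rw [Measure.map_apply L.unitSphere.toMeasurableEquiv.measurable hs, Measure.toSphere_apply' _ hs,
    Measure.toSphere_apply' _ (L.unitSphere.toMeasurableEquiv.measurable hs)]
  congr 1
  have : Ioo (0 : ℝ) 1 • (Subtype.val '' (L.unitSphere.toMeasurableEquiv ⁻¹' s)) =
      L.toMeasurableEquiv ⁻¹' (Ioo (0 : ℝ) 1 • (Subtype.val '' s)) := by
    ext x
    simp only [mem_preimage, Set.mem_smul]
    constructor
    · rintro ⟨t, ht, -, ⟨ξ, hξ, rfl⟩, rfl⟩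
      exact ⟨t, ht, _, ⟨_, hξ, rfl⟩, (map_smul L t ξ.1).symm⟩
    · rintro ⟨t, ht, -, ⟨ξ, hξ, rfl⟩, hx⟩
      refine ⟨t, ht, _, ⟨L.unitSphere.symm ξ, ?_, rfl⟩, ?_⟩
      · have : L.unitSphere (L.unitSphere.symm ξ) = ξ := L.unitSphere.apply_symm_apply ξ
        exact (congrArg (· ∈ s) this).mpr hξ
      · apply L.injective
        change L (t • L.symm ξ.1) = L x
        rw [map_smul, L.apply_symm_apply]
        exact hx
  rw [this]
  exact (L.measurePreserving.measure_preimage_equiv (f := L.toMeasurableEquiv) _)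

/-- The average of `y ↦ b ⟨x, y⟩` over the geodesic sphere of radius `s` around the vertex, where
`x` has polar coordinates `(e, r)`. -/
noncomputable def sphereAvg {n : ℕ} (b : ℝ → ℝ) (e : UnitSphere n) (r s : ℝ) : ℝ :=
  ∫ ξ, b (Real.cosh r * Real.cosh s - Real.sinh r * Real.sinh s * inner ℝ e.1 ξ.1)
    ∂(sphereMeasure n)

theorem sphereAvg_comm {n : ℕ} (b : ℝ → ℝ) (e : UnitSphere n) (r s : ℝ) :
    sphereAvg b e r s = sphereAvg b e s r := by
  simp only [sphereAvg, mul_comm (Real.cosh r), mul_comm (Real.sinh r)]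

/-- The reflection in the hyperplane orthogonal to e - e' carries e to e' and preserves the surface
measure. -/
theorem sphereAvg_eq {n : ℕ} (b : ℝ → ℝ) (e e' : UnitSphere n) (r s : ℝ) :
    sphereAvg b e r s = sphereAvg b e' r s := by
  let L := (Submodule.span ℝ {e.1 - e'.1})ᗮ.reflection
  have hL : L e.1 = e'.1 := Submodule.reflection_sub (by simp)
  unfold sphereAvg
  rw [← (measurePreserving_unitSphere L).integral_comp'
    (g := fun ξ : UnitSphere n =>
      b (Real.cosh r * Real.cosh s - Real.sinh r * Real.sinh s * inner ℝ e'.1 ξ.1))]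
  refine integral_congr_ae (Eventually.of_forall fun ξ => ?_)
  have : inner ℝ e'.1 (L.unitSphere.toMeasurableEquiv ξ).1 = inner ℝ e.1 ξ.1 := by
    rw [← hL]
    exact L.inner_map_map _ _
  simp only [this]

theorem abs_inner_unitSphere_le_one {n : ℕ} (e ξ : UnitSphere n) : |inner ℝ e.1 ξ.1| ≤ 1 := by
  simpa using abs_real_inner_le_norm e.1 ξ.1

theorem cosh_sub_le_sphere {n : ℕ} (e ξ : UnitSphere n) {r s : ℝ} (hr : 0 ≤ r) (hs : 0 ≤ s) :
    Real.cosh (r - s) ≤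
      Real.cosh r * Real.cosh s - Real.sinh r * Real.sinh s * inner ℝ e.1 ξ.1 := by
  have h := (abs_le.1 (abs_inner_unitSphere_le_one e ξ)).2
  have := mul_nonneg (Real.sinh_nonneg_iff.2 hr) (Real.sinh_nonneg_iff.2 hs)
  rw [Real.cosh_sub]
  nlinarith

theorem sphere_le_cosh_add {n : ℕ} (e ξ : UnitSphere n) {r s : ℝ} (hr : 0 ≤ r) (hs : 0 ≤ s) :
    Real.cosh r * Real.cosh s - Real.sinh r * Real.sinh s * inner ℝ e.1 ξ.1 ≤
      Real.cosh (r + s) := by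
  have h := (abs_le.1 (abs_inner_unitSphere_le_one e ξ)).1
  have := mul_nonneg (Real.sinh_nonneg_iff.2 hr) (Real.sinh_nonneg_iff.2 hs)
  rw [Real.cosh_add]
  nlinarith

theorem one_lt_sphere {n : ℕ} (e ξ : UnitSphere n) {r s : ℝ} (hr : 0 ≤ r) (hs : 0 ≤ s)
    (hrs : r ≠ s) :
    1 < Real.cosh r * Real.cosh s - Real.sinh r * Real.sinh s * inner ℝ e.1 ξ.1 :=
  (Real.one_lt_cosh.2 (sub_ne_zero.2 hrs)).trans_le (cosh_sub_le_sphere e ξ hr hs)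

theorem continuous_sphere_arg {n : ℕ} (e : UnitSphere n) : Continuous fun p : (ℝ × ℝ) × UnitSphere n =>
    Real.cosh p.1.1 * Real.cosh p.1.2 - Real.sinh p.1.1 * Real.sinh p.1.2 * inner ℝ e.1 p.2.1 := by
  have : Continuous fun p : (ℝ × ℝ) × UnitSphere n => inner ℝ e.1 p.2.1 :=
    continuous_const.inner (continuous_subtype_val.comp continuous_snd)
  fun_prop

theorem continuous_sphereAvg {n : ℕ} [NeZero n] {b : ℝ → ℝ} (hb : Continuous b) (e : UnitSphere n) :
    Continuous fun p : ℝ × ℝ => sphereAvg b e p.1 p.2 := by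
  have h := continuous_parametric_integral_of_continuous (μ := sphereMeasure n)
    (f := fun (p : ℝ × ℝ) (ξ : UnitSphere n) =>
      b (Real.cosh p.1 * Real.cosh p.2 - Real.sinh p.1 * Real.sinh p.2 * inner ℝ e.1 ξ.1))
    (s := univ) (hb.comp (continuous_sphere_arg e)) isCompact_univ
  simpa only [setIntegral_univ, sphereAvg] using h

theorem integrable_sphere {n : ℕ} [NeZero n] {b : ℝ → ℝ} (hb : ContinuousOn b (Ioi 1))
    (e : UnitSphere n) {r s : ℝ} (hr : 0 ≤ r) (hs : 0 ≤ s) (hrs : r ≠ s) :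
    Integrable (fun ξ : UnitSphere n => b (Real.cosh r * Real.cosh s -
      Real.sinh r * Real.sinh s * inner ℝ e.1 ξ.1)) (sphereMeasure n) :=
  Continuous.integrable_of_compactSpace (hb.comp_continuous
    ((continuous_sphere_arg e).comp ((continuous_const (y := (r, s))).prodMk continuous_id))
    fun ξ => one_lt_sphere e ξ hr hs hrs)

theorem sphereAvg_zero {n : ℕ} [NeZero n] (b : ℝ → ℝ) (e : UnitSphere n) (r : ℝ) :
    sphereAvg b e r 0 = b (Real.cosh r) := by
  simp [sphereAvg]

theorem integral_lorentz_polar {n : ℕ} [NeZero n] (b : ℝ → ℝ) (e : UnitSphere n) (z : HypSpace n)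
    (s : ℝ) : ∫ ξ, b (lorentz z.1 (polar (ξ, s)).1) ∂(sphereMeasure n) =
      sphereAvg b e (hypDist (vertex n) z) s := by
  obtain ⟨e', he'⟩ := exists_polar_eq z
  rw [sphereAvg_eq b e e', sphereAvg]
  conv_lhs => rw [← he']
  simp only [lorentz_polar_polar]

/-- Inside the ball of radius s the average is a radial function without local maxima, so on [0, r₂]
its maximum can only be attained at r₂. -/
theorem SubharmonicProfile.sphereAvg_strictMono {n : ℕ} [NeZero n] {b : ℝ → ℝ}
    (hb : SubharmonicProfile n b) (e : UnitSphere n) {r₁ r₂ s : ℝ} (h1 : 0 ≤ r₁) (h12 : r₁ < r₂)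
    (h2 : r₂ < s) : sphereAvg b e r₁ s < sphereAvg b e r₂ s := by
  have hcont : ContinuousOn (fun r => sphereAvg b e r s) (Icc 0 r₂) := by
    have hc : 1 < Real.cosh (r₂ - s) := Real.one_lt_cosh.2 (by linarith)
    -- No continuity of b at C = 1 is assumed, as the Green's profile must be allowed. Truncating at
    -- cosh (r₂ - s) changes nothing for r ≤ r₂, since all arguments are at least that large.
    have hb' : Continuous fun C => b (max C (Real.cosh (r₂ - s))) :=
      hb.continuousOn.comp_continuous (continuous_id.max continuous_const)
        fun C => hc.trans_le (le_max_right _ _)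
    refine ((continuous_sphereAvg hb' e).comp
      (continuous_id.prodMk (continuous_const (y := s)))).continuousOn.congr fun r hr => ?_
    refine integral_congr_ae (Eventually.of_forall fun ξ => ?_)
    simp only [id]
    rw [max_eq_left]
    refine le_trans ?_ (cosh_sub_le_sphere e ξ hr.1 (by linarith))
    rw [Real.cosh_le_cosh, abs_of_nonpos (by linarith), abs_of_nonpos (by linarith [hr.2])]
    linarith [hr.2]
  have key : ∀ r, 0 ≤ r → r < r₂ → ∃ r' ∈ Icc 0 r₂, sphereAvg b e r s < sphereAvg b e r' s := by
    intro r hr hr2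
    have hvr := hypDist_vertex_polar e hr
    obtain ⟨z, hz, hlt⟩ := hb.exists_lt (ω := sphereMeasure n) (X := UnitSphere n)
      (y := fun ξ => polar (ξ, s)) (x := polar (e, r)) (c := fun _ => 0) (c' := fun _ => 0)
      (c'' := fun _ => 0)
      (continuous_polar.comp (continuous_id.prodMk continuous_const))
      (Eventually.of_forall fun C => ⟨hasDerivAt_const _ _, hasDerivAt_const _ _⟩)
      continuousAt_const (by simp)
      (fun ξ => by rw [lorentz_polar_polar]; exact one_lt_sphere e ξ hr (by linarith) (by linarith))
      (U := {z | hypDist (vertex n) z < r₂})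
      ((isOpen_lt (continuous_hypDist.comp (continuous_const.prodMk continuous_id))
        continuous_const).mem_nhds (by
          change hypDist (vertex n) (polar (e, r)) < r₂
          rwa [hvr]))
    rw [integral_lorentz_polar b e, integral_lorentz_polar b e, hvr, sub_zero, sub_zero] at hlt
    exact ⟨_, ⟨hypDist_nonneg _ _, le_of_lt hz⟩, hlt⟩
  obtain ⟨m, hm, hmax⟩ := isCompact_Icc.exists_isMaxOn (nonempty_Icc.2 (h1.trans h12.le)) hcont
  have hm2 : m = r₂ := by
    by_contra hne
    obtain ⟨r', hr', hlt⟩ := key m hm.1 (lt_of_le_of_ne hm.2 hne)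
    exact absurd (hmax hr') (not_le.2 hlt)
  obtain ⟨r', hr', hlt⟩ := key r₁ h1 h12
  exact hlt.trans_le (hm2 ▸ hmax hr')

/-- Strict convexity as a function of T on an interval whose interior avoids s. Subtracting the
multiple β T that equalizes the end values leaves the Laplacian positive, so the maximum lies only
at the ends. Continuity of b at 1 allows s to be an endpoint. -/
theorem SubharmonicProfile.sphereAvg_strictConvex {n : ℕ} (hn : 2 ≤ n) [NeZero n] {b : ℝ → ℝ}
    (hb : SubharmonicProfile n b) (hbc : Continuous b) (e : UnitSphere n) {r₁ r₂ r₃ s w : ℝ}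
    (h1 : 0 < r₁) (h12 : r₁ < r₂) (h23 : r₂ < r₃) (hs : 0 ≤ s) (hs' : s ≤ r₁ ∨ r₃ ≤ s)
    (hw : greenTail n r₂ = (1 - w) * greenTail n r₁ + w * greenTail n r₃) :
    sphereAvg b e r₂ s < (1 - w) * sphereAvg b e r₁ s + w * sphereAvg b e r₃ s := by
  set F := fun r => sphereAvg b e r s
  have hT13 : greenTail n r₃ < greenTail n r₁ :=
    greenTail_strictAntiOn hn h1 (h1.trans (h12.trans h23)) (h12.trans h23)
  set β := (F r₃ - F r₁) / (greenTail n r₃ - greenTail n r₁) with hβ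
  have hβ' : β * (greenTail n r₃ - greenTail n r₁) = F r₃ - F r₁ :=
    div_mul_cancel₀ _ (by linarith)
  have hcont : ContinuousOn (fun r => F r - β * greenTail n r) (Icc r₁ r₃) := by
    refine ContinuousOn.sub ?_ (continuousOn_const.mul fun r hr => ?_)
    · exact ((continuous_sphereAvg hbc e).comp
        (continuous_id.prodMk (continuous_const (y := s)))).continuousOn
    · exact (hasDerivAt_greenTail hn (h1.trans_le hr.1)).continuousAt.continuousWithinAt
  have key : ∀ r, r₁ < r → r < r₃ → ∃ r' ∈ Icc r₁ r₃,
      F r - β * greenTail n r < F r' - β * greenTail n r' := by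
    intro r hr1 hr3
    have hr : 0 < r := h1.trans hr1
    have hvr := hypDist_vertex_polar e hr.le
    have hx : (polar (e, r)).1.1 = Real.cosh r := rfl
    have hch : 1 < Real.cosh r := Real.one_lt_cosh.2 hr.ne'
    have hgc : ∀ z : HypSpace n, greenCosh n z.1.1 = greenTail n (hypDist (vertex n) z) := fun z => by
      rw [← cosh_hypDist_vertex, greenCosh_cosh n (hypDist_nonneg _ _)]
    have hrs : r ≠ s := by
      rintro rfl
      rcases hs' with h | h <;> linarith
    obtain ⟨z, hz, hlt⟩ := hb.exists_lt (ω := sphereMeasure n) (X := UnitSphere n)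
      (y := fun ξ => polar (ξ, s)) (x := polar (e, r)) (c := fun C => β * greenCosh n C)
      (c' := fun C => β * greenCoshDeriv n C) (c'' := fun C => β * greenCoshDeriv2 n C)
      (continuous_polar.comp (continuous_id.prodMk continuous_const))
      (by
        rw [hx]
        filter_upwards [Ioi_mem_nhds hch] with C hC
        exact ⟨(hasDerivAt_greenCosh hn hC).const_mul β,
          (hasDerivAt_greenCoshDeriv hn hC).const_mul β⟩)
      (by
        rw [hx]
        exact continuousAt_const.mul
          ((continuousOn_greenCoshDeriv2 n).continuousAt (Ioi_mem_nhds hch)))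
      (by
        rw [hx]
        have := greenCosh_laplace (n := n) hch
        refine le_of_eq ?_
        calc _ = β * ((Real.cosh r ^ 2 - 1) * greenCoshDeriv2 n (Real.cosh r) +
              n * Real.cosh r * greenCoshDeriv n (Real.cosh r)) := by ring
          _ = 0 := by rw [this, mul_zero])
      (fun ξ => by rw [lorentz_polar_polar]; exact one_lt_sphere e ξ hr.le hs hrs)
      (U := {z | hypDist (vertex n) z ∈ Ioo r₁ r₃})
      ((isOpen_Ioo.preimage (continuous_hypDist.comp (continuous_const.prodMk continuous_id))).mem_nhds
        (by
          change hypDist (vertex n) (polar (e, r)) ∈ Ioo r₁ r₃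
          rw [hvr]
          exact ⟨hr1, hr3⟩))
    rw [integral_lorentz_polar b e, integral_lorentz_polar b e, hgc, hgc, hvr] at hlt
    exact ⟨_, Ioo_subset_Icc_self hz, hlt⟩
  have hlt : F r₂ - β * greenTail n r₂ < F r₁ - β * greenTail n r₁ := by
    obtain ⟨m, hm, hmax⟩ := isCompact_Icc.exists_isMaxOn (nonempty_Icc.2 (h12.trans h23).le) hcont
    have hend : m = r₁ ∨ m = r₃ := by
      by_contra! hne
      obtain ⟨r', hr', hlt⟩ := key m (lt_of_le_of_ne hm.1 hne.1.symm) (lt_of_le_of_ne hm.2 hne.2)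
      exact absurd (hmax hr') (not_le.2 hlt)
    obtain ⟨r', hr', hlt⟩ := key r₂ h12 h23
    have h4 := hlt.trans_le (hmax hr')
    rcases hend with rfl | rfl
    · exact h4
    · have h5 : F r₂ - β * greenTail n r₂ < F m - β * greenTail n m := h4
      linarith
  have e1 : β * greenTail n r₂ = (1 - w) * (β * greenTail n r₁) + w * (β * greenTail n r₃) := by
    rw [hw]; ring
  have e2 : w * (β * (greenTail n r₃ - greenTail n r₁)) = w * (F r₃ - F r₁) := by rw [hβ']
  change F r₂ < (1 - w) * F r₁ + w * F r₃
  nlinarith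

/-- Newton's theorem for the Green's function. -/
theorem sphereAvg_greenCosh {n : ℕ} (hn : 2 ≤ n) [NeZero n] {b : ℝ → ℝ}
    (hb : SubharmonicProfile n b) (e : UnitSphere n) {r s : ℝ} (hr : 0 ≤ r)
    (hs : 0 ≤ s) (hrs : r ≠ s) : sphereAvg (greenCosh n) e r s = greenTail n (max r s) := by
  wlog h : r < s generalizing r s
  · rw [sphereAvg_comm, max_comm]
    exact this hs hr hrs.symm (lt_of_le_of_ne (not_lt.1 h) hrs.symm)
  rw [max_eq_right h.le]
  rcases hr.eq_or_lt with rfl | hr0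
  · rw [sphereAvg_comm, sphereAvg_zero, greenCosh_cosh n hs]
  have hlin : ∀ (k ε : ℝ), ∀ r, 0 ≤ r → r ≠ s →
      sphereAvg (fun C => k * greenCosh n C + ε * b C) e r s =
        k * sphereAvg (greenCosh n) e r s + ε * sphereAvg b e r s := by
    intro k ε r hr hrs
    unfold sphereAvg
    rw [integral_add ((integrable_sphere (continuousOn_greenCosh hn) e hr hs hrs).const_mul k)
      ((integrable_sphere hb.continuousOn e hr hs hrs).const_mul ε), integral_const_mul,
      integral_const_mul]
  have h0 : sphereAvg (greenCosh n) e 0 s = greenTail n s := by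
    rw [sphereAvg_comm, sphereAvg_zero, greenCosh_cosh n hs]
  -- Since k times the Green's profile plus ε b is subharmonic for either sign of k, its average at
  -- r exceeds that at 0. The limit ε → 0 leaves a weak inequality, and k = ±1 gives equality.
  have hk : ∀ k : ℝ, k * greenTail n s ≤ k * sphereAvg (greenCosh n) e r s := by
    intro k
    have hle : ∀ ε : ℝ, 0 < ε → k * greenTail n s ≤ k * sphereAvg (greenCosh n) e r s +
        ε * (sphereAvg b e r s - sphereAvg b e 0 s) := by
      intro ε hε
      have := (hb.add_greenCosh hn hε k).sphereAvg_strictMono e le_rfl hr0 h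
      rw [hlin k ε 0 le_rfl (by linarith), hlin k ε r hr hrs, h0] at this
      linarith
    have hlim : Tendsto (fun ε : ℝ => k * sphereAvg (greenCosh n) e r s +
        ε * (sphereAvg b e r s - sphereAvg b e 0 s)) (𝓝[>] 0)
        (𝓝 (k * sphereAvg (greenCosh n) e r s)) := by
      have : Continuous fun ε : ℝ => k * sphereAvg (greenCosh n) e r s +
        ε * (sphereAvg b e r s - sphereAvg b e 0 s) := by fun_prop
      simpa using (this.tendsto 0).mono_left (nhdsWithin_le_nhds (s := Ioi 0))
    exact ge_of_tendsto hlim (eventually_nhdsWithin_of_forall hle)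
  linarith [hk 1, hk (-1)]

/-! ### Radial measures and their radial laws. -/

/-- The radial measure on `ℍⁿ` whose distance to the vertex has law `τ`. -/
noncomputable def radialMeasure (n : ℕ) (τ : Measure ℝ) : Measure (HypSpace n) :=
  ((sphereMeasure n).prod τ).map polar

theorem lintegral_radialMeasure {n : ℕ} [NeZero n] {τ : Measure ℝ} [SFinite τ]
    {f : HypSpace n → ℝ≥0∞} (hf : Measurable f) :
    ∫⁻ x, f x ∂(radialMeasure n τ) = ∫⁻ r, ∫⁻ ξ, f (polar (ξ, r)) ∂(sphereMeasure n) ∂τ := by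
  rw [radialMeasure, lintegral_map hf continuous_polar.measurable,
    lintegral_prod_symm' (fun p => f (polar p)) (hf.comp continuous_polar.measurable)]

theorem radialMeasure_univ {n : ℕ} [NeZero n] (τ : Measure ℝ) [SFinite τ] :
    radialMeasure n τ univ = τ univ := by
  rw [radialMeasure, Measure.map_apply continuous_polar.measurable .univ, preimage_univ,
    ← univ_prod_univ, Measure.prod_prod, measure_univ, one_mul]

theorem isProbabilityMeasure_radialMeasure {n : ℕ} [NeZero n] {τ : Measure ℝ}
    [IsProbabilityMeasure τ] : IsProbabilityMeasure (radialMeasure n τ) :=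
  ⟨by rw [radialMeasure_univ, measure_univ]⟩

instance sFinite_radialMeasure {n : ℕ} [NeZero n] {τ : Measure ℝ} [SFinite τ] :
    SFinite (radialMeasure n τ) := by
  unfold radialMeasure; infer_instance

theorem radialMeasure_add {n : ℕ} [NeZero n] (τ τ' : Measure ℝ) [SFinite τ] [SFinite τ'] :
    radialMeasure n (τ + τ') = radialMeasure n τ + radialMeasure n τ' := by
  rw [radialMeasure, Measure.prod_add, Measure.map_add _ _ continuous_polar.measurable]
  rfl

theorem radialMeasure_smul {n : ℕ} [NeZero n] (c : ℝ≥0∞) (τ : Measure ℝ) [SFinite τ] :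
    radialMeasure n (c • τ) = c • radialMeasure n τ := by
  rw [radialMeasure, Measure.prod_smul_right, Measure.map_smul]
  rfl

/-- The radial part of the volume measure, without the factor `n α(n)`. -/
noncomputable def radialVolume (n : ℕ) : Measure ℝ :=
  ((volume : Measure ℝ).restrict (Ioi 0)).withDensity
    fun θ => ENNReal.ofReal (Real.sinh θ ^ (n - 1))

instance sFinite_radialVolume {n : ℕ} : SFinite (radialVolume n) := by
  unfold radialVolume; infer_instance

theorem radialVolume_absolutelyContinuous (n : ℕ) : radialVolume n ≪ volume.restrict (Ioi 0) :=
  withDensity_absolutelyContinuous _ _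

theorem measurable_hypDist_vertex {n : ℕ} : Measurable (hypDist (vertex n)) :=
  (continuous_hypDist.comp (continuous_const.prodMk continuous_id)).measurable

theorem ae_prod_hypDist_polar {n : ℕ} : ∀ᵐ p ∂((volume :
    Measure (EuclideanSpace ℝ (Fin n))).toSphere.prod (radialVolume n)),
    hypDist (vertex n) (polar p) = p.2 := by
  have h : ∀ᵐ θ ∂(radialVolume n), 0 < θ :=
    (radialVolume_absolutelyContinuous n).ae_le (ae_restrict_mem measurableSet_Ioi)
  have h2 := Measure.quasiMeasurePreserving_snd (μ := (volume :
    Measure (EuclideanSpace ℝ (Fin n))).toSphere) (ν := radialVolume n) |>.ae h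
  filter_upwards [h2] with p hp using hypDist_vertex_polar p.1 (le_of_lt hp)

theorem map_hypDist_hypVolume {n : ℕ} : (hypVolume n).map (hypDist (vertex n)) =
    (volume : Measure (EuclideanSpace ℝ (Fin n))).toSphere univ • radialVolume n := by
  rw [← Measure.map_snd_prod, hypVolume, Measure.map_map measurable_hypDist_vertex
    continuous_polar.measurable]
  exact Measure.map_congr ae_prod_hypDist_polar

/-- An absolutely continuous radial measure is determined by the law of the distance to the
vertex, which is absolutely continuous as well. -/
theorem exists_densityMeasure_eq_radialMeasure {n : ℕ} [NeZero n] {ρ : HypSpace n → ℝ}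
    (hρm : AEMeasurable ρ (hypVolume n)) (hρr : IsRadial ρ) :
    ∃ τ : Measure ℝ, SFinite τ ∧ τ ≪ volume.restrict (Ioi 0) ∧
      densityMeasure ρ = radialMeasure n τ := by
  obtain ⟨f, hf⟩ := hρr
  set σ := (volume : Measure (EuclideanSpace ℝ (Fin n))).toSphere with hσ
  have hvol : hypVolume n = (σ.prod (radialVolume n)).map polar := rfl
  have hpm := (continuous_polar (n := n)).measurable
  obtain ⟨g, hgm, hg⟩ : ∃ g : UnitSphere n × ℝ → ℝ, Measurable g ∧
      ∀ᵐ p ∂(σ.prod (radialVolume n)), ρ (polar p) = g p := by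
    have : AEMeasurable (fun p => ρ (polar p)) (σ.prod (radialVolume n)) :=
      (hvol ▸ hρm).comp_measurable hpm
    exact ⟨this.mk, this.measurable_mk, this.ae_eq_mk⟩
  have hfg : ∀ᵐ p ∂(σ.prod (radialVolume n)), f p.2 = g p := by
    filter_upwards [ae_of_ae_map hpm.aemeasurable (hvol ▸ hf), hg, ae_prod_hypDist_polar]
      with p h1 h2 h3
    rw [← h2, h1, h3]
  have hσ0 : NeZero σ := ⟨Measure.toSphere_ne_zero _⟩
  -- The radial profile f need not be measurable. By Fubini, the slice of a measurable
  -- representative of the density along almost every direction ξ agrees with f almost everywhere,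
  -- and it replaces f.
  obtain ⟨ξ, hξ⟩ := (Measure.ae_ae_of_ae_prod hfg).exists
  set f₀ : ℝ → ℝ := fun θ => g (ξ, θ) with hf₀
  have hf₀m : Measurable f₀ := hgm.comp measurable_prodMk_left
  have hff : ∀ᵐ x ∂(hypVolume n), ρ x = f₀ (hypDist (vertex n) x) := by
    have h1 : ∀ᵐ θ ∂((hypVolume n).map (hypDist (vertex n))), f θ = f₀ θ := by
      rw [map_hypDist_hypVolume]
      exact Measure.ae_smul_measure hξ _
    filter_upwards [hf, ae_of_ae_map measurable_hypDist_vertex.aemeasurable h1] with x h2 h3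
    rw [h2, h3]
  have hm : Measurable fun θ => ENNReal.ofReal (f₀ θ) := ENNReal.measurable_ofReal.comp hf₀m
  refine ⟨σ univ • (radialVolume n).withDensity fun θ => ENNReal.ofReal (f₀ θ), inferInstance, ?_, ?_⟩
  · exact ((withDensity_absolutelyContinuous _ _).trans
      (radialVolume_absolutelyContinuous n)).smul_left _
  · have e1 : densityMeasure ρ =
        (hypVolume n).withDensity fun x => ENNReal.ofReal (f₀ (hypDist (vertex n) x)) :=
      withDensity_congr_ae (hff.mono fun x hx => by simp only [hx])
    have e2 : σ.prod ((radialVolume n).withDensity fun θ => ENNReal.ofReal (f₀ θ)) =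
        (σ.prod (radialVolume n)).withDensity fun p => ENNReal.ofReal (f₀ p.2) :=
      prod_withDensity_right hm
    have e3 : σ = σ univ • sphereMeasure n := by
      rw [sphereMeasure, smul_smul, ENNReal.mul_inv_cancel (toSphere_univ_ne_zero n)
        (measure_ne_top _ _), one_smul]
    have e4 : radialMeasure n
        (σ univ • (radialVolume n).withDensity fun θ => ENNReal.ofReal (f₀ θ)) =
        (σ.prod ((radialVolume n).withDensity fun θ => ENNReal.ofReal (f₀ θ))).map polar := by
      rw [radialMeasure, Measure.prod_smul_right, ← Measure.prod_smul_left, ← e3]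
    rw [e1, e4, e2]
    ext s hs
    rw [withDensity_apply _ hs, hvol, Measure.map_apply hpm hs, withDensity_apply _ (hpm hs),
      setLIntegral_map hs (f := fun x => ENNReal.ofReal (f₀ (hypDist (vertex n) x)))
        (hm.comp measurable_hypDist_vertex) hpm]
    refine lintegral_congr_ae (ae_restrict_of_ae ?_)
    filter_upwards [ae_prod_hypDist_polar] with p hp
    rw [hp]

/-! ### The energy of the shifted potential. -/

/-- The potential `G(x, y) + A(d(x, y)) - A(0)`, which is nonnegative. -/
noncomputable def shiftedPotential {n : ℕ} (A : ℝ → ℝ) (x y : HypSpace n) : ℝ≥0∞ :=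
  greenProfile n (hypDist x y) + ENNReal.ofReal (pairProfile A (lorentz x.1 y.1))

theorem measurable_greenProfile (n : ℕ) : Measurable (greenProfile n) := by
  unfold greenProfile
  refine Measurable.div_const (Antitone.measurable fun a b hab => ?_) _
  exact lintegral_mono_set (Ioi_subset_Ioi hab)

theorem measurable_shiftedPotential {n : ℕ} {A : ℝ → ℝ} (hA₀ : ContinuousOn A (Ici 0)) :
    Measurable fun p : HypSpace n × HypSpace n => shiftedPotential A p.1 p.2 := by
  refine ((measurable_greenProfile n).comp continuous_hypDist.measurable).add
    (ENNReal.measurable_ofReal.comp ((continuous_pairProfile hA₀).comp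
      (continuous_lorentz.comp ((continuous_subtype_val.comp continuous_fst).prodMk
        (continuous_subtype_val.comp continuous_snd)))).measurable)

/-- The mutual interaction of two measures for the shifted potential. -/
noncomputable def mutualEnergy {n : ℕ} (A : ℝ → ℝ) (μ ν : Measure (HypSpace n)) : ℝ≥0∞ :=
  ∫⁻ x, ∫⁻ y, shiftedPotential A x y ∂ν ∂μ

/-- The decomposition K = (K - a) + a with every negative part moved to the other side, so that it
can be integrated in `ℝ≥0∞` even where p = ∞. -/
theorem toENNReal_add_ofReal_eq {p : ℝ≥0∞} {α a : ℝ} (h : a ≤ α) :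
    ((p : EReal) + (α : EReal)).toENNReal + ENNReal.ofReal (-a) =
      p + ENNReal.ofReal (α - a) + (ENNReal.ofReal a + (-((p : EReal) + (α : EReal))).toENNReal) := by
  induction p with
  | top => simp
  | coe q =>
    have e : (((q : ℝ≥0∞) : EReal) + (α : EReal)) = ((q + α : ℝ) : EReal) := by
      rw [EReal.coe_add]; rfl
    have hq : (q : ℝ≥0∞) = ENNReal.ofReal q := (ENNReal.ofReal_coe_nnreal).symm
    have h0 : (0 : ℝ) ≤ q := q.2
    rw [e, ← EReal.coe_neg, EReal.real_coe_toENNReal, EReal.real_coe_toENNReal,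
      ← ENNReal.toReal_eq_toReal_iff' (by finiteness) (by finiteness)]
    rw [ENNReal.toReal_add (by finiteness) (by finiteness),
      ENNReal.toReal_add (by finiteness) (by finiteness),
      ENNReal.toReal_add (by finiteness) (by finiteness),
      ENNReal.toReal_add (by finiteness) (by finiteness)]
    simp only [ENNReal.toReal_ofReal', ENNReal.coe_toReal]
    have e1 := max_zero_sub_max_neg_zero_eq_self ((q : ℝ) + α)
    have e2 := max_zero_sub_max_neg_zero_eq_self a
    have e3 := max_eq_left (sub_nonneg.2 h)
    linarith

theorem toENNReal_neg_le {p : ℝ≥0∞} {α a : ℝ} (h : a ≤ α) :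
    (-((p : EReal) + (α : EReal))).toENNReal ≤ ENNReal.ofReal (-a) := by
  rw [← EReal.real_coe_toENNReal, EReal.coe_neg]
  refine EReal.toENNReal_le_toENNReal (EReal.neg_le_neg_iff.2 ?_)
  calc (a : EReal) ≤ (α : EReal) := by exact_mod_cast h
    _ = 0 + (α : EReal) := (zero_add _).symm
    _ ≤ (p : EReal) + α := add_le_add_left (EReal.coe_ennreal_nonneg p) _

theorem coe_newtonPotential {n : ℕ} {A : ℝ → ℝ} (hA : ∀ C, 0 ≤ pairProfile A C) (x y : HypSpace n) :
    (newtonPotential A x y).toENNReal + ENNReal.ofReal (-A 0) =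
      shiftedPotential A x y + (ENNReal.ofReal (A 0) + (-newtonPotential A x y).toENNReal) := by
  have h := hA (lorentz x.1 y.1)
  rw [pairProfile_lorentz] at h
  rw [newtonPotential, toENNReal_add_ofReal_eq (sub_nonneg.1 h), shiftedPotential,
    pairProfile_lorentz]

/-- Because K ≥ A(0), the negative part has finite integral and ∞ - ∞ never occurs. Comparing
energies of probability measures thus reduces to comparing integrals of a nonnegative kernel. -/
theorem interactionEnergy_newtonPotential {n : ℕ} {A : ℝ → ℝ} (hA₀ : ContinuousOn A (Ici 0))
    (hA : ∀ C, 0 ≤ pairProfile A C) (μ : Measure (HypSpace n)) [IsProbabilityMeasure μ] :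
    interactionEnergy (newtonPotential A) μ =
      ((1 / 2 : ℝ) : EReal) * ((mutualEnergy A μ μ : EReal) + (A 0 : EReal)) := by
  have hm := measurable_shiftedPotential (n := n) hA₀
  have hprod : mutualEnergy A μ μ = ∫⁻ p, shiftedPotential A p.1 p.2 ∂(μ.prod μ) :=
    (lintegral_prod _ hm.aemeasurable).symm
  unfold interactionEnergy
  congr 1
  rw [hprod]
  set X := ∫⁻ p, (newtonPotential A p.1 p.2).toENNReal ∂(μ.prod μ)
  set Y := ∫⁻ p, (-newtonPotential A p.1 p.2).toENNReal ∂(μ.prod μ)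
  set I := ∫⁻ p, shiftedPotential A p.1 p.2 ∂(μ.prod μ)
  have hXY : X + ENNReal.ofReal (-A 0) = I + (ENNReal.ofReal (A 0) + Y) := by
    have h1 : ∫⁻ p, ((newtonPotential A p.1 p.2).toENNReal + ENNReal.ofReal (-A 0)) ∂(μ.prod μ) =
        ∫⁻ p, (shiftedPotential A p.1 p.2 +
          (ENNReal.ofReal (A 0) + (-newtonPotential A p.1 p.2).toENNReal)) ∂(μ.prod μ) :=
      lintegral_congr fun p => coe_newtonPotential hA p.1 p.2
    rw [lintegral_add_right _ measurable_const, lintegral_add_left hm,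
      lintegral_add_left measurable_const] at h1
    simpa using h1
  have hY : Y ≠ ∞ := by
    have : Y ≤ ∫⁻ p, ENNReal.ofReal (-A 0) ∂(μ.prod μ) := by
      refine lintegral_mono fun p => ?_
      have h := hA (lorentz p.1.1 p.2.1)
      rw [pairProfile_lorentz] at h
      exact toENNReal_neg_le (sub_nonneg.1 h)
    refine ne_top_of_le_ne_top ?_ this
    simp
  by_cases hI : I = ∞
  · have hX : X = ∞ := by
      rw [hI, top_add] at hXY
      by_contra h
      exact ENNReal.add_ne_top.2 ⟨h, ENNReal.ofReal_ne_top⟩ hXY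
    rw [hX, hI, ← ENNReal.ofReal_toReal hY]
    simp
  · have hX : X ≠ ∞ := by
      intro h
      rw [h, top_add] at hXY
      exact ENNReal.add_ne_top.2 ⟨hI, ENNReal.add_ne_top.2 ⟨ENNReal.ofReal_ne_top, hY⟩⟩ hXY.symm
    rw [← EReal.coe_ennreal_toReal hX, ← EReal.coe_ennreal_toReal hY, ← EReal.coe_ennreal_toReal hI,
      ← EReal.coe_sub, ← EReal.coe_add, EReal.coe_eq_coe_iff]
    have h2 := congrArg ENNReal.toReal hXY
    rw [ENNReal.toReal_add hX (by finiteness), ENNReal.toReal_add hI (by finiteness),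
      ENNReal.toReal_add (by finiteness) hY, ENNReal.toReal_ofReal', ENNReal.toReal_ofReal'] at h2
    have e2 := max_zero_sub_max_neg_zero_eq_self (A 0)
    linarith

theorem mutualEnergy_le_of_interactionEnergy_le {n : ℕ} {A : ℝ → ℝ} (hA₀ : ContinuousOn A (Ici 0))
    (hA : ∀ C, 0 ≤ pairProfile A C) {μ σ : Measure (HypSpace n)} [IsProbabilityMeasure μ]
    [IsProbabilityMeasure σ]
    (h : interactionEnergy (newtonPotential A) μ ≤ interactionEnergy (newtonPotential A) σ) :
    mutualEnergy A μ μ ≤ mutualEnergy A σ σ := by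
  rw [interactionEnergy_newtonPotential hA₀ hA, interactionEnergy_newtonPotential hA₀ hA] at h
  by_cases hσ : mutualEnergy A σ σ = ∞
  · rw [hσ]; exact le_top
  by_cases hμ : mutualEnergy A μ μ = ∞
  · exfalso
    rw [hμ, ← EReal.coe_ennreal_toReal hσ, ← EReal.coe_add, ← EReal.coe_mul,
      EReal.coe_ennreal_top, EReal.top_add_coe, EReal.coe_mul_top_of_pos (by norm_num)] at h
    exact absurd h (not_le.2 (EReal.coe_lt_top _))
  · rw [← EReal.coe_ennreal_toReal hσ, ← EReal.coe_ennreal_toReal hμ, ← EReal.coe_add,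
      ← EReal.coe_add, ← EReal.coe_mul, ← EReal.coe_mul, EReal.coe_le_coe_iff] at h
    exact (ENNReal.toReal_le_toReal hμ hσ).1 (by linarith)

/-! ### Transport cost of redistributing mass. -/

/-- The coupling leaves μ₁ in place and moves μ₂ by the product coupling with ν. The cost follows
from d(x, y)² ≤ 2 d(x, v)² + 2 d(y, v)². It is small as soon as μ₂ has small mass and second moment,
wherever ν sits. -/
theorem wasserstein_add_smul_le {n : ℕ} (μ₁ μ₂ ν : Measure (HypSpace n)) [IsFiniteMeasure μ₁]
    [IsFiniteMeasure μ₂] [IsProbabilityMeasure ν] :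
    wasserstein (μ₁ + μ₂) (μ₁ + μ₂ univ • ν) ≤
      (2 * ∫⁻ x, ENNReal.ofReal (hypDist x (vertex n) ^ 2) ∂μ₂ +
        2 * μ₂ univ * ∫⁻ x, ENNReal.ofReal (hypDist x (vertex n) ^ 2) ∂ν) ^ (1 / 2 : ℝ) := by
  have hd : Measurable fun x : HypSpace n => (x, x) := measurable_id.prodMk measurable_id
  have hm : Measurable fun p : HypSpace n × HypSpace n => ENNReal.ofReal (hypDist p.1 p.2 ^ 2) :=
    ENNReal.measurable_ofReal.comp (continuous_hypDist.pow 2).measurable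
  have hm1 : Measurable fun x : HypSpace n => ENNReal.ofReal (hypDist x (vertex n) ^ 2) :=
    ENNReal.measurable_ofReal.comp ((continuous_hypDist.comp
      (continuous_id.prodMk continuous_const)).pow 2).measurable
  unfold wasserstein
  refine ENNReal.rpow_le_rpow ?_ (by norm_num)
  refine (iInf₂_le (μ₁.map (fun x => (x, x)) + μ₂.prod ν) ⟨?_, ?_⟩).trans ?_
  · have h0 : ∀ x : HypSpace n, hypDist x x = 0 := fun x => by
      rw [hypDist, x.2.1, Real.arcosh_zero]
    rw [lintegral_add_measure, lintegral_map hm hd]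
    simp only [h0]
    rw [lintegral_prod _ hm.aemeasurable]
    simp only [ne_eq, OfNat.ofNat_ne_zero, not_false_eq_true, zero_pow, ENNReal.ofReal_zero,
      lintegral_zero, zero_add]
    calc ∫⁻ x, ∫⁻ y, ENNReal.ofReal (hypDist x y ^ 2) ∂ν ∂μ₂
        ≤ ∫⁻ x, ∫⁻ y, (2 * ENNReal.ofReal (hypDist x (vertex n) ^ 2) +
            2 * ENNReal.ofReal (hypDist y (vertex n) ^ 2)) ∂ν ∂μ₂ := by
          refine lintegral_mono fun x => lintegral_mono fun y => ?_
          have e2 : (2 : ℝ≥0∞) = ENNReal.ofReal 2 := by simp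
          rw [e2, ← ENNReal.ofReal_mul (by norm_num), ← ENNReal.ofReal_mul (by norm_num),
            ← ENNReal.ofReal_add (by positivity) (by positivity)]
          refine ENNReal.ofReal_le_ofReal ?_
          have h1 := hypDist_le_add x y
          rw [hypDist_comm (vertex n) x, hypDist_comm (vertex n) y] at h1
          have h2 := hypDist_nonneg x y
          nlinarith [sq_nonneg (hypDist x (vertex n) - hypDist y (vertex n))]
      _ = _ := by
          simp only [lintegral_add_left measurable_const, lintegral_const, measure_univ, mul_one,
            lintegral_const_mul _ hm1]
          rw [lintegral_add_right _ measurable_const, lintegral_const_mul _ hm1, lintegral_const]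
          ring
  · rw [Measure.map_add _ _ measurable_fst, Measure.map_map measurable_fst hd,
      Measure.map_fst_prod, measure_univ, one_smul]
    congr 1
    exact Measure.map_id
  · rw [Measure.map_add _ _ measurable_snd, Measure.map_map measurable_snd hd,
      Measure.map_snd_prod]
    congr 1
    exact Measure.map_id

theorem lintegral_hypDist_radialMeasure {n : ℕ} [NeZero n] {τ : Measure ℝ} [SFinite τ]
    (hτ : τ ≪ volume.restrict (Ioi 0)) :
    ∫⁻ x, ENNReal.ofReal (hypDist x (vertex n) ^ 2) ∂(radialMeasure n τ) =
      ∫⁻ r, ENNReal.ofReal (r ^ 2) ∂τ := by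
  have hm1 : Measurable fun x : HypSpace n => ENNReal.ofReal (hypDist x (vertex n) ^ 2) :=
    ENNReal.measurable_ofReal.comp ((continuous_hypDist.comp
      (continuous_id.prodMk continuous_const)).pow 2).measurable
  rw [lintegral_radialMeasure hm1]
  refine lintegral_congr_ae ?_
  filter_upwards [hτ.ae_le (ae_restrict_mem measurableSet_Ioi)] with r hr
  simp only [hypDist_comm _ (vertex n), hypDist_vertex_polar _ (le_of_lt hr), lintegral_const,
    measure_univ, mul_one]

/-! ### The radial kernel. -/

/-- The constant `1 / (n α(n))`. -/
noncomputable def greenConst (n : ℕ) : ℝ :=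
  ((volume : Measure (EuclideanSpace ℝ (Fin n))).toSphere univ).toReal⁻¹

theorem greenConst_pos (n : ℕ) [NeZero n] : 0 < greenConst n :=
  inv_pos.2 (ENNReal.toReal_pos (toSphere_univ_ne_zero n) (measure_ne_top _ _))

theorem greenProfile_eq {n : ℕ} (hn : 2 ≤ n) [NeZero n] {θ : ℝ} (hθ : 0 < θ) :
    greenProfile n θ = ENNReal.ofReal (greenConst n * greenTail n θ) := by
  have h : (n : ℝ≥0∞) * volume (Metric.ball (0 : EuclideanSpace ℝ (Fin n)) 1) =
      (volume : Measure (EuclideanSpace ℝ (Fin n))).toSphere univ := by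
    rw [Measure.toSphere_apply_univ]; simp
  rw [greenProfile, lintegral_inv_sinh_pow hn hθ, h, ENNReal.div_eq_inv_mul,
    ENNReal.ofReal_mul (greenConst_pos n).le, greenConst, ENNReal.ofReal_inv_of_pos,
    ENNReal.ofReal_toReal (measure_ne_top _ _)]
  exact inv_pos.1 (greenConst_pos n)

/-- The average of the shifted potential over a pair of geodesic spheres around the vertex. -/
noncomputable def radialKernel {n : ℕ} (A : ℝ → ℝ) (e : UnitSphere n) (r s : ℝ) : ℝ :=
  greenConst n * greenTail n (max r s) + sphereAvg (pairProfile A) e r s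

theorem radialKernel_comm {n : ℕ} (A : ℝ → ℝ) (e : UnitSphere n) (r s : ℝ) :
    radialKernel A e r s = radialKernel A e s r := by
  rw [radialKernel, max_comm, sphereAvg_comm, radialKernel]

theorem SubharmonicProfile.pairProfile_mono {n : ℕ} (hn : 2 ≤ n) {A : ℝ → ℝ}
    (hA₀ : ContinuousOn A (Ici 0)) (hb : SubharmonicProfile n (pairProfile A)) :
    Monotone (pairProfile A) := by
  intro C D h
  have e : ∀ C, pairProfile A C = pairProfile A (max C 1) := fun C => by simp [pairProfile]
  rw [e C, e D]
  exact (hb.strictMonoOn hn (continuous_pairProfile hA₀)).monotoneOn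
    (mem_Ici.2 (le_max_right _ _)) (mem_Ici.2 (le_max_right _ _)) (max_le_max_right _ h)

theorem SubharmonicProfile.pairProfile_nonneg {n : ℕ} (hn : 2 ≤ n) {A : ℝ → ℝ}
    (hA₀ : ContinuousOn A (Ici 0)) (hb : SubharmonicProfile n (pairProfile A)) (C : ℝ) :
    0 ≤ pairProfile A C := by
  have h := hb.pairProfile_mono hn hA₀ (min_le_left C 1)
  refine le_trans (le_of_eq ?_) h
  rw [pairProfile, max_eq_right (min_le_right _ _), Real.arcosh_zero, sub_self]

theorem sphereAvg_nonneg {n : ℕ} {b : ℝ → ℝ} (hb : ∀ C, 0 ≤ b C) (e : UnitSphere n) (r s : ℝ) :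
    0 ≤ sphereAvg b e r s :=
  integral_nonneg fun _ => hb _

/-- Antitonicity cannot be used on all of ℝ: for θ ≤ 0 the integral may diverge and take the default
value 0. Joint measurability of the integrand avoids this. -/
theorem measurable_greenTail (n : ℕ) : Measurable (greenTail n) := by
  have h : greenTail n = fun θ => ∫ ζ, (Ioi θ).indicator (fun ζ => 1 / Real.sinh ζ ^ (n - 1)) ζ := by
    funext θ
    rw [greenTail, integral_indicator measurableSet_Ioi]
  rw [h]
  refine (StronglyMeasurable.integral_prod_right (ν := volume)
    (f := fun θ ζ : ℝ => (Ioi θ).indicator (fun ζ => 1 / Real.sinh ζ ^ (n - 1)) ζ) ?_).measurable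
  have h2 : (Function.uncurry fun θ ζ : ℝ =>
      (Ioi θ).indicator (fun ζ => 1 / Real.sinh ζ ^ (n - 1)) ζ) =
      {p : ℝ × ℝ | p.1 < p.2}.indicator fun p => 1 / Real.sinh p.2 ^ (n - 1) := by
    ext p
    simp [Function.uncurry, indicator]
  rw [h2]
  refine Measurable.stronglyMeasurable (Measurable.indicator ?_ (measurableSet_lt measurable_fst
    measurable_snd))
  exact measurable_const.div ((Real.measurable_sinh.comp measurable_snd).pow_const _)

theorem measurable_radialKernel {n : ℕ} [NeZero n] {A : ℝ → ℝ} (hA₀ : ContinuousOn A (Ici 0))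
    (e : UnitSphere n) : Measurable fun p : ℝ × ℝ => radialKernel A e p.1 p.2 :=
  (((measurable_greenTail n).comp (measurable_fst.max measurable_snd)).const_mul _).add
    (continuous_sphereAvg (continuous_pairProfile hA₀) e).measurable

theorem continuousOn_greenTail {n : ℕ} (hn : 2 ≤ n) : ContinuousOn (greenTail n) (Ioi 0) :=
  fun _ hr => (hasDerivAt_greenTail hn hr).continuousAt.continuousWithinAt

theorem continuousOn_radialKernel {n : ℕ} (hn : 2 ≤ n) [NeZero n] {A : ℝ → ℝ}
    (hA₀ : ContinuousOn A (Ici 0)) (e : UnitSphere n) :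
    ContinuousOn (fun p : ℝ × ℝ => radialKernel A e p.1 p.2) {p | 0 < p.1} := by
  refine ContinuousOn.add (continuousOn_const.mul ?_)
    (continuous_sphereAvg (continuous_pairProfile hA₀) e).continuousOn
  exact (continuousOn_greenTail hn).comp (continuous_fst.max continuous_snd).continuousOn
    fun p hp => mem_Ioi.2 (lt_max_of_lt_left hp)

theorem lintegral_shiftedPotential_polar {n : ℕ} (hn : 2 ≤ n) [NeZero n] {A : ℝ → ℝ}
    (hA₀ : ContinuousOn A (Ici 0)) (hb : SubharmonicProfile n (pairProfile A)) (e e' : UnitSphere n)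
    {r s : ℝ} (hr : 0 ≤ r) (hs : 0 ≤ s) (hrs : r ≠ s) :
    ∫⁻ ξ, shiftedPotential A (polar (e', r)) (polar (ξ, s)) ∂(sphereMeasure n) =
      ENNReal.ofReal (radialKernel A e r s) := by
  have h1 : ∀ ξ : UnitSphere n, shiftedPotential A (polar (e', r)) (polar (ξ, s)) =
      ENNReal.ofReal (greenConst n * greenCosh n (Real.cosh r * Real.cosh s -
        Real.sinh r * Real.sinh s * inner ℝ e'.1 ξ.1) + pairProfile A (Real.cosh r * Real.cosh s -
        Real.sinh r * Real.sinh s * inner ℝ e'.1 ξ.1)) := by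
    intro ξ
    have hl := one_lt_sphere e' ξ hr hs hrs
    have hd : hypDist (polar (e', r)) (polar (ξ, s)) = Real.arcosh (Real.cosh r * Real.cosh s -
        Real.sinh r * Real.sinh s * inner ℝ e'.1 ξ.1) := by rw [hypDist, lorentz_polar_polar]
    rw [shiftedPotential, hd, lorentz_polar_polar, greenProfile_eq hn (Real.arcosh_pos hl),
      greenCosh, ENNReal.ofReal_add _ (hb.pairProfile_nonneg hn hA₀ _)]
    exact mul_nonneg (greenConst_pos n).le (greenTail_nonneg n (Real.arcosh_pos hl).le)
  have i1 := (integrable_sphere (continuousOn_greenCosh hn) e' hr hs hrs).const_mul (greenConst n)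
  have i2 := integrable_sphere hb.continuousOn e' hr hs hrs
  simp only [h1]
  refine (ofReal_integral_eq_lintegral_ofReal (i1.add i2) ?_).symm.trans ?_
  swap
  · congr 1
    refine (integral_add i1 i2).trans ?_
    rw [integral_const_mul]
    change greenConst n * sphereAvg (greenCosh n) e' r s + sphereAvg (pairProfile A) e' r s = _
    rw [sphereAvg_greenCosh hn hb e' hr hs hrs, sphereAvg_eq _ e' e]
    rfl
  · refine Eventually.of_forall fun ξ => add_nonneg ?_ (hb.pairProfile_nonneg hn hA₀ _)
    exact mul_nonneg (greenConst_pos n).le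
      (greenTail_nonneg n (Real.arcosh_pos (one_lt_sphere e' ξ hr hs hrs)).le)

/-- The mutual interaction of two radial measures in terms of their radial laws. -/
noncomputable def radialEnergy {n : ℕ} (A : ℝ → ℝ) (e : UnitSphere n) (τ χ : Measure ℝ) : ℝ≥0∞ :=
  ∫⁻ r, ∫⁻ s, ENNReal.ofReal (radialKernel A e r s) ∂χ ∂τ

theorem ae_ne_of_absolutelyContinuous {χ : Measure ℝ} (hχ : χ ≪ volume.restrict (Ioi 0)) (r : ℝ) :
    ∀ᵐ s ∂χ, r ≠ s := by
  refine hχ.ae_le (ae_restrict_of_ae ?_)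
  have : ∀ᵐ s ∂(volume : Measure ℝ), s ≠ r := by
    rw [ae_iff]
    simp
  exact this.mono fun s hs => hs.symm

theorem ae_pos_of_absolutelyContinuous {χ : Measure ℝ} (hχ : χ ≪ volume.restrict (Ioi 0)) :
    ∀ᵐ s ∂χ, 0 < s :=
  hχ.ae_le (ae_restrict_mem measurableSet_Ioi)

theorem measurable_shiftedPotential_right {n : ℕ} {A : ℝ → ℝ} (hA₀ : ContinuousOn A (Ici 0))
    (x : HypSpace n) : Measurable (shiftedPotential A x) := by
  refine ((measurable_greenProfile n).comp (continuous_hypDist.comp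
    (continuous_const.prodMk continuous_id)).measurable).add
    (ENNReal.measurable_ofReal.comp ((continuous_pairProfile hA₀).comp
      (continuous_lorentz.comp (continuous_const.prodMk continuous_subtype_val))).measurable)

/-- Newton's theorem is available for r ≠ s only; absolute continuity of χ makes the exceptional s
negligible. -/
theorem mutualEnergy_radialMeasure {n : ℕ} (hn : 2 ≤ n) [NeZero n] {A : ℝ → ℝ}
    (hA₀ : ContinuousOn A (Ici 0)) (hb : SubharmonicProfile n (pairProfile A)) (e : UnitSphere n)
    {τ χ : Measure ℝ} [SFinite τ] [SFinite χ] (hτ : τ ≪ volume.restrict (Ioi 0))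
    (hχ : χ ≪ volume.restrict (Ioi 0)) :
    mutualEnergy A (radialMeasure n τ) (radialMeasure n χ) = radialEnergy A e τ χ := by
  have hm := measurable_shiftedPotential (n := n) hA₀
  rw [mutualEnergy, lintegral_radialMeasure hm.lintegral_prod_right', radialEnergy]
  refine lintegral_congr_ae ?_
  filter_upwards [ae_pos_of_absolutelyContinuous hτ] with r hr
  have : ∀ ξ : UnitSphere n, ∫⁻ y, shiftedPotential A (polar (ξ, r)) y ∂(radialMeasure n χ) =
      ∫⁻ s, ENNReal.ofReal (radialKernel A e r s) ∂χ := by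
    intro ξ
    rw [lintegral_radialMeasure (measurable_shiftedPotential_right hA₀ (polar (ξ, r)))]
    refine lintegral_congr_ae ?_
    filter_upwards [ae_pos_of_absolutelyContinuous hχ, ae_ne_of_absolutelyContinuous hχ r]
      with s hs hrs
    exact lintegral_shiftedPotential_polar hn hA₀ hb e ξ hr.le hs.le hrs
  simp only [this, lintegral_const, measure_univ, mul_one]

/-! ### Local minimality, finite energy and the first variation. -/

/-- Local minimality in terms of the radial laws. -/
theorem IsLocalEnergyMinimizer.exists_radialEnergy_le {n : ℕ} (hn : 2 ≤ n) [NeZero n] {A : ℝ → ℝ}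
    (hA₀ : ContinuousOn A (Ici 0)) (hb : SubharmonicProfile n (pairProfile A)) (e : UnitSphere n)
    {τ : Measure ℝ} [IsProbabilityMeasure τ] (hτ : τ ≪ volume.restrict (Ioi 0))
    (hmin : IsLocalEnergyMinimizer (newtonPotential A) (radialMeasure n τ)) :
    ∃ ε : ℝ≥0∞, 0 < ε ∧ ∀ τ₁ τ₂ χ : Measure ℝ, IsFiniteMeasure τ₁ → IsFiniteMeasure τ₂ →
      IsProbabilityMeasure χ → χ ≪ volume.restrict (Ioi 0) → τ = τ₁ + τ₂ →
      ∫⁻ r, ENNReal.ofReal (r ^ 2) ∂χ < ∞ →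
      2 * ∫⁻ r, ENNReal.ofReal (r ^ 2) ∂τ₂ + 2 * τ₂ univ * ∫⁻ r, ENNReal.ofReal (r ^ 2) ∂χ < ε →
      radialEnergy A e τ τ ≤
        radialEnergy A e (τ₁ + τ₂ univ • χ) (τ₁ + τ₂ univ • χ) := by
  obtain ⟨⟨-, hmom⟩, ε, hε, hle⟩ := hmin
  rw [lintegral_hypDist_radialMeasure hτ] at hmom
  -- The smallness condition bounds the squared Wasserstein distance, hence ε².
  refine ⟨ENNReal.ofReal ε ^ (2 : ℝ), ENNReal.rpow_pos (ENNReal.ofReal_pos.2 hε) (by simp), ?_⟩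
  intro τ₁ τ₂ χ _ _ _ hχ hsum hχ2 hsmall
  have hτ₁ : τ₁ ≪ volume.restrict (Ioi 0) :=
    (Measure.absolutelyContinuous_of_le (hsum ▸ Measure.le_add_right le_rfl)).trans hτ
  have hτ₂ : τ₂ ≪ volume.restrict (Ioi 0) :=
    (Measure.absolutelyContinuous_of_le (hsum ▸ Measure.le_add_left le_rfl)).trans hτ
  have hτ' : τ₁ + τ₂ univ • χ ≪ volume.restrict (Ioi 0) := hτ₁.add_left (hχ.smul_left _)
  have hfin : IsFiniteMeasure (τ₂ univ • χ) := ⟨by simp⟩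
  have hprob : IsProbabilityMeasure (τ₁ + τ₂ univ • χ) := by
    refine ⟨?_⟩
    have h1 : τ univ = 1 := measure_univ
    rw [hsum] at h1
    simpa using h1
  have hpτ : IsProbabilityMeasure (radialMeasure n τ) := isProbabilityMeasure_radialMeasure
  have hpτ' : IsProbabilityMeasure (radialMeasure n (τ₁ + τ₂ univ • χ)) :=
    isProbabilityMeasure_radialMeasure
  have hpχ : IsProbabilityMeasure (radialMeasure n χ) := isProbabilityMeasure_radialMeasure
  have hf₁ : IsFiniteMeasure (radialMeasure n τ₁) := ⟨by rw [radialMeasure_univ]; simp⟩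
  have hf₂ : IsFiniteMeasure (radialMeasure n τ₂) := ⟨by rw [radialMeasure_univ]; simp⟩
  rw [← mutualEnergy_radialMeasure hn hA₀ hb e hτ hτ,
    ← mutualEnergy_radialMeasure hn hA₀ hb e hτ' hτ']
  refine mutualEnergy_le_of_interactionEnergy_le hA₀ (hb.pairProfile_nonneg hn hA₀)
    (hle _ ⟨hpτ', ?_⟩ ?_)
  · rw [lintegral_hypDist_radialMeasure hτ', lintegral_add_measure, lintegral_smul_measure]
    refine ENNReal.add_lt_top.2 ⟨lt_of_le_of_lt ?_ hmom, ENNReal.mul_lt_top (by simp) hχ2⟩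
    exact lintegral_mono' (hsum ▸ Measure.le_add_right le_rfl) le_rfl
  · have hw := wasserstein_add_smul_le (radialMeasure n τ₁) (radialMeasure n τ₂) (radialMeasure n χ)
    rw [radialMeasure_univ, ← radialMeasure_add, ← hsum, ← radialMeasure_smul, ← radialMeasure_add,
      lintegral_hypDist_radialMeasure hτ₂, lintegral_hypDist_radialMeasure hχ] at hw
    refine hw.trans_lt ?_
    refine (ENNReal.rpow_lt_rpow hsmall (by norm_num : (0 : ℝ) < 1 / 2)).trans_eq ?_
    rw [← ENNReal.rpow_mul]
    norm_num

theorem radialKernel_nonneg {n : ℕ} (hn : 2 ≤ n) [NeZero n] {A : ℝ → ℝ}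
    (hA₀ : ContinuousOn A (Ici 0)) (hb : SubharmonicProfile n (pairProfile A)) (e : UnitSphere n)
    {r : ℝ} (hr : 0 ≤ r) (s : ℝ) : 0 ≤ radialKernel A e r s :=
  add_nonneg (mul_nonneg (greenConst_pos n).le (greenTail_nonneg n (le_max_of_le_left hr)))
    (sphereAvg_nonneg (hb.pairProfile_nonneg hn hA₀) e r s)

theorem radialEnergy_add_left {n : ℕ} (A : ℝ → ℝ) (e : UnitSphere n) (τ τ' χ : Measure ℝ) :
    radialEnergy A e (τ + τ') χ = radialEnergy A e τ χ + radialEnergy A e τ' χ :=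
  lintegral_add_measure _ _ _

theorem radialEnergy_smul_left {n : ℕ} (A : ℝ → ℝ) (e : UnitSphere n) (c : ℝ≥0∞) (τ χ : Measure ℝ) :
    radialEnergy A e (c • τ) χ = c * radialEnergy A e τ χ :=
  lintegral_smul_measure _ _

theorem measurable_ofReal_radialKernel {n : ℕ} [NeZero n] {A : ℝ → ℝ}
    (hA₀ : ContinuousOn A (Ici 0)) (e : UnitSphere n) :
    Measurable (Function.uncurry fun r s => ENNReal.ofReal (radialKernel A e r s)) :=
  ENNReal.measurable_ofReal.comp (measurable_radialKernel hA₀ e)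

theorem measurable_lintegral_radialKernel {n : ℕ} [NeZero n] {A : ℝ → ℝ}
    (hA₀ : ContinuousOn A (Ici 0)) (e : UnitSphere n)
    (χ : Measure ℝ) [SFinite χ] :
    Measurable fun r => ∫⁻ s, ENNReal.ofReal (radialKernel A e r s) ∂χ :=
  (measurable_ofReal_radialKernel hA₀ e).lintegral_prod_right'

theorem radialEnergy_comm {n : ℕ} [NeZero n] {A : ℝ → ℝ}
    (hA₀ : ContinuousOn A (Ici 0)) (e : UnitSphere n) (τ χ : Measure ℝ)
    [SFinite τ] [SFinite χ] : radialEnergy A e τ χ = radialEnergy A e χ τ := by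
  unfold radialEnergy
  rw [lintegral_lintegral_swap (measurable_ofReal_radialKernel hA₀ e).aemeasurable]
  simp only [radialKernel_comm A e]

theorem radialEnergy_smul_right {n : ℕ} [NeZero n] {A : ℝ → ℝ} (hA₀ : ContinuousOn A (Ici 0))
    (e : UnitSphere n) (c : ℝ≥0∞) (τ χ : Measure ℝ) [SFinite τ] [SFinite χ] :
    radialEnergy A e τ (c • χ) = c * radialEnergy A e τ χ := by
  rw [radialEnergy_comm hA₀, radialEnergy_smul_left, radialEnergy_comm hA₀]

theorem radialEnergy_lt_top_of_Icc {n : ℕ} (hn : 2 ≤ n) [NeZero n] {A : ℝ → ℝ}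
    (hA₀ : ContinuousOn A (Ici 0)) (e : UnitSphere n) {χ : Measure ℝ} [IsFiniteMeasure χ]
    {p q : ℝ} (hp : 0 < p) (hχ : χ (Icc p q)ᶜ = 0) : radialEnergy A e χ χ < ∞ := by
  obtain ⟨C, hC⟩ := (isCompact_Icc (a := p) (b := q)).prod (isCompact_Icc (a := p) (b := q))
    |>.exists_bound_of_continuousOn ((continuousOn_radialKernel hn hA₀ e).mono
      fun z hz => hp.trans_le hz.1.1)
  have hae : ∀ᵐ r ∂χ, r ∈ Icc p q := mem_ae_iff.2 hχ
  have h : radialEnergy A e χ χ ≤ ∫⁻ _, ∫⁻ _, ENNReal.ofReal C ∂χ ∂χ := by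
    refine lintegral_mono_ae ?_
    filter_upwards [hae] with r hr
    refine lintegral_mono_ae ?_
    filter_upwards [hae] with s hs
    exact ENNReal.ofReal_le_ofReal ((le_abs_self _).trans (hC (r, s) ⟨hr, hs⟩))
  refine h.trans_lt ?_
  simp only [lintegral_const]
  finiteness

theorem exists_Icc_compl_small {τ : Measure ℝ} [IsFiniteMeasure τ]
    (hτ : τ ≪ volume.restrict (Ioi 0)) (hM : ∫⁻ r, ENNReal.ofReal (r ^ 2) ∂τ ≠ ∞) {δ : ℝ≥0∞}
    (hδ : 0 < δ) : ∃ p q : ℝ, 0 < p ∧ τ (Icc p q)ᶜ < δ ∧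
      ∫⁻ r in (Icc p q)ᶜ, ENNReal.ofReal (r ^ 2) ∂τ < δ := by
  -- Continuity from above for this one finite measure controls the mass and the second moment of
  -- the tails together.
  set m := τ + τ.withDensity fun r => ENNReal.ofReal (r ^ 2) with hm
  have hf : IsFiniteMeasure (τ.withDensity fun r => ENNReal.ofReal (r ^ 2)) :=
    isFiniteMeasure_withDensity hM
  have hmτ : m ≪ τ := Measure.AbsolutelyContinuous.rfl.add_left (withDensity_absolutelyContinuous _ _)
  let s : ℕ → Set ℝ := fun k => (Icc (1 / ((k : ℝ) + 1)) k)ᶜ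
  have hanti : Antitone s := by
    intro j k hjk
    refine compl_subset_compl.2 (Icc_subset_Icc ?_ (by exact_mod_cast hjk))
    exact one_div_le_one_div_of_le (by positivity) (by gcongr)
  have hinter : ⋂ k, s k = Iic 0 := by
    ext x
    simp only [s, mem_iInter, mem_compl_iff, mem_Icc, mem_Iic]
    constructor
    · intro h
      by_contra! hx
      obtain ⟨j, hj⟩ := exists_nat_one_div_lt hx
      obtain ⟨k, hk⟩ := exists_nat_ge x
      refine h (max j k) ⟨le_trans ?_ hj.le, hk.trans (by exact_mod_cast le_max_right j k)⟩
      refine one_div_le_one_div_of_le (by positivity) ?_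
      have : (j : ℝ) ≤ ((max j k : ℕ) : ℝ) := by exact_mod_cast le_max_left j k
      linarith
    · intro hx k h
      have : (0 : ℝ) < 1 / ((k : ℝ) + 1) := by positivity
      linarith [h.1]
  have hm0 : m (Iic 0) = 0 := by
    refine hmτ (hτ ?_)
    rw [Measure.restrict_apply measurableSet_Iic, Iic_inter_Ioi, Ioc_self, measure_empty]
  have ht := tendsto_measure_iInter_atTop (μ := m) (s := s)
    (fun k => measurableSet_Icc.compl.nullMeasurableSet) hanti ⟨0, measure_ne_top _ _⟩
  rw [hinter, hm0] at ht
  obtain ⟨k, hk⟩ := (ht.eventually (gt_mem_nhds hδ)).exists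
  have hk' : τ (s k) + ∫⁻ r in s k, ENNReal.ofReal (r ^ 2) ∂τ < δ := by
    rw [← withDensity_apply _ measurableSet_Icc.compl]
    exact hk
  exact ⟨_, _, by positivity, lt_of_le_of_lt le_self_add hk', lt_of_le_of_lt le_add_self hk'⟩

/-- Moving the little mass outside a large interval [p, q] ⊂ (0, ∞) onto the normalized restriction
of τ to it gives a nearby competitor. Its energy is finite because the kernel is bounded there. -/
theorem radialEnergy_lt_top_of_isLocalEnergyMinimizer {n : ℕ} (hn : 2 ≤ n) [NeZero n] {A : ℝ → ℝ}
    (hA₀ : ContinuousOn A (Ici 0)) (hb : SubharmonicProfile n (pairProfile A)) (e : UnitSphere n)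
    {τ : Measure ℝ} [IsProbabilityMeasure τ] (hτ : τ ≪ volume.restrict (Ioi 0))
    (hmin : IsLocalEnergyMinimizer (newtonPotential A) (radialMeasure n τ)) :
    radialEnergy A e τ τ < ∞ := by
  obtain ⟨ε, hε, hle⟩ := hmin.exists_radialEnergy_le hn hA₀ hb e hτ
  have hM : ∫⁻ r, ENNReal.ofReal (r ^ 2) ∂τ < ∞ := by
    rw [← lintegral_hypDist_radialMeasure (n := n) hτ]; exact hmin.1.2
  set M := ∫⁻ r, ENNReal.ofReal (r ^ 2) ∂τ
  -- If the tails have mass and second moment at most d and the interval has mass at least 1/2, the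
  -- receiving law has second moment at most 2M. The cost is then at most 2d + 2d · 2M.
  obtain ⟨d, hd, hdε⟩ := ENNReal.exists_nnreal_pos_mul_lt (a := 2 + 4 * M) (b := ε)
    (by finiteness) hε.ne'
  obtain ⟨p, q, hp, hB, hB2⟩ := exists_Icc_compl_small hτ hM.ne
    (δ := min (d : ℝ≥0∞) (1 / 2)) (lt_min (by exact_mod_cast hd) (by simp))
  set B := Icc p q
  have hBm : MeasurableSet B := measurableSet_Icc
  have hBhalf : 1 / 2 ≤ τ B := by
    by_contra! h
    have h1 := ENNReal.add_lt_add h (hB.trans_le (min_le_right _ _))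
    rw [measure_add_measure_compl hBm, measure_univ, ENNReal.add_halves] at h1
    exact lt_irrefl _ h1
  have hB0 : τ B ≠ 0 := (lt_of_lt_of_le (by simp) hBhalf).ne'
  have hBinv : (τ B)⁻¹ ≤ 2 := by
    refine (ENNReal.inv_le_inv.2 hBhalf).trans (by simp)
  set χ := (τ B)⁻¹ • τ.restrict B with hχ
  have hχp : IsProbabilityMeasure χ := by
    refine ⟨?_⟩
    simp only [hχ, Measure.smul_apply, Measure.restrict_apply_univ, smul_eq_mul]
    exact ENNReal.inv_mul_cancel hB0 (measure_ne_top _ _)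
  have hχτ : χ ≪ volume.restrict (Ioi 0) :=
    (Measure.absolutelyContinuous_of_le Measure.restrict_le_self |>.trans hτ).smul_left _
  have hχM : ∫⁻ r, ENNReal.ofReal (r ^ 2) ∂χ ≤ 2 * M := by
    rw [hχ, lintegral_smul_measure, smul_eq_mul]
    exact mul_le_mul' hBinv (lintegral_mono' Measure.restrict_le_self le_rfl)
  have huniv : τ.restrict Bᶜ univ = τ Bᶜ := Measure.restrict_apply_univ _
  have h := hle (τ.restrict B) (τ.restrict Bᶜ) χ inferInstance inferInstance hχp hχτ
    (Measure.restrict_add_restrict_compl hBm).symm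
    (hχM.trans_lt (by finiteness)) (by
      rw [huniv]
      calc _ ≤ 2 * (d : ℝ≥0∞) + 2 * (d : ℝ≥0∞) * (2 * M) := by
            gcongr
            · exact (hB2.trans_le (min_le_left _ _)).le
            · exact (hB.trans_le (min_le_left _ _)).le
        _ = d * (2 + 4 * M) := by ring
        _ < ε := hdε)
  refine h.trans_lt ?_
  rw [huniv]
  have hfin : IsFiniteMeasure (τ Bᶜ • χ) := ⟨by
    rw [Measure.smul_apply, smul_eq_mul]; finiteness⟩
  refine radialEnergy_lt_top_of_Icc hn hA₀ e hp (q := q) ?_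
  have hrB : τ.restrict B Bᶜ = 0 := by simp [Measure.restrict_apply hBm.compl]
  change (τ.restrict B + τ Bᶜ • χ) Bᶜ = 0
  simp [hχ, hrB]

/-- The mixture (1 - η) τ + η χ is close to τ for small η even if χ is far from τ. Expanding its
quadratic energy, dividing by η and letting η → 0 gives the linear inequality. -/
theorem radialEnergy_le_of_isLocalEnergyMinimizer {n : ℕ} (hn : 2 ≤ n) [NeZero n] {A : ℝ → ℝ}
    (hA₀ : ContinuousOn A (Ici 0)) (hb : SubharmonicProfile n (pairProfile A)) (e : UnitSphere n)
    {τ : Measure ℝ} [IsProbabilityMeasure τ] (hτ : τ ≪ volume.restrict (Ioi 0))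
    (hmin : IsLocalEnergyMinimizer (newtonPotential A) (radialMeasure n τ))
    {χ : Measure ℝ} [IsProbabilityMeasure χ] (hχ : χ ≪ volume.restrict (Ioi 0)) {p q : ℝ}
    (hp : 0 < p) (hχpq : χ (Icc p q)ᶜ = 0) : radialEnergy A e τ τ ≤ radialEnergy A e χ τ := by
  have hL := radialEnergy_lt_top_of_isLocalEnergyMinimizer hn hA₀ hb e hτ hmin
  obtain ⟨ε, hε, hle⟩ := hmin.exists_radialEnergy_le hn hA₀ hb e hτ
  have hM : ∫⁻ r, ENNReal.ofReal (r ^ 2) ∂τ < ∞ := by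
    rw [← lintegral_hypDist_radialMeasure (n := n) hτ]; exact hmin.1.2
  have hM' : ∫⁻ r, ENNReal.ofReal (r ^ 2) ∂χ < ∞ := by
    have hae : ∀ᵐ r ∂χ, r ∈ Icc p q := mem_ae_iff.2 hχpq
    have : ∫⁻ r, ENNReal.ofReal (r ^ 2) ∂χ ≤ ∫⁻ _, ENNReal.ofReal (q ^ 2) ∂χ := by
      refine lintegral_mono_ae ?_
      filter_upwards [hae] with r hr
      exact ENNReal.ofReal_le_ofReal (pow_le_pow_left₀ (hp.le.trans hr.1) hr.2 2)
    refine this.trans_lt ?_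
    simp
  by_cases hj : radialEnergy A e χ τ = ∞
  · rw [hj]; exact le_top
  have hk := radialEnergy_lt_top_of_Icc hn hA₀ e hp hχpq
  set M := ∫⁻ r, ENNReal.ofReal (r ^ 2) ∂τ
  set M' := ∫⁻ r, ENNReal.ofReal (r ^ 2) ∂χ
  obtain ⟨d, hd, hdε⟩ := ENNReal.exists_nnreal_pos_mul_lt (a := 2 * M + 2 * M') (b := ε)
    (by finiteness) hε.ne'
  set L := (radialEnergy A e τ τ).toReal with hLdef
  set j := (radialEnergy A e χ τ).toReal with hjdef
  set k := (radialEnergy A e χ χ).toReal with hkdef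
  have key : ∀ η : ℝ, 0 < η → η < min d 1 → 2 * L ≤ η * L + 2 * (1 - η) * j + η * k := by
    intro η hη hη1
    have hη1' : η < 1 := hη1.trans_le (min_le_right _ _)
    have hηd : ENNReal.ofReal η ≤ d := by
      rw [← ENNReal.ofReal_coe_nnreal]
      exact ENNReal.ofReal_le_ofReal (hη1.trans_le (min_le_left _ _)).le
    have hsum : τ = ENNReal.ofReal (1 - η) • τ + ENNReal.ofReal η • τ := by
      rw [← add_smul, ← ENNReal.ofReal_add (by linarith) hη.le]
      simp
    have hf1 : IsFiniteMeasure (ENNReal.ofReal (1 - η) • τ) := ⟨by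
      rw [Measure.smul_apply, smul_eq_mul]; finiteness⟩
    have hf2 : IsFiniteMeasure (ENNReal.ofReal η • τ) := ⟨by
      rw [Measure.smul_apply, smul_eq_mul]; finiteness⟩
    have hu : (ENNReal.ofReal η • τ) univ = ENNReal.ofReal η := by simp
    have h := hle _ _ χ hf1 hf2 inferInstance hχ hsum hM' (by
      rw [hu, lintegral_smul_measure, smul_eq_mul]
      calc _ = ENNReal.ofReal η * (2 * M + 2 * M') := by ring
        _ ≤ d * (2 * M + 2 * M') := by gcongr
        _ < ε := hdε)
    have hf3 : IsFiniteMeasure (ENNReal.ofReal η • χ) := ⟨by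
      rw [Measure.smul_apply, smul_eq_mul]; finiteness⟩
    rw [hu, radialEnergy_add_left, radialEnergy_comm hA₀ e (ENNReal.ofReal (1 - η) • τ),
      radialEnergy_comm hA₀ e (ENNReal.ofReal η • χ)] at h
    simp only [radialEnergy_add_left, radialEnergy_smul_left, radialEnergy_smul_right hA₀] at h
    rw [radialEnergy_comm hA₀ e τ χ, ← ENNReal.ofReal_toReal hL.ne, ← ENNReal.ofReal_toReal hj,
      ← ENNReal.ofReal_toReal hk.ne, ← hLdef, ← hjdef, ← hkdef] at h
    have hL0 : 0 ≤ L := ENNReal.toReal_nonneg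
    have hj0 : 0 ≤ j := ENNReal.toReal_nonneg
    have hk0 : 0 ≤ k := ENNReal.toReal_nonneg
    have h1η : 0 ≤ 1 - η := by linarith
    have hη0 := hη.le
    simp only [← ENNReal.ofReal_mul h1η, ← ENNReal.ofReal_mul hη0] at h
    rw [← ENNReal.ofReal_add (by positivity) (by positivity),
      ← ENNReal.ofReal_add (by positivity) (by positivity)] at h
    simp only [← ENNReal.ofReal_mul h1η, ← ENNReal.ofReal_mul hη0] at h
    rw [← ENNReal.ofReal_add (by positivity) (by positivity),
      ENNReal.ofReal_le_ofReal_iff (by positivity)] at h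
    have : η * (2 * L) ≤ η * (η * L + 2 * (1 - η) * j + η * k) := by nlinarith
    exact le_of_mul_le_mul_left this hη
  have hlim : Tendsto (fun η : ℝ => η * L + 2 * (1 - η) * j + η * k) (𝓝[>] 0) (𝓝 (2 * j)) := by
    have : Continuous fun η : ℝ => η * L + 2 * (1 - η) * j + η * k := by fun_prop
    simpa using (this.tendsto 0).mono_left (nhdsWithin_le_nhds (s := Ioi 0))
  have hLj : 2 * L ≤ 2 * j := by
    refine ge_of_tendsto hlim ?_
    filter_upwards [Ioo_mem_nhdsGT (show (0 : ℝ) < min d 1 from lt_min (by exact_mod_cast hd) one_pos)]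
      with η hη using key η hη.1 hη.2
  exact (ENNReal.toReal_le_toReal hL.ne hj).1 (by linarith)

/-! ### The radial potential and the Euler–Lagrange conditions. -/

theorem sphereAvg_le_of_le {n : ℕ} [NeZero n] {b : ℝ → ℝ} (hb : Continuous b) (hbm : Monotone b)
    (e : UnitSphere n) {r s : ℝ} (hr : 0 ≤ r) (hs : 0 ≤ s) :
    sphereAvg b e r s ≤ b (Real.cosh (r + s)) := by
  have hi : Integrable (fun ξ : UnitSphere n => b (Real.cosh r * Real.cosh s -
      Real.sinh r * Real.sinh s * inner ℝ e.1 ξ.1)) (sphereMeasure n) :=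
    Continuous.integrable_of_compactSpace (hb.comp
      ((continuous_sphere_arg e).comp ((continuous_const (y := (r, s))).prodMk continuous_id)))
  refine (integral_mono hi (integrable_const _) fun ξ =>
    hbm (sphere_le_cosh_add e ξ hr hs)).trans_eq ?_
  simp

theorem le_sphereAvg_of_le {n : ℕ} [NeZero n] {b : ℝ → ℝ} (hb : Continuous b) (hbm : Monotone b)
    (e : UnitSphere n) {r s : ℝ} (hr : 0 ≤ r) (hs : 0 ≤ s) :
    b (Real.cosh (r - s)) ≤ sphereAvg b e r s := by
  have hi : Integrable (fun ξ : UnitSphere n => b (Real.cosh r * Real.cosh s -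
      Real.sinh r * Real.sinh s * inner ℝ e.1 ξ.1)) (sphereMeasure n) :=
    Continuous.integrable_of_compactSpace (hb.comp
      ((continuous_sphere_arg e).comp ((continuous_const (y := (r, s))).prodMk continuous_id)))
  refine le_trans (by simp) (integral_mono (integrable_const (b (Real.cosh (r - s)))) hi fun ξ =>
    hbm (cosh_sub_le_sphere e ξ hr hs))

/-- An integrable bound for the radial kernel, uniform for `r` in a compact interval. -/
theorem exists_integrable_bound_radialKernel {n : ℕ} (hn : 2 ≤ n) [NeZero n] {A : ℝ → ℝ}
    (hA₀ : ContinuousOn A (Ici 0)) (hb : SubharmonicProfile n (pairProfile A)) (e : UnitSphere n)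
    {τ : Measure ℝ} [IsFiniteMeasure τ] (hτ : τ ≪ volume.restrict (Ioi 0))
    (hL : radialEnergy A e τ τ < ∞) {p q : ℝ} (hp : 0 < p) :
    ∃ g : ℝ → ℝ, Integrable g τ ∧ ∀ r ∈ Icc p q, ∀ᵐ s ∂τ, ‖radialKernel A e r s‖ ≤ g s := by
  have hmeas : ∀ r, Measurable fun s => radialKernel A e r s := fun r =>
    (measurable_radialKernel hA₀ e).comp measurable_prodMk_left
  have hbm := hb.pairProfile_mono hn hA₀
  have hbc := continuous_pairProfile hA₀
  -- Finite energy makes the kernel at R integrable for τ-almost every R, so a suitable R beyond p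
  -- and q exists unless τ has no mass there. For s > R the sphere average increases in r ≤ R and is
  -- dominated by its value at R; for s ≤ R the kernel is bounded.
  obtain ⟨R, hqR, hpR, hR⟩ : ∃ R, q ≤ R ∧ p ≤ R ∧
      IntegrableOn (fun s => radialKernel A e R s) (Ioi R) τ := by
    rcases eq_or_ne (τ (Ioi (max p q))) 0 with h | h
    · refine ⟨max p q, le_max_right _ _, le_max_left _ _, ?_⟩
      rw [IntegrableOn, Measure.restrict_eq_zero.2 h]
      exact integrable_zero_measure
    · have hfin := ae_lt_top (measurable_lintegral_radialKernel hA₀ e τ) hL.ne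
      obtain ⟨R, hR1, hR2⟩ : ∃ R, R ∈ Ioi (max p q) ∧
          ∫⁻ s, ENNReal.ofReal (radialKernel A e R s) ∂τ < ∞ := by
        by_contra! hcon
        refine h (measure_mono_null (fun R hR => ?_) (ae_iff.1 hfin))
        exact not_lt.2 (hcon R hR)
      have hR1' : max p q < R := hR1
      refine ⟨R, (le_max_right _ _).trans hR1'.le, (le_max_left _ _).trans hR1'.le, ?_⟩
      have : Integrable (fun s => radialKernel A e R s) τ := by
        refine ⟨(hmeas R).aestronglyMeasurable, ?_⟩
        rw [hasFiniteIntegral_iff_ofReal (Eventually.of_forall fun s =>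
          radialKernel_nonneg hn hA₀ hb e (hp.le.trans ((le_max_left _ _).trans hR1'.le)) s)]
        exact hR2
      exact this.integrableOn
  have hR0 : 0 < R := hp.trans_le hpR
  refine ⟨fun s => (greenConst n * greenTail n p + pairProfile A (Real.cosh (R + R))) +
    (Ioi R).indicator (fun s => radialKernel A e R s) s,
    (integrable_const _).add (hR.integrable_indicator measurableSet_Ioi), fun r hr => ?_⟩
  have hr0 : 0 < r := hp.trans_le hr.1
  filter_upwards [ae_pos_of_absolutelyContinuous hτ] with s hs
  rw [Real.norm_of_nonneg (radialKernel_nonneg hn hA₀ hb e hr0.le s), radialKernel]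
  have h1 : greenConst n * greenTail n (max r s) ≤ greenConst n * greenTail n p :=
    mul_le_mul_of_nonneg_left ((greenTail_strictAntiOn hn).antitoneOn hp
      (mem_Ioi.2 (lt_max_of_lt_left hr0)) (le_max_of_le_left hr.1)) (greenConst_pos n).le
  by_cases hsR : s ≤ R
  · rw [indicator_of_notMem (by simpa using hsR), add_zero]
    refine add_le_add h1 ((sphereAvg_le_of_le hbc hbm e hr0.le hs.le).trans (hbm ?_))
    rw [Real.cosh_le_cosh, abs_of_pos (by linarith), abs_of_pos (by linarith)]
    linarith [hr.2]
  · push Not at hsR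
    rw [indicator_of_mem (mem_Ioi.2 hsR)]
    have h2 : sphereAvg (pairProfile A) e r s ≤ sphereAvg (pairProfile A) e R s := by
      rcases (hr.2.trans hqR).eq_or_lt with h | h
      · rw [h]
      · exact (hb.sphereAvg_strictMono e hr0.le h hsR).le
    have h3 := hb.pairProfile_nonneg hn hA₀ (Real.cosh (R + R))
    have h4 : 0 ≤ greenConst n * greenTail n (max R s) :=
      mul_nonneg (greenConst_pos n).le (greenTail_nonneg n (le_max_of_le_left hR0.le))
    rw [radialKernel]
    linarith

/-- The potential generated by a radial measure. -/
noncomputable def radialPotential {n : ℕ} (A : ℝ → ℝ) (e : UnitSphere n) (τ : Measure ℝ) (r : ℝ) :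
    ℝ := ∫ s, radialKernel A e r s ∂τ

theorem integrable_radialKernel {n : ℕ} (hn : 2 ≤ n) [NeZero n] {A : ℝ → ℝ}
    (hA₀ : ContinuousOn A (Ici 0)) (hb : SubharmonicProfile n (pairProfile A)) (e : UnitSphere n)
    {τ : Measure ℝ} [IsFiniteMeasure τ] (hτ : τ ≪ volume.restrict (Ioi 0))
    (hL : radialEnergy A e τ τ < ∞) {r : ℝ} (hr : 0 < r) :
    Integrable (fun s => radialKernel A e r s) τ := by
  obtain ⟨g, hg, hle⟩ := exists_integrable_bound_radialKernel hn hA₀ hb e hτ hL (q := r) hr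
  exact hg.mono' ((measurable_radialKernel hA₀ e).comp measurable_prodMk_left).aestronglyMeasurable
    (hle r (right_mem_Icc.2 le_rfl))

theorem continuousOn_radialPotential {n : ℕ} (hn : 2 ≤ n) [NeZero n] {A : ℝ → ℝ}
    (hA₀ : ContinuousOn A (Ici 0)) (hb : SubharmonicProfile n (pairProfile A)) (e : UnitSphere n)
    {τ : Measure ℝ} [IsFiniteMeasure τ] (hτ : τ ≪ volume.restrict (Ioi 0))
    (hL : radialEnergy A e τ τ < ∞) : ContinuousOn (radialPotential A e τ) (Ioi 0) := by
  intro r hr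
  have hr' : 0 < r := hr
  obtain ⟨g, hg, hle⟩ := exists_integrable_bound_radialKernel hn hA₀ hb e hτ hL (p := r / 2)
    (q := r + 1) (by linarith)
  refine ContinuousAt.continuousWithinAt (continuousAt_of_dominated (bound := g) ?_ ?_ hg ?_)
  · exact Eventually.of_forall fun x =>
      ((measurable_radialKernel hA₀ e).comp measurable_prodMk_left).aestronglyMeasurable
  · filter_upwards [Icc_mem_nhds (show r / 2 < r by linarith) (show r < r + 1 by linarith)]
      with x hx using hle x hx
  · refine Eventually.of_forall fun s => ?_
    have h : ContinuousAt (fun p : ℝ × ℝ => radialKernel A e p.1 p.2) (r, s) :=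
      (continuousOn_radialKernel hn hA₀ e).continuousAt
        ((isOpen_lt continuous_const continuous_fst).mem_nhds hr)
    exact ContinuousAt.comp (f := fun x : ℝ => (x, s)) h
      (continuousAt_id.prodMk continuousAt_const)

theorem lintegral_radialKernel_eq {n : ℕ} (hn : 2 ≤ n) [NeZero n] {A : ℝ → ℝ}
    (hA₀ : ContinuousOn A (Ici 0)) (hb : SubharmonicProfile n (pairProfile A)) (e : UnitSphere n)
    {τ : Measure ℝ} [IsFiniteMeasure τ] (hτ : τ ≪ volume.restrict (Ioi 0))
    (hL : radialEnergy A e τ τ < ∞) {r : ℝ} (hr : 0 < r) :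
    ∫⁻ s, ENNReal.ofReal (radialKernel A e r s) ∂τ = ENNReal.ofReal (radialPotential A e τ r) :=
  (ofReal_integral_eq_lintegral_ofReal (integrable_radialKernel hn hA₀ hb e hτ hL hr)
    (Eventually.of_forall fun s => radialKernel_nonneg hn hA₀ hb e hr.le s)).symm

/-- The Euler–Lagrange conditions for radial local minimizers. -/
theorem exists_radialPotential_eq_on_support {n : ℕ} (hn : 2 ≤ n) [NeZero n] {A : ℝ → ℝ}
    (hA₀ : ContinuousOn A (Ici 0)) (hb : SubharmonicProfile n (pairProfile A)) (e : UnitSphere n)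
    {τ : Measure ℝ} [IsProbabilityMeasure τ] (hτ : τ ≪ volume.restrict (Ioi 0))
    (hmin : IsLocalEnergyMinimizer (newtonPotential A) (radialMeasure n τ)) :
    ∃ L : ℝ, (∀ r, 0 < r → L ≤ radialPotential A e τ r) ∧
      ∀ r, 0 < r → r ∈ τ.support → radialPotential A e τ r = L := by
  have hL := radialEnergy_lt_top_of_isLocalEnergyMinimizer hn hA₀ hb e hτ hmin
  have hcont := continuousOn_radialPotential hn hA₀ hb e hτ hL
  have heq := fun r (hr : 0 < r) => lintegral_radialKernel_eq hn hA₀ hb e hτ hL hr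
  have hge : ∀ r, 0 < r → (radialEnergy A e τ τ).toReal ≤ radialPotential A e τ r := by
    intro r hr
    by_contra! hlt
    obtain ⟨L', h1, h2⟩ := exists_between hlt
    have hΛ0 : 0 ≤ radialPotential A e τ r :=
      integral_nonneg fun s => radialKernel_nonneg hn hA₀ hb e hr.le s
    have hev : ∀ᶠ x in 𝓝 r, 0 < x ∧ radialPotential A e τ x < L' :=
      Filter.Eventually.and (Ioi_mem_nhds hr)
        ((hcont.continuousAt (Ioi_mem_nhds hr)).eventually (gt_mem_nhds h1))
    obtain ⟨δ, hδ, hball⟩ := Metric.eventually_nhds_iff.1 hev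
    set p := r - δ / 2
    set q := r + δ / 2
    have hpq : p < q := by simp only [p, q]; linarith
    have hI : ∀ x ∈ Icc p q, 0 < x ∧ radialPotential A e τ x < L' := fun x hx => by
      refine hball ?_
      rw [Real.dist_eq, abs_lt]
      simp only [p, q] at hx
      constructor <;> linarith [hx.1, hx.2]
    have hp : 0 < p := (hI p (left_mem_Icc.2 hpq.le)).1
    -- The uniform law near a point where the potential falls below the energy level violates the
    -- first variation inequality.
    set χ : Measure ℝ := (volume (Icc p q))⁻¹ • volume.restrict (Icc p q) with hχ
    have hv0 : volume (Icc p q) ≠ 0 := by simpa using hpq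
    have hv1 : volume (Icc p q) ≠ ∞ := by simp
    have hχp : IsProbabilityMeasure χ := by
      refine ⟨?_⟩
      simp only [hχ, Measure.smul_apply, Measure.restrict_apply_univ, smul_eq_mul]
      exact ENNReal.inv_mul_cancel hv0 hv1
    have hχc : χ (Icc p q)ᶜ = 0 := by
      simp [hχ, Measure.restrict_apply measurableSet_Icc.compl]
    have hχa : χ ≪ volume.restrict (Ioi 0) :=
      (Measure.absolutelyContinuous_of_le (Measure.restrict_mono_set _
        fun x hx => (hI x hx).1)).smul_left _
    have h3 := radialEnergy_le_of_isLocalEnergyMinimizer hn hA₀ hb e hτ hmin hχa hp hχc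
    have h4 : radialEnergy A e χ τ ≤ ENNReal.ofReal L' := by
      have hae : ∀ᵐ x ∂χ, x ∈ Icc p q := mem_ae_iff.2 hχc
      have : radialEnergy A e χ τ ≤ ∫⁻ _, ENNReal.ofReal L' ∂χ := by
        refine lintegral_mono_ae ?_
        filter_upwards [hae] with x hx
        rw [heq x (hI x hx).1]
        exact ENNReal.ofReal_le_ofReal (hI x hx).2.le
      simpa using this
    have h5 := h3.trans h4
    rw [← ENNReal.ofReal_toReal hL.ne, ENNReal.ofReal_le_ofReal_iff (by linarith)] at h5
    linarith
  refine ⟨(radialEnergy A e τ τ).toReal, hge, fun r hr hrs => ?_⟩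
  have hpos := ae_pos_of_absolutelyContinuous hτ
  -- The τ-average of the potential is the energy, which is also its lower bound, so equality holds
  -- almost everywhere. Continuity extends it to the whole support.
  have hae : ∀ᵐ r ∂τ, radialPotential A e τ r = (radialEnergy A e τ τ).toReal := by
    have h := ae_eq_of_ae_le_of_lintegral_le (μ := τ)
      (f := fun _ => ENNReal.ofReal (radialEnergy A e τ τ).toReal)
      (g := fun r => ∫⁻ s, ENNReal.ofReal (radialKernel A e r s) ∂τ) ?_ (by simp)
      (measurable_lintegral_radialKernel hA₀ e τ).aemeasurable ?_
    · filter_upwards [h, hpos] with r h1 h2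
      rw [heq r h2, ENNReal.ofReal_eq_ofReal_iff ENNReal.toReal_nonneg] at h1
      · exact h1.symm
      · exact integral_nonneg fun s => radialKernel_nonneg hn hA₀ hb e h2.le s
    · filter_upwards [hpos] with r h2
      rw [heq r h2]
      exact ENNReal.ofReal_le_ofReal (hge r h2)
    · rw [ENNReal.ofReal_toReal hL.ne, lintegral_const, measure_univ, mul_one]
      rfl
  by_contra hne
  have hU : {x | radialPotential A e τ x ≠ (radialEnergy A e τ τ).toReal} ∈ 𝓝 r :=
    (hcont.continuousAt (Ioi_mem_nhds hr)).eventually (isOpen_ne.mem_nhds hne)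
  exact (Measure.mem_support_iff_forall r |>.1 hrs _ hU).ne' (ae_iff.1 hae)

/-! ### The radial support has no gaps. -/

theorem integral_lt_integral_of_ae_lt {X : Type*} [MeasurableSpace X] {ω : Measure X} [NeZero ω]
    {f g : X → ℝ} (hf : Integrable f ω) (hg : Integrable g ω) (h : ∀ᵐ x ∂ω, f x < g x) :
    ∫ x, f x ∂ω < ∫ x, g x ∂ω := by
  refine lt_of_le_of_ne (integral_mono_ae hf hg (h.mono fun x hx => hx.le)) fun heq => ?_
  have h2 := (integral_eq_iff_of_ae_le hf hg (h.mono fun x hx => hx.le)).1 heq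
  obtain ⟨x, hx1, hx2⟩ := (h.and h2).exists
  exact hx1.ne hx2

theorem ae_mem_support (τ : Measure ℝ) : ∀ᵐ s ∂τ, s ∈ τ.support :=
  Measure.support_mem_ae

/-- Around a missing r lies a maximal gap of the support. There the potential is strictly convex in
T or, if no support lies in (0, r], strictly increasing. As it equals L at the ends in the support,
it drops below L at r. -/
theorem mem_support_of_lt {n : ℕ} (hn : 2 ≤ n) [NeZero n] {A : ℝ → ℝ}
    (hA₀ : ContinuousOn A (Ici 0)) (hb : SubharmonicProfile n (pairProfile A)) (e : UnitSphere n)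
    {τ : Measure ℝ} [IsProbabilityMeasure τ] (hτ : τ ≪ volume.restrict (Ioi 0))
    (hE : radialEnergy A e τ τ < ∞) {L : ℝ} (hge : ∀ r, 0 < r → L ≤ radialPotential A e τ r)
    (heq : ∀ r, 0 < r → r ∈ τ.support → radialPotential A e τ r = L)
    {r b : ℝ} (hr : 0 < r) (hrb : r < b) (hbs : b ∈ τ.support) : r ∈ τ.support := by
  by_contra hrs
  have hint := fun r (hr : 0 < r) => integrable_radialKernel hn hA₀ hb e hτ hE hr
  have hclosed : IsClosed τ.support := Measure.isClosed_support
  set b' := sInf (τ.support ∩ Ici r) with hb'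
  have hne : (τ.support ∩ Ici r).Nonempty := ⟨b, hbs, hrb.le⟩
  have hbdd : BddBelow (τ.support ∩ Ici r) := ⟨r, fun x hx => hx.2⟩
  have hb'mem : b' ∈ τ.support ∩ Ici r := (hclosed.inter isClosed_Ici).csInf_mem hne hbdd
  have hrb' : r < b' := lt_of_le_of_ne hb'mem.2 fun h => hrs (h ▸ hb'mem.1)
  have habove : ∀ s ∈ τ.support, r ≤ s → b' ≤ s := fun s hs hrs => csInf_le hbdd ⟨hs, hrs⟩
  have hLb := heq b' (hr.trans hrb') hb'mem.1
  by_cases hlow : ∃ a ∈ τ.support, 0 < a ∧ a ≤ r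
  · obtain ⟨a₀, ha₀, ha₀0, ha₀r⟩ := hlow
    set a := sSup (τ.support ∩ Iic r) with ha
    have hne' : (τ.support ∩ Iic r).Nonempty := ⟨a₀, ha₀, ha₀r⟩
    have hbdd' : BddAbove (τ.support ∩ Iic r) := ⟨r, fun x hx => hx.2⟩
    have hamem : a ∈ τ.support ∩ Iic r := (hclosed.inter isClosed_Iic).csSup_mem hne' hbdd'
    have har : a < r := lt_of_le_of_ne hamem.2 fun h => hrs (h ▸ hamem.1)
    have ha0 : 0 < a := ha₀0.trans_le (le_csSup hbdd' ⟨ha₀, ha₀r⟩)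
    have hLa := heq a ha0 hamem.1
    have hTab : greenTail n b' < greenTail n a :=
      greenTail_strictAntiOn hn ha0 (hr.trans hrb') (har.trans hrb')
    set w := (greenTail n a - greenTail n r) / (greenTail n a - greenTail n b') with hw
    have hwT : greenTail n r = (1 - w) * greenTail n a + w * greenTail n b' := by
      have : w * (greenTail n a - greenTail n b') = greenTail n a - greenTail n r :=
        div_mul_cancel₀ _ (by linarith)
      linarith
    have hlt : ∀ᵐ s ∂τ, radialKernel A e r s <
        (1 - w) * radialKernel A e a s + w * radialKernel A e b' s := by
      filter_upwards [ae_mem_support τ, ae_pos_of_absolutelyContinuous hτ] with s hs hs0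
      have hside : s ≤ a ∨ b' ≤ s := by
        rcases le_total s r with h | h
        · exact Or.inl (le_csSup hbdd' ⟨hs, h⟩)
        · exact Or.inr (habove s hs h)
      have h1 := hb.sphereAvg_strictConvex hn (continuous_pairProfile hA₀) e ha0 har hrb' hs0.le
        hside hwT
      -- With no s inside the gap, T(max · s) is there either T itself or constant, hence affine in
      -- T.
      have h2 : greenTail n (max r s) =
          (1 - w) * greenTail n (max a s) + w * greenTail n (max b' s) := by
        rcases hside with h | h
        · rw [max_eq_left (h.trans har.le), max_eq_left h, max_eq_left (h.trans (har.trans hrb').le)]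
          exact hwT
        · rw [max_eq_right (hrb'.le.trans h), max_eq_right h,
            max_eq_right ((har.trans hrb').le.trans h)]
          ring
      unfold radialKernel
      rw [h2]
      linarith
    have h := (integral_lt_integral_of_ae_lt (hint r hr)
      (((hint a ha0).const_mul (1 - w)).add ((hint b' (hr.trans hrb')).const_mul w)) hlt).trans_eq
      (integral_add ((hint a ha0).const_mul (1 - w)) ((hint b' (hr.trans hrb')).const_mul w))
    rw [integral_const_mul, integral_const_mul] at h
    have h3 : radialPotential A e τ r <
      (1 - w) * radialPotential A e τ a + w * radialPotential A e τ b' := h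
    rw [hLa, hLb] at h3
    linarith [hge r hr]
  · push Not at hlow
    -- All mass lies beyond b', so the Green part is constant on (0, b'] and only the increasing
    -- average of b remains.
    have hlt : ∀ᵐ s ∂τ, radialKernel A e r s < radialKernel A e b' s := by
      filter_upwards [ae_mem_support τ, ae_pos_of_absolutelyContinuous hτ,
        ae_ne_of_absolutelyContinuous hτ b'] with s hs hs0 hsb
      have h1 : b' < s := lt_of_le_of_ne (habove s hs (hlow s hs hs0).le) hsb
      unfold radialKernel
      rw [max_eq_right h1.le, max_eq_right (hrb'.trans h1).le]
      linarith [hb.sphereAvg_strictMono e hr.le hrb' h1]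
    have h : radialPotential A e τ r < radialPotential A e τ b' :=
      integral_lt_integral_of_ae_lt (hint r hr) (hint b' (hr.trans hrb')) hlt
    linarith [hge r hr]

/-! ### The radial support is bounded. -/

theorem tendsto_toReal_measure_Iic {τ : Measure ℝ} [IsProbabilityMeasure τ] :
    Tendsto (fun s => (τ (Iic s)).toReal) atTop (𝓝 1) := by
  have h := tendsto_measure_Iic_atTop τ
  rw [measure_univ] at h
  have h2 := (ENNReal.tendsto_toReal ENNReal.one_ne_top).comp h
  rw [ENNReal.toReal_one] at h2
  exact h2

/-- `L - (A - A(0))` is strictly concave as a function of `greenTail`. -/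
theorem SubharmonicProfile.concave {n : ℕ} (hn : 2 ≤ n) [NeZero n] {A : ℝ → ℝ}
    (hA₀ : ContinuousOn A (Ici 0)) (hb : SubharmonicProfile n (pairProfile A)) (L : ℝ)
    {r₁ r₂ r₃ : ℝ} (h1 : 0 < r₁) (h12 : r₁ < r₂) (h23 : r₂ < r₃) :
    (greenTail n r₂ - greenTail n r₃) * (L - pairProfile A (Real.cosh r₁)) +
      (greenTail n r₁ - greenTail n r₂) * (L - pairProfile A (Real.cosh r₃)) <
      (greenTail n r₁ - greenTail n r₃) * (L - pairProfile A (Real.cosh r₂)) := by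
  have e : UnitSphere n := Classical.arbitrary _
  have hT13 : greenTail n r₃ < greenTail n r₁ :=
    greenTail_strictAntiOn hn h1 (h1.trans (h12.trans h23)) (h12.trans h23)
  set w := (greenTail n r₁ - greenTail n r₂) / (greenTail n r₁ - greenTail n r₃) with hw
  have hwm : w * (greenTail n r₁ - greenTail n r₃) = greenTail n r₁ - greenTail n r₂ :=
    div_mul_cancel₀ _ (by linarith)
  -- At s = 0 the sphere degenerates to the vertex and the average is b(cosh r).
  have h := hb.sphereAvg_strictConvex hn (continuous_pairProfile hA₀) e h1 h12 h23 le_rfl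
    (Or.inl h1.le) (w := w) (by linarith)
  simp only [sphereAvg_zero] at h
  have h' := mul_lt_mul_of_pos_left h (sub_pos.2 hT13)
  have e1 : (greenTail n r₁ - greenTail n r₃) * ((1 - w) * pairProfile A (Real.cosh r₁) +
      w * pairProfile A (Real.cosh r₃)) =
      (greenTail n r₂ - greenTail n r₃) * pairProfile A (Real.cosh r₁) +
      (greenTail n r₁ - greenTail n r₂) * pairProfile A (Real.cosh r₃) := by
    have e2 : (greenTail n r₁ - greenTail n r₃) * (1 - w) = greenTail n r₂ - greenTail n r₃ := by
      linarith
    linear_combination pairProfile A (Real.cosh r₁) * e2 + pairProfile A (Real.cosh r₃) * hwm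
  rw [e1] at h'
  linarith

/-- If `A - A(0) ≤ L`, then `(L - (A - A(0))) / greenTail` is strictly increasing. -/
theorem SubharmonicProfile.ratio_lt {n : ℕ} (hn : 2 ≤ n) [NeZero n] {A : ℝ → ℝ}
    (hA₀ : ContinuousOn A (Ici 0)) (hb : SubharmonicProfile n (pairProfile A)) {L : ℝ}
    (hL : ∀ C, pairProfile A C ≤ L) {r₁ r₂ : ℝ} (h1 : 0 < r₁) (h12 : r₁ < r₂) :
    (L - pairProfile A (Real.cosh r₁)) * greenTail n r₂ <
      (L - pairProfile A (Real.cosh r₂)) * greenTail n r₁ := by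
  set h : ℝ → ℝ := fun r => L - pairProfile A (Real.cosh r) with hh
  have hT := fun r (hr : 0 < r) => greenTail_pos hn hr
  -- Send the third point of the concavity inequality to infinity, where T → 0 and h ≥ 0.
  have hle : ∀ r, r₁ < r → h r₁ * greenTail n r ≤ h r * greenTail n r₁ := by
    intro r hr
    have hlim : Tendsto (fun r₃ => (greenTail n r₁ - greenTail n r₃) * h r -
        (greenTail n r - greenTail n r₃) * h r₁) atTop
        (𝓝 ((greenTail n r₁ - 0) * h r - (greenTail n r - 0) * h r₁)) :=
      (((tendsto_greenTail_atTop hn).const_sub _).mul_const _).sub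
        (((tendsto_greenTail_atTop hn).const_sub _).mul_const _)
    have := ge_of_tendsto (b := 0) hlim (by
      filter_upwards [eventually_gt_atTop r] with r₃ h3
      have hc := hb.concave hn hA₀ L h1 hr h3
      have hp : 0 ≤ (greenTail n r₁ - greenTail n r) * (L - pairProfile A (Real.cosh r₃)) :=
        mul_nonneg (sub_nonneg.2 (greenTail_strictAntiOn hn h1 (h1.trans hr) hr).le)
          (sub_nonneg.2 (hL _))
      simp only [hh]
      linarith)
    linarith
  have h2 : 0 < r₂ := h1.trans h12
  -- The limit loses strictness; a finite third point restores it.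
  set r₃ := r₂ + 1
  have h23 : r₂ < r₃ := by simp [r₃]
  have hc := hb.concave hn hA₀ L h1 h12 h23
  have h3 := hle r₃ (h12.trans h23)
  have hT12 : 0 ≤ greenTail n r₁ - greenTail n r₂ :=
    sub_nonneg.2 (greenTail_strictAntiOn hn h1 h2 h12).le
  have hT13 : 0 < greenTail n r₁ - greenTail n r₃ :=
    sub_pos.2 (greenTail_strictAntiOn hn h1 (h2.trans h23) (h12.trans h23))
  have hT1 := hT r₁ h1
  change (greenTail n r₂ - greenTail n r₃) * h r₁ + (greenTail n r₁ - greenTail n r₂) * h r₃ <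
    (greenTail n r₁ - greenTail n r₃) * h r₂ at hc
  have h4 := mul_lt_mul_of_pos_left hc hT1
  have h5 := mul_le_mul_of_nonneg_left h3 hT12
  have h6 : (greenTail n r₁ - greenTail n r₃) * (h r₁ * greenTail n r₂) <
      (greenTail n r₁ - greenTail n r₃) * (h r₂ * greenTail n r₁) := by nlinarith
  exact lt_of_mul_lt_mul_left h6 hT13.le

/-- A radial measure of full support cannot have a constant potential. -/
theorem not_forall_radialPotential_eq {n : ℕ} (hn : 2 ≤ n) [NeZero n] {A : ℝ → ℝ}
    (hA₀ : ContinuousOn A (Ici 0)) (hb : SubharmonicProfile n (pairProfile A)) (e : UnitSphere n)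
    {τ : Measure ℝ} [IsProbabilityMeasure τ] (hτ : τ ≪ volume.restrict (Ioi 0))
    (hE : radialEnergy A e τ τ < ∞) (L : ℝ) : ¬ ∀ r, 0 < r → radialPotential A e τ r = L := by
  intro hL
  have hint := fun r (hr : 0 < r) => integrable_radialKernel hn hA₀ hb e hτ hE hr
  have hbc := continuous_pairProfile hA₀
  have hbm := hb.pairProfile_mono hn hA₀
  have hbn := hb.pairProfile_nonneg hn hA₀
  have hκ := greenConst_pos n
  have hpos := ae_pos_of_absolutelyContinuous hτ
  have hTlim := tendsto_greenTail_atTop hn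
  have hle : ∀ C, pairProfile A C ≤ L := by
    intro C
    -- For r far beyond s₀, every point at distance at most s₀ from the vertex is so far from the
    -- sphere of radius r that b is at least b(C) there. The potential at r is L, and s₀ → ∞ then
    -- gives b(C) ≤ L.
    have hs : ∀ s₀, pairProfile A C * (τ (Iic s₀)).toReal ≤ L := by
      intro s₀
      set q := Real.arcosh (max C 1)
      have hq : 0 ≤ q := Real.arcosh_nonneg (le_max_right _ _)
      have hCq : C ≤ Real.cosh q := by
        rw [Real.cosh_arcosh (le_max_right _ _)]; exact le_max_left _ _
      set r := max s₀ 0 + q + 1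
      have hr : 0 < r := by have := le_max_right s₀ 0; positivity
      rw [← hL r hr]
      have : ∫ s, (Iic s₀).indicator (fun _ => pairProfile A C) s ∂τ ≤ radialPotential A e τ r := by
        refine integral_mono_ae ((integrable_const _).indicator measurableSet_Iic) (hint r hr) ?_
        filter_upwards [hpos] with s hs0
        by_cases hss : s ∈ Iic s₀
        · rw [indicator_of_mem hss]
          have h1 := le_sphereAvg_of_le hbc hbm e hr.le hs0.le
          have h2 : pairProfile A C ≤ pairProfile A (Real.cosh (r - s)) := by
            refine hbm (hCq.trans ?_)
            have hs1 : s ≤ s₀ := hss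
            have hs2 := le_max_left s₀ 0
            have hs3 : q ≤ r - s := by simp only [r]; linarith
            rw [Real.cosh_le_cosh, abs_of_nonneg hq, abs_of_nonneg (hq.trans hs3)]
            exact hs3
          have h3 := mul_nonneg hκ.le (greenTail_nonneg n (le_max_of_le_left hr.le : 0 ≤ max r s))
          unfold radialKernel
          linarith
        · rw [indicator_of_notMem hss]
          exact radialKernel_nonneg hn hA₀ hb e hr.le s
      rw [integral_indicator measurableSet_Iic, setIntegral_const, smul_eq_mul, mul_comm] at this
      exact this
    have hlim := tendsto_toReal_measure_Iic (τ := τ) |>.const_mul (pairProfile A C)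
    rw [mul_one] at hlim
    exact le_of_tendsto hlim (Eventually.of_forall hs)
  have havg : ∀ r s, 0 ≤ r → 0 ≤ s → sphereAvg (pairProfile A) e r s ≤ L := fun r s hr hs =>
    (sphereAvg_le_of_le hbc hbm e hr hs).trans (hle _)
  by_cases hcase : ∃ r₀, 0 < r₀ ∧ greenConst n * greenTail n r₀ < L - pairProfile A (Real.cosh r₀)
  · obtain ⟨r₀, hr₀, hlt⟩ := hcase
    have hT₀ := greenTail_pos hn hr₀
    set c := (L - pairProfile A (Real.cosh r₀)) / greenTail n r₀ with hc
    have hcT : c * greenTail n r₀ = L - pairProfile A (Real.cosh r₀) := div_mul_cancel₀ _ hT₀.ne'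
    have hcκ : greenConst n < c := (lt_div_iff₀ hT₀).2 hlt
    have hc0 : 0 < c := hκ.trans hcκ
    -- Monotonicity of h/T propagates h ≥ c T from r₀ to all larger radii.
    have hq : ∀ q, r₀ ≤ q → pairProfile A (Real.cosh q) ≤ L - c * greenTail n q := by
      intro q hq
      rcases hq.eq_or_lt with rfl | h
      · linarith
      · have := hb.ratio_lt hn hA₀ hle hr₀ h
        rw [← hcT] at this
        have h2 : c * greenTail n q < L - pairProfile A (Real.cosh q) :=
          lt_of_mul_lt_mul_right (by linarith) hT₀.le
        linarith
    -- Points of the two spheres are at least r - s ≥ r₀ apart, so the pointwise bound applies;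
    -- Newton's theorem averages its Green term to T(r).
    have hin : ∀ r s, 0 < s → s ≤ r - r₀ →
        sphereAvg (pairProfile A) e r s ≤ L - c * greenTail n r := by
      intro r s hs hsr
      have hr : 0 ≤ r := by linarith
      have hrs : r ≠ s := by linarith
      have hN := sphereAvg_greenCosh hn hb e hr hs.le hrs
      rw [max_eq_left (by linarith)] at hN
      rw [← hN]
      have i1 := (integrable_sphere (continuousOn_greenCosh hn) e hr hs.le hrs).const_mul c
      have i2 := integrable_sphere hb.continuousOn e hr hs.le hrs
      have h := integral_mono i2 ((integrable_const L).sub i1) fun ξ => ?_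
      · refine h.trans_eq ?_
        refine (integral_sub (integrable_const L) i1).trans ?_
        rw [integral_const_mul]
        simp [sphereAvg]
      · set D := Real.cosh r * Real.cosh s - Real.sinh r * Real.sinh s * inner ℝ e.1 ξ.1
        have hD1 : 1 ≤ D := (one_lt_sphere e ξ hr hs.le hrs).le
        have hDr : r₀ ≤ Real.arcosh D := by
          rw [← Real.arcosh_cosh hr₀.le, Real.arcosh_le_arcosh (Real.cosh_pos _) (by linarith)]
          refine le_trans ?_ (cosh_sub_le_sphere e ξ hr hs.le)
          rw [Real.cosh_le_cosh, abs_of_pos hr₀, abs_of_pos (by linarith)]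
          linarith
        have := hq _ hDr
        rw [Real.cosh_arcosh hD1] at this
        exact this
    -- Only mass inside r - r₀ gains -c T(r), while all mass contributes at most κ T(r) + L. Since
    -- the total is exactly L, T(r) cancels.
    have hmass : ∀ r, 0 < r → c * (τ (Iic (r - r₀))).toReal ≤ greenConst n := by
      intro r hr
      have hTr := greenTail_pos hn hr
      have hup : radialPotential A e τ r ≤ ∫ s, ((greenConst n * greenTail n r + L) -
          (Iic (r - r₀)).indicator (fun _ => c * greenTail n r) s) ∂τ := by
        refine integral_mono_ae (hint r hr) ((integrable_const _).sub
          ((integrable_const _).indicator measurableSet_Iic)) ?_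
        filter_upwards [hpos] with s hs
        have h1 : greenConst n * greenTail n (max r s) ≤ greenConst n * greenTail n r :=
          mul_le_mul_of_nonneg_left ((greenTail_strictAntiOn hn).antitoneOn hr
            (mem_Ioi.2 (lt_max_of_lt_left hr)) (le_max_left _ _)) hκ.le
        unfold radialKernel
        by_cases hss : s ∈ Iic (r - r₀)
        · rw [indicator_of_mem hss]
          linarith [hin r s hs hss]
        · rw [indicator_of_notMem hss]
          linarith [havg r s hr.le hs.le]
      rw [hL r hr, integral_sub (integrable_const _)
        ((integrable_const _).indicator measurableSet_Iic), integral_indicator measurableSet_Iic,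
        setIntegral_const, integral_const, probReal_univ, one_smul, smul_eq_mul] at hup
      change L ≤ greenConst n * greenTail n r + L -
        (τ (Iic (r - r₀))).toReal * (c * greenTail n r) at hup
      refine le_of_mul_le_mul_right ?_ hTr
      linarith
    have hlim : Tendsto (fun r => c * (τ (Iic (r - r₀))).toReal) atTop (𝓝 (c * 1)) :=
      ((tendsto_toReal_measure_Iic (τ := τ)).comp
        (tendsto_atTop_add_const_right _ (-r₀) tendsto_id)).const_mul c
    have := le_of_tendsto hlim ((eventually_gt_atTop 0).mono hmass)
    linarith
  · push Not at hcase
    -- The bound h/T ≤ κ at q + 1 becomes strict at q because h/T is strictly increasing.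
    have hstrict : ∀ q, 0 < q → L - pairProfile A (Real.cosh q) < greenConst n * greenTail n q := by
      intro q hq
      have h1 := hb.ratio_lt hn hA₀ hle hq (lt_add_one q)
      have hT := greenTail_pos hn (show 0 < q + 1 by linarith)
      have h2 := mul_le_mul_of_nonneg_right (hcase (q + 1) (by linarith)) (greenTail_pos hn hq).le
      refine lt_of_mul_lt_mul_right (lt_of_lt_of_le h1 (h2.trans_eq ?_)) hT.le
      ring
    have hlt : ∀ᵐ s ∂τ, L < radialKernel A e 1 s := by
      filter_upwards [hpos, ae_ne_of_absolutelyContinuous hτ 1] with s hs hne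
      have i1 := (integrable_sphere (continuousOn_greenCosh hn) e zero_le_one hs.le
        hne).const_mul (greenConst n)
      have i2 := integrable_sphere hb.continuousOn e zero_le_one hs.le hne
      have h := integral_lt_integral_of_forall_lt (integrable_const L) (i1.add i2) fun ξ => ?_
      · rw [integral_const, probReal_univ, one_smul] at h
        refine h.trans_eq ((integral_add i1 i2).trans ?_)
        rw [integral_const_mul]
        change greenConst n * sphereAvg (greenCosh n) e 1 s + _ = _
        rw [sphereAvg_greenCosh hn hb e zero_le_one hs.le hne]
        rfl
      · set D := Real.cosh 1 * Real.cosh s - Real.sinh 1 * Real.sinh s * inner ℝ e.1 ξ.1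
        have hD1 : 1 < D := one_lt_sphere e ξ zero_le_one hs.le hne
        have := hstrict _ (Real.arcosh_pos hD1)
        rw [Real.cosh_arcosh hD1.le] at this
        change L < greenConst n * greenTail n (Real.arcosh D) + pairProfile A D
        linarith
    have h := integral_lt_integral_of_ae_lt (integrable_const L) (hint 1 one_pos) hlt
    rw [integral_const, probReal_univ, one_smul] at h
    exact h.ne (hL 1 one_pos).symm

/-! ### From the radial support to the support in hyperbolic space. -/

theorem map_hypDist_radialMeasure {n : ℕ} [NeZero n] {τ : Measure ℝ} [SFinite τ]
    (hτ : τ ≪ volume.restrict (Ioi 0)) : (radialMeasure n τ).map (hypDist (vertex n)) = τ := by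
  have h : ∀ᵐ p ∂((sphereMeasure n).prod τ), hypDist (vertex n) (polar p) = p.2 := by
    have h2 := Measure.quasiMeasurePreserving_snd (μ := sphereMeasure n) (ν := τ) |>.ae
      (ae_pos_of_absolutelyContinuous hτ)
    filter_upwards [h2] with p hp using hypDist_vertex_polar p.1 (le_of_lt hp)
  rw [radialMeasure, Measure.map_map measurable_hypDist_vertex continuous_polar.measurable]
  refine (Measure.map_congr h).trans ?_
  rw [Measure.map_snd_prod, measure_univ, one_smul]

/-- Polar coordinates are continuous and the sphere measure charges every nonempty open set, so a
neighbourhood of a point has positive mass whenever τ charges the nearby radii. The vertex is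
included, since any direction represents it. -/
theorem support_radialMeasure {n : ℕ} [NeZero n] {τ : Measure ℝ} [SFinite τ]
    (hτ : τ ≪ volume.restrict (Ioi 0)) :
    (radialMeasure n τ).support = {x | hypDist (vertex n) x ∈ τ.support} := by
  ext x
  simp only [Measure.mem_support_iff_forall, mem_ofPred_eq]
  have hc : Continuous (hypDist (vertex n)) :=
    continuous_hypDist.comp (continuous_const.prodMk continuous_id)
  constructor
  · intro h U hU
    obtain ⟨V, hVU, hV, hxV⟩ := mem_nhds_iff.1 hU
    have := h (hypDist (vertex n) ⁻¹' V) ((hV.preimage hc).mem_nhds hxV)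
    rw [← Measure.map_apply measurable_hypDist_vertex hV.measurableSet,
      map_hypDist_radialMeasure hτ] at this
    exact this.trans_le (measure_mono hVU)
  · intro h U hU
    obtain ⟨ξ, hξ⟩ := exists_polar_eq x
    rw [← hξ] at hU
    have hpre := continuous_polar.continuousAt.preimage_mem_nhds hU
    obtain ⟨V, hV, I, hI, hVI⟩ := mem_nhds_prod_iff.1 hpre
    have hV0 : 0 < sphereMeasure n V := by
      rw [sphereMeasure, Measure.smul_apply, smul_eq_mul]
      exact ENNReal.mul_pos (ENNReal.inv_ne_zero.2 (measure_ne_top _ _))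
        (Measure.measure_pos_of_mem_nhds _ hV).ne'
    calc 0 < sphereMeasure n V * τ I := ENNReal.mul_pos hV0.ne' (h I hI).ne'
      _ = (sphereMeasure n).prod τ (V ×ˢ I) := (Measure.prod_prod _ _).symm
      _ ≤ (sphereMeasure n).prod τ (polar ⁻¹' U) := measure_mono hVI
      _ ≤ radialMeasure n τ U := Measure.le_map_apply continuous_polar.aemeasurable _

theorem mainTheorem5 (n : ℕ) (hn : 2 ≤ n) (A : ℝ → ℝ)
    (hA₀ : ContinuousOn A (Ici 0)) (hA₂ : ContDiffOn ℝ 2 A (Ioi 0))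
    (hA : ∀ x y : HypSpace n, x ≠ y → 0 < laplaceBeltrami (fun z => A (hypDist z y)) x)
    (ρ : HypSpace n → ℝ) (hρm : AEMeasurable ρ (hypVolume n))
    (hρ₀ : ∀ᵐ x ∂(hypVolume n), 0 ≤ ρ x)
    (hρb : ∃ M : ℝ, ∀ᵐ x ∂(hypVolume n), ρ x ≤ M)
    (hρr : IsRadial ρ)
    (hmin : IsLocalEnergyMinimizer (newtonPotential A) (densityMeasure ρ)) :
    ∃ R : ℝ, 0 < R ∧
      (densityMeasure ρ).support = {x : HypSpace n | hypDist (vertex n) x ≤ R} := by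
  have : NeZero n := ⟨by omega⟩
  obtain ⟨τ, hsf, hτ, hρτ⟩ := exists_densityMeasure_eq_radialMeasure hρm hρr
  rw [hρτ] at hmin ⊢
  have hτp : IsProbabilityMeasure τ := ⟨by
    rw [← radialMeasure_univ (n := n) τ]; exact hmin.1.1.measure_univ⟩
  have hb := subharmonicProfile_pairProfile hn hA₂ hA
  have e : UnitSphere n := Classical.arbitrary _
  have hE := radialEnergy_lt_top_of_isLocalEnergyMinimizer hn hA₀ hb e hτ hmin
  obtain ⟨L, hge, heq⟩ := exists_radialPotential_eq_on_support hn hA₀ hb e hτ hmin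
  have hdown : ∀ r b, 0 < r → r < b → b ∈ τ.support → r ∈ τ.support := fun r b hr hrb hbs =>
    mem_support_of_lt hn hA₀ hb e hτ hE hge heq hr hrb hbs
  have hbdd : BddAbove τ.support := by
    by_contra hunb
    -- An unbounded, downward closed support contains every r > 0, making the potential constant.
    refine not_forall_radialPotential_eq hn hA₀ hb e hτ hE L fun r hr => heq r hr ?_
    obtain ⟨b, hbs, hrb⟩ := not_bddAbove_iff.1 hunb r
    exact hdown r b hr hrb hbs
  obtain ⟨b, hb0, hbs⟩ := ((ae_pos_of_absolutelyContinuous hτ).and (ae_mem_support τ)).exists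
  have hclosed : IsClosed τ.support := Measure.isClosed_support
  have hRs : sSup τ.support ∈ τ.support := hclosed.csSup_mem ⟨b, hbs⟩ hbdd
  have hR0 : 0 < sSup τ.support := hb0.trans_le (le_csSup hbdd hbs)
  refine ⟨sSup τ.support, hR0, ?_⟩
  rw [support_radialMeasure hτ]
  ext x
  refine ⟨fun h => le_csSup hbdd h, fun h => ?_⟩
  -- Downward closedness yields only positive radii; the radius 0 enters by closedness of the
  -- support.
  have hsub : Icc 0 (sSup τ.support) ⊆ τ.support := by
    rw [← closure_Ioo hR0.ne]
    exact closure_minimal (fun r hr => hdown r _ hr.1 hr.2 hRs) hclosed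
  exact hsub ⟨hypDist_nonneg _ _, h⟩
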